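/- Let $(M,J,\Theta)$ be an oriented pseudohermitian 3-manifold: $M$ is a smooth paracompact Hausdorff 3-manifold, $\Theta$ a smooth contact form, $J$ a smooth endomorphism of $\xi=\ker\Theta$ with $J^2=-1$ and $d\Theta(X,JX)>0$ for $0\ne X\in\xi$. Let $T$ be the Reeb field of $\Theta$, $G=\frac12 d\Theta(\cdot,J\cdot)$ the Levi metric on $\xi$, and $\nabla$ the pseudohermitian (Tanaka–Webster) connection. A point $p$ of a $C^2$ surface $\Sigma\subset M$ is singular if $T_p\Sigma=\xi_p$. A characteristic field of $\Sigma$ is a continuous field $e_1$ of $G$-unit vectors in $\xi\cap T\Sigma$; put $e_2=Je_1$, and let $(\Theta,e^1,e^2)$ be the coframe dual to $(T,e_1,e_2)$. At a nonsingular point the p-mean curvature $H$ is defined by $\nabla_{e_1}e_1=He_2$, and $\Sigma$ is p-minimal if $H=0$ at all nonsingular points. A nonsingular surface with a characteristic field $e_1$ is oriented by $\Theta\wedge e^1>0$, and $\text{p-Area}(\Sigma)=\int_\Sigma\Theta\wedge e^1$. Let $n\in\{1,2,\dots,\infty\}$ and let $U\subset M$ be an open set such that 1. $U$ is foliated, with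 a foliation of class $C^{n+1}$, by p-minimal surfaces without singular points, and there is a continuous vector field $e_1$ on $U$ that is a characteristic field of every leaf (such a field exists, for example, if the leaves are the level sets $\Sigma_t$ of a $C^{n+1}$ function on $U$ without critical points); 2. every closed 2-form of class $C^n$ on $U$ is the exterior derivative of a 1-form of class $C^n$ on $U$. Let $\Sigma$ be a compact embedded $C^2$ surface, possibly with boundary, contained in a leaf of the foliation, with the characteristic field $e_1$. Let $\Sigma'\subset U$ be any compact embedded $C^2$ surface without singular points, possibly with boundary, with a characteristic field $e_1'$, such that $\Sigma$ and $\Sigma'$ have the same oriented boundary: $\partial\Sigma'=\partial\Sigma$ as sets, and the orientations by $\Theta\wedge e^1$ and $\Theta\wedge e^{1\prime}$ induce the same orientation on this curve. Then $$\text{p-Area}(\Sigma)\le\text{p-Area}(\Sigma').$$ -/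

import Mathlib

open Set MeasureTheory
open scoped Manifold ContDiff Topology ENNReal

noncomputable section

namespace PseudohermitianSurface

/-- The model space of 3-manifolds. -/
abbrev E3 : Type := EuclideanSpace ℝ (Fin 3)

section Forms

/-! ### Differential forms and vector fields on 3-manifolds -/

/-- A (not necessarily continuous) vector field on the 3-manifold `M`. -/
abbrev VField (M : Type*) [TopologicalSpace M] [ChartedSpace E3 M] : Type _ :=
  ∀ p : M, TangentSpace (𝓡 3) p

/-- A (not necessarily continuous) differential `k`-form on the 3-manifold `M`. The value of the
`k`-form `η` at `p` on the tangent vectors `v₁, …, v_k` is `η p ![v₁, …, v_k]`. -/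
abbrev DForm (k : ℕ) (M : Type*) [TopologicalSpace M] [ChartedSpace E3 M] : Type _ :=
  ∀ p : M, TangentSpace (𝓡 3) p [⋀^Fin k]→L[ℝ] ℝ

variable {M : Type*} [TopologicalSpace M] [ChartedSpace E3 M] {k : ℕ}

/-- The expression `(e⁻¹)^* η` of a form `η` in a chart `e`, meaningful on `e.target`. -/
def DForm.inChart (η : DForm k M) (e : OpenPartialHomeomorph M E3) :
    E3 → E3 [⋀^Fin k]→L[ℝ] ℝ := fun x =>
  ContinuousAlternatingMap.compContinuousLinearMap (M := E3) (M' := E3) (η (e.symm x))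
    (mfderiv (𝓡 3) (𝓡 3) e.symm x : E3 →L[ℝ] E3)

/-- The form `η` is of class `C^n` on the open set `U`: its expressions in all smooth charts
are of class `C^n`. -/
def DForm.IsClassOn (n : WithTop ℕ∞) (η : DForm k M) (U : Set M) : Prop :=
  ∀ e ∈ IsManifold.maximalAtlas (𝓡 3) ∞ M,
    ContDiffOn ℝ n (η.inChart e) (e.target ∩ e.symm ⁻¹' U)

/-- The exterior derivative `dη`, computed at the point `p` in the preferred chart at `p` (for a
form of class `C^1` near `p`, every other smooth chart at `p` gives the same result). -/
def DForm.d (η : DForm k M) : DForm (k + 1) M := fun p =>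
  ContinuousAlternatingMap.compContinuousLinearMap (M := E3) (M' := E3)
    (extDeriv (η.inChart (chartAt E3 p)) (chartAt E3 p p))
    (mfderiv (𝓡 3) (𝓡 3) (chartAt E3 p) p : E3 →L[ℝ] E3)

/-- The interior product `i_X η` of a 2-form with a vector field: `(i_X η)(w) = η(X, w)`. -/
def DForm.interior (X : VField M) (η : DForm 2 M) : DForm 1 M := fun p =>
  ContinuousAlternatingMap.curryLeft (E := E3) (η p) (X p)

/-- The value `(α ∧ β)(u, v)` at `p` of the wedge product of two 1-forms. -/
def wedge (α β : DForm 1 M) (p : M) (u v : TangentSpace (𝓡 3) p) : ℝ :=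
  α p ![u] * β p ![v] - α p ![v] * β p ![u]

/-- The vector field `X` is of class `C^n` on `U`. -/
def VField.IsClassOn [IsManifold (𝓡 3) ∞ M] (n : WithTop ℕ∞) (X : VField M) (U : Set M) : Prop :=
  ContMDiffOn (𝓡 3) (𝓡 3).tangent n (fun p => (⟨p, X p⟩ : TangentBundle (𝓡 3) M)) U

end Forms

/-- An (oriented) pseudohermitian structure on the 3-manifold `M`: a smooth contact form `Θ` and
a smooth endomorphism `J` with `J² = -1` of the contact bundle `ξ = ker Θ`, such that
`dΘ(X, JX) > 0` for all nonzero `X ∈ ξ` (which makes `Θ` a contact form). For convenience `J` is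
given as the restriction to `ξ` of a smooth endomorphism of `TM`; nothing below uses the values
of that endomorphism outside `ξ`. -/
structure PseudohermitianStructure (M : Type*) [TopologicalSpace M] [ChartedSpace E3 M] where
  Θ : DForm 1 M
  J : ∀ p : M, TangentSpace (𝓡 3) p →L[ℝ] TangentSpace (𝓡 3) p
  Θ_smooth : Θ.IsClassOn ∞ univ
  Θ_ne_zero : ∀ p, Θ p ≠ 0
  J_smooth : ∀ e ∈ IsManifold.maximalAtlas (𝓡 3) ∞ M,
    ContDiffOn ℝ ∞ (fun x : E3 =>
      ContinuousLinearMap.comp (mfderiv (𝓡 3) (𝓡 3) e (e.symm x) : E3 →L[ℝ] E3)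
        (ContinuousLinearMap.comp (J (e.symm x) : E3 →L[ℝ] E3)
          (mfderiv (𝓡 3) (𝓡 3) e.symm x : E3 →L[ℝ] E3))) e.target
  J_mem : ∀ p (v : TangentSpace (𝓡 3) p), Θ p ![v] = 0 → Θ p ![J p v] = 0
  J_sq : ∀ p (v : TangentSpace (𝓡 3) p), Θ p ![v] = 0 → J p (J p v) = -v
  pos : ∀ p (v : TangentSpace (𝓡 3) p), Θ p ![v] = 0 → v ≠ 0 → 0 < Θ.d p ![v, J p v]

section Pseudohermitian

/-! ### The Levi metric, unitary frames and the pseudohermitian connection -/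

variable {M : Type*} [TopologicalSpace M] [ChartedSpace E3 M]

/-- The Levi metric `G = ½ dΘ(·, J·)` on the contact bundle. -/
def PseudohermitianStructure.levi (P : PseudohermitianStructure M) (p : M)
    (u v : TangentSpace (𝓡 3) p) : ℝ :=
  (1 / 2) * P.Θ.d p ![u, P.J p v]

/-- The tangent vector `v` lies in the contact plane `ξ_p` and has length one there. -/
def PseudohermitianStructure.IsUnitLegendrian (P : PseudohermitianStructure M) (p : M)
    (v : TangentSpace (𝓡 3) p) : Prop :=
  P.Θ p ![v] = 0 ∧ P.levi p v v = 1

/-- For a unit Legendrian field `X = e₁` and `e₂ = J e₁`, the 1-form `e¹` of the coframe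
`(Θ, e¹, e²)` dual to `(T, e₁, e₂)`, `T` being the Reeb field: since `dΘ = 2 e¹ ∧ e²`, it is
`e¹ = -½ i_{e₂} dΘ`. See `coframe₁_apply_self` and the lemmas that follow it. -/
def PseudohermitianStructure.coframe₁ (P : PseudohermitianStructure M) (X : VField M) :
    DForm 1 M := fun p =>
  (-(1 / 2) : ℝ) • DForm.interior (fun q => P.J q (X q)) P.Θ.d p

/-- For a unit Legendrian field `X = e₁` and `e₂ = J e₁`, the 1-form `e² = ½ i_{e₁} dΘ` of the
coframe `(Θ, e¹, e²)` dual to `(T, e₁, e₂)`. -/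
def PseudohermitianStructure.coframe₂ (P : PseudohermitianStructure M) (X : VField M) :
    DForm 1 M := fun p =>
  (1 / 2 : ℝ) • DForm.interior X P.Θ.d p

variable (P : PseudohermitianStructure M)

theorem PseudohermitianStructure.coframe₁_apply (X : VField M) (p : M)
    (w : TangentSpace (𝓡 3) p) :
    P.coframe₁ X p ![w] = (1 / 2) * P.Θ.d p ![w, P.J p (X p)] := by
  have h : P.Θ.d p ![w, P.J p (X p)] = -P.Θ.d p ![P.J p (X p), w] := by
    have h1 := (P.Θ.d p).toAlternatingMap.map_swap ![P.J p (X p), w]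
      (i := (0 : Fin 2)) (j := 1) (by decide)
    have h2 : (![P.J p (X p), w] ∘ (Equiv.swap (0 : Fin 2) 1)) = ![w, P.J p (X p)] := by
      funext i; fin_cases i <;> simp
    rw [h2] at h1
    exact h1
  rw [h]
  change (-(1 / 2) : ℝ) * P.Θ.d p ![P.J p (X p), w] = _
  ring

theorem PseudohermitianStructure.coframe₂_apply (X : VField M) (p : M)
    (w : TangentSpace (𝓡 3) p) :
    P.coframe₂ X p ![w] = (1 / 2) * P.Θ.d p ![X p, w] := rfl

/-- `e¹(e₁) = 1`. -/
theorem PseudohermitianStructure.coframe₁_apply_self (X : VField M) (p : M)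
    (h : P.IsUnitLegendrian p (X p)) : P.coframe₁ X p ![X p] = 1 := by
  rw [P.coframe₁_apply]; exact h.2

/-- `e¹(e₂) = 0`. -/
theorem PseudohermitianStructure.coframe₁_apply_J (X : VField M) (p : M) :
    P.coframe₁ X p ![P.J p (X p)] = 0 := by
  rw [P.coframe₁_apply, (P.Θ.d p).map_eq_zero_of_eq _ (i := 0) (j := 1) rfl (by decide), mul_zero]

/-- `e¹(T) = 0`. -/
theorem PseudohermitianStructure.coframe₁_apply_reeb (X : VField M) (p : M)
    (T : TangentSpace (𝓡 3) p) (hT : ∀ w, P.Θ.d p ![T, w] = 0) : P.coframe₁ X p ![T] = 0 := by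
  rw [P.coframe₁_apply, hT, mul_zero]

/-- `e²(e₁) = 0`. -/
theorem PseudohermitianStructure.coframe₂_apply_self (X : VField M) (p : M) :
    P.coframe₂ X p ![X p] = 0 := by
  rw [P.coframe₂_apply, (P.Θ.d p).map_eq_zero_of_eq _ (i := 0) (j := 1) rfl (by decide), mul_zero]

/-- `e²(e₂) = 1`. -/
theorem PseudohermitianStructure.coframe₂_apply_J (X : VField M) (p : M)
    (h : P.IsUnitLegendrian p (X p)) : P.coframe₂ X p ![P.J p (X p)] = 1 := by
  rw [P.coframe₂_apply]; exact h.2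

/-- `η` is, over `V`, the real connection form (`ω₁¹ = iη`) of the pseudohermitian connection in
the unitary frame `e₁ = X`, `e₂ = J X`: with `θ¹ = e¹ + i e²`, it solves the structure equation
`dθ¹ = θ¹ ∧ (iη) + A Θ ∧ conj θ¹` for some complex-valued function `A` (the torsion).
The purely imaginary form `iη` is the solution `ω₁¹` of this equation that satisfies the
normalization `ω₁¹ + conj ω₁¹ = 0`. -/
def IsConnectionForm (V : Set M) (X : VField M) (η : DForm 1 M) : Prop :=
  ∃ A : M → ℂ, ∀ p ∈ V, ∀ u v : TangentSpace (𝓡 3) p,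
    let θ : TangentSpace (𝓡 3) p → ℂ := fun w =>
      (P.coframe₁ X p ![w] : ℂ) + Complex.I * (P.coframe₂ X p ![w] : ℂ)
    ((P.coframe₁ X).d p ![u, v] : ℂ) + Complex.I * ((P.coframe₂ X).d p ![u, v] : ℂ) =
      (θ u * (Complex.I * (η p ![v] : ℂ)) - θ v * (Complex.I * (η p ![u] : ℂ))) +
      A p * ((P.Θ p ![u] : ℂ) * (starRingEnd ℂ) (θ v)
        - (P.Θ p ![v] : ℂ) * (starRingEnd ℂ) (θ u))

/-- The covariant derivative `∇_v e₁ = η(v) e₂` of the field `e₁ = X` at `p` in the direction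
`v`, where `∇` is the pseudohermitian connection and `η` its connection form in the frame
`X, J X`. -/
def covDeriv (X : VField M) (η : DForm 1 M) (p : M) (v : TangentSpace (𝓡 3) p) :
    TangentSpace (𝓡 3) p :=
  η p ![v] • P.J p (X p)

end Pseudohermitian

section Surfaces

/-! ### Embedded surfaces with boundary -/

variable {M : Type*} [TopologicalSpace M] [ChartedSpace E3 M]

/-- The model half-plane `{x₃ = 0, x₁ ≥ 0}` in `ℝ³`. -/
def halfPlane : Set E3 := {x | x 2 = 0 ∧ 0 ≤ x 0}

/-- The components `de_p(v)` of the tangent vector `v` at `p` in the chart `e`. -/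
def components (e : OpenPartialHomeomorph M E3) (p : M) (v : TangentSpace (𝓡 3) p) : E3 :=
  mfderiv (𝓡 3) (𝓡 3) e p v

/-- A `C²` chart of `M` that carries `S` to the half-plane `{x₃ = 0, x₁ ≥ 0}`. -/
def IsFlatChart (S : Set M) (e : OpenPartialHomeomorph M E3) : Prop :=
  e ∈ IsManifold.maximalAtlas (𝓡 3) 2 M ∧ e.IsImage S halfPlane

/-- `S` is an embedded `C²` surface in `M`, possibly with boundary: around each of its points, a
`C²` chart of `M` carries `S` to the half-plane. (For interior points, use a chart whose target
lies in `{x₁ > 0}`.) -/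
def IsSurface (S : Set M) : Prop :=
  ∀ p ∈ S, ∃ e, IsFlatChart S e ∧ p ∈ e.source

/-- The boundary `∂S` of a surface with boundary. -/
def boundary (S : Set M) : Set M :=
  {p | p ∈ S ∧ ∃ e, IsFlatChart S e ∧ p ∈ e.source ∧ e p 0 = 0}

/-- `v` lies in the tangent plane `T_pS` of the surface `S`. -/
def IsTangent (S : Set M) (p : M) (v : TangentSpace (𝓡 3) p) : Prop :=
  ∃ e, IsFlatChart S e ∧ p ∈ e.source ∧ components e p v 2 = 0

/-- `w` is tangent, at the boundary point `p` of `S`, to the curve `∂S`. -/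
def IsBoundaryTangent (S : Set M) (p : M) (w : TangentSpace (𝓡 3) p) : Prop :=
  ∃ e, IsFlatChart S e ∧ p ∈ e.source ∧ e p 0 = 0 ∧
    components e p w 2 = 0 ∧ components e p w 0 = 0

/-- `ν` is tangent to `S` at the boundary point `p` and points strictly out of `S`. -/
def IsOutward (S : Set M) (p : M) (ν : TangentSpace (𝓡 3) p) : Prop :=
  ∃ e, IsFlatChart S e ∧ p ∈ e.source ∧ e p 0 = 0 ∧
    components e p ν 2 = 0 ∧ components e p ν 0 < 0

end Surfaces

section PGeometry

/-! ### p-minimal surfaces and p-area -/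

variable {M : Type*} [TopologicalSpace M] [ChartedSpace E3 M] [IsManifold (𝓡 3) ∞ M]
  (P : PseudohermitianStructure M)

/-- `p` is a singular point of `S`: the contact plane at `p` is the tangent plane of `S`. -/
def IsSingularPoint (S : Set M) (p : M) : Prop :=
  ∀ v : TangentSpace (𝓡 3) p, IsTangent S p v ↔ P.Θ p ![v] = 0

/-- The surface `S` has no singular points. -/
def IsNonsingular (S : Set M) : Prop :=
  ∀ p ∈ S, ¬ IsSingularPoint P S p

/-- `H` is the p-mean curvature of the surface `S` at its point `p` (for one of the two choices
of the sign of `e₁`): `∇_{e₁} e₁ = H e₂` at `p`, where `∇` is the pseudohermitian connection,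
`e₂ = J e₁`, and `e₁` is a characteristic field of `S`, that is a unit Legendrian field tangent
to `S` along `S`, extended to a unit Legendrian field `X` of class `C¹` on a neighbourhood `V`
of `p` in `M`. -/
def HasPMeanCurvature (S : Set M) (p : M) (H : ℝ) : Prop :=
  ∃ (V : Set M) (X : VField M) (η : DForm 1 M),
    IsOpen V ∧ p ∈ V ∧ X.IsClassOn 1 V ∧ (∀ q ∈ V, P.IsUnitLegendrian q (X q)) ∧
    (∀ q ∈ V ∩ S, IsTangent S q (X q)) ∧ IsConnectionForm P V X η ∧
    covDeriv P X η p (X p) = H • P.J p (X p)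

/-- The surface `S` is p-minimal: its p-mean curvature vanishes at every nonsingular point. -/
def IsPMinimal (S : Set M) : Prop :=
  ∀ p ∈ S, ¬ IsSingularPoint P S p → ∀ H, HasPMeanCurvature P S p H → H = 0

/-- `X` is a (continuous) characteristic field `e₁` on the surface `S`: a field of unit vectors
in `ξ ∩ TS`. On a nonsingular surface it amounts to an orientation of `S`, the one for
which the p-area form `Θ ∧ e¹` is positive. -/
def IsCharacteristicField (S : Set M) (X : VField M) : Prop :=
  X.IsClassOn 0 S ∧ ∀ p ∈ S, P.IsUnitLegendrian p (X p) ∧ IsTangent S p (X p)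

/-- The value of the p-area form `Θ ∧ e¹` on a pair of tangent vectors at `p`. -/
def pAreaForm (X : VField M) (p : M) (u v : TangentSpace (𝓡 3) p) : ℝ :=
  wedge P.Θ (P.coframe₁ X) p u v

/-- The inclusion of the coordinate plane `{x₃ = 0}`. -/
def planePoint (y : ℝ × ℝ) : E3 := !₂[y.1, y.2, 0]

/-- The coordinate vectors `∂/∂x₁` (`i = 0`) and `∂/∂x₂` (`i = 1`) of the chart `e` at the point
with coordinates `x`. -/
def coordVec (e : OpenPartialHomeomorph M E3) (i : Fin 3) (x : E3) :
    TangentSpace (𝓡 3) (e.symm x) :=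
  mfderiv (𝓡 3) (𝓡 3) e.symm x (EuclideanSpace.single i (1 : ℝ) : E3)

/-- The p-area measure of the part of `S` in the domain of the flat chart `e`: in the local
coordinates `(s, t)` on `S` provided by `e`, it has the density `|(Θ ∧ e¹)(∂_s, ∂_t)|` with
respect to the Lebesgue measure `ds dt`. -/
def chartPArea [MeasurableSpace M] (X : VField M) (e : OpenPartialHomeomorph M E3) : Measure M :=
  Measure.map (fun y : ℝ × ℝ => e.symm (planePoint y))
    ((volume.restrict {y : ℝ × ℝ | planePoint y ∈ e.target ∧ 0 ≤ y.1}).withDensity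
      (fun y => ENNReal.ofReal
        |pAreaForm P X (e.symm (planePoint y))
          (coordVec e 0 (planePoint y)) (coordVec e 1 (planePoint y))|))

/-- The p-area measure of the surface `S` with characteristic field `X = e₁`: the least measure
that dominates the p-area measures in all flat charts. As these agree on overlaps, it is
the measure which coincides with each of them in the domain of the chart. -/
def pAreaMeasure [MeasurableSpace M] (S : Set M) (X : VField M) : Measure M :=
  ⨆ e ∈ {e : OpenPartialHomeomorph M E3 | IsFlatChart S e}, chartPArea P X e

/-- The p-area `∫_S Θ ∧ e¹` of `S`, where `S` is oriented so that `Θ ∧ e¹` is positive. -/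
def pArea [MeasurableSpace M] (S : Set M) (X : VField M) : ℝ≥0∞ :=
  pAreaMeasure P S X S

/-- The surfaces `S` and `S'`, oriented by `Θ ∧ e¹` and `Θ ∧ e¹'` for their characteristic fields
`X` and `X'`, have the same boundary: `∂S = ∂S'`, and both surfaces induce the same orientation
on this curve (a vector `w` tangent to it is positive for `S` if `(ν, w)` is positively oriented
for the vectors `ν` that point out of `S`). -/
def SameOrientedBoundary (S : Set M) (X : VField M) (S' : Set M) (X' : VField M) : Prop :=
  boundary S = boundary S' ∧
  ∀ p ∈ boundary S, ∀ w ν ν' : TangentSpace (𝓡 3) p,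
    IsBoundaryTangent S p w → IsBoundaryTangent S' p w → IsOutward S p ν → IsOutward S' p ν' →
      (0 < pAreaForm P X p ν w ↔ 0 < pAreaForm P X' p ν' w)

end PGeometry

section Foliations

/-! ### Foliations by surfaces -/

variable {M : Type*} [TopologicalSpace M] [ChartedSpace E3 M]

/-- The slice `{x₃ = c}` of the chart `e`. -/
def slice (e : OpenPartialHomeomorph M E3) (c : ℝ) : Set M := {q | q ∈ e.source ∧ e q 2 = c}

/-- `e` is a foliated chart of class `C^k` in `U` for the family `F` of subsets: each member
of the family meets the domain of `e` in at most countably many slices `{x₃ = c}`. -/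
def IsFoliatedChart {ι : Type*} (k : WithTop ℕ∞) (U : Set M) (F : ι → Set M)
    (e : OpenPartialHomeomorph M E3) : Prop :=
  e ∈ IsManifold.maximalAtlas (𝓡 3) k M ∧ e.source ⊆ U ∧
    ∀ i, ∃ C : Set ℝ, C.Countable ∧ ∀ q ∈ e.source, q ∈ F i ↔ e q 2 ∈ C

/-- The family `F` of surfaces foliates `U` (the foliation being of class `C^k`). -/
structure IsFoliation {ι : Type*} (k : WithTop ℕ∞) (U : Set M) (F : ι → Set M) : Prop where
  iUnion_eq : ⋃ i, F i = U
  disjoint : Pairwise (fun i j => Disjoint (F i) (F j))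
  exists_chart : ∀ p ∈ U, ∃ e, IsFoliatedChart k U F e ∧ p ∈ e.source

end Foliations

end PseudohermitianSurface

end

open PseudohermitianSurface

noncomputable section

set_option linter.unusedSectionVars false

namespace PseudohermitianSurface

/-! ### Regularity of maps into spaces of alternating forms -/

section AlternatingCalculus

variable {E F G : Type*} [NormedAddCommGroup E] [NormedSpace ℝ E]
  [NormedAddCommGroup F] [NormedSpace ℝ F] [NormedAddCommGroup G] [NormedSpace ℝ G]

/-! The proof is a calibration argument. Let σ = Θ ∧ e¹ be the p-area form of the characteristic
field e₁ of the foliation. Its integral over S is p-Area(S). It is closed because the leaves are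
p-minimal: dσ = dΘ ∧ e¹ - Θ ∧ de¹, where the first term vanishes since dΘ = 2 e¹ ∧ e², and the
second is -de¹(e₁, e₂) Θ ∧ e¹ ∧ e². By the structure equation de¹(e₁, e₂) = η(e₁), and η(e₁) is the
p-mean curvature of the leaf, which is zero (`d_areaForm_eq_zero_of_isPMinimal`).

On the competitor, let σ' = Θ ∧ e¹'. The vector e₁' is tangent to S' and Θ(e₁') = 0, so contraction
with e₁' shows that σ = e¹(e₁') σ' on the tangent planes of S' (`areaForm_density_eq`). As e₁ and
e₁' are unit vectors of the same contact plane, |e¹(e₁')| ≤ 1 (`abs_eOne_le`). The closed form σ is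
exact on U, say σ = dΨ, and Stokes gives p-Area(S) = ∫_S dΨ = ∫_S' dΨ = ∫_S' σ ≤ p-Area(S').

Three points need care. First, e₁ is only assumed continuous, whereas exactness needs a form of
class C^n. But e₁ is a unit vector in the line where two plane fields of class C^n meet, so it is
given by an algebraic formula up to a sign, and continuity fixes the sign locally
(`contDiffOn_of_unit`). Second, S only lies in a leaf, and a leaf may cross a foliated chart in
countably many slices; a continuous function with countably many values on an interval is constant,
so S is tangent to the slices (`IsFlatChart.fderiv_transition_foliated`).

Third, Stokes is used only to compare two surfaces (`surfIntegral_d_eq_surfIntegral_d`). The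
integral of η over a surface oriented by an area form σ is the integral of the function η/σ for the
measure |σ| (`formRatio`, `surfMeasure`), so the orientation is carried by σ. Bump functions cut Ψ
into pieces supported in charts. Each piece reduces to Stokes in a half-plane, and the boundary
terms for S and S' are matched by a change of variable along the common boundary, the orientation
hypothesis supplying the sign (`sign_density_eq`). -/

theorem contDiffOn_alternating_apply {m : WithTop ℕ∞} {k : ℕ} {f : E → F [⋀^Fin k]→L[ℝ] G}
    {g : Fin k → E → F} {s : Set E} (hf : ContDiffOn ℝ m f s) (hg : ∀ i, ContDiffOn ℝ m (g i) s) :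
    ContDiffOn ℝ m (fun x => f x (fun i => g i x)) s := by
  induction k with
  | zero =>
    have h : (fun x => f x (fun i => g i x)) =
        fun x => (ContinuousMultilinearMap.apply ℝ (fun _ : Fin 0 => F) G (fun i => 0))
          ((ContinuousAlternatingMap.toContinuousMultilinearMapCLM ℝ) (f x)) := by
      funext x
      simp only [ContinuousMultilinearMap.apply_apply]
      exact congrArg (f x) (Subsingleton.elim _ _)
    rw [h]
    exact (ContinuousLinearMap.contDiff _).comp_contDiffOn
      ((ContinuousLinearMap.contDiff _).comp_contDiffOn hf)
  | succ k ih =>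
    have h0 : ContDiff ℝ m (fun A : F [⋀^Fin (k + 1)]→L[ℝ] G => A.curryLeft) := by
      let L : (F [⋀^Fin (k + 1)]→L[ℝ] G) →L[ℝ] (F →L[ℝ] F [⋀^Fin k]→L[ℝ] G) :=
        (ContinuousAlternatingMap.curryLeftLI (𝕜 := ℝ) (E := F) (F := G)
          (n := k)).toContinuousLinearMap
      exact ContinuousLinearMap.contDiff (𝕜 := ℝ) (E := F [⋀^Fin (k + 1)]→L[ℝ] G)
        (F := F →L[ℝ] F [⋀^Fin k]→L[ℝ] G) L
    -- Filling the first slot leaves a family of forms of lower degree, to which the induction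
    -- hypothesis applies.
    have h1 : ContDiffOn ℝ m (fun x => (f x).curryLeft (g 0 x)) s :=
      ContDiffOn.clm_apply (f := fun x => (f x).curryLeft) (h0.comp_contDiffOn hf) (hg 0)
    refine (ih h1 (fun i => hg i.succ)).congr fun x _ => ?_
    rw [ContinuousAlternatingMap.curryLeft_apply_apply]
    congr 1
    funext i
    refine Fin.cases ?_ (fun j => ?_) i <;> simp

/-- Evaluation on tuples of basis vectors is an injective linear map into a finite-dimensional
space. It has a linear left inverse, which recovers the form from its coefficients. -/
theorem contDiffOn_alternating_iff {m : WithTop ℕ∞} {k : ℕ} [FiniteDimensional ℝ F]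
    {f : E → F [⋀^Fin k]→L[ℝ] ℝ} {s : Set E} :
    ContDiffOn ℝ m f s ↔ ∀ v : Fin k → F, ContDiffOn ℝ m (fun x => f x v) s := by
  refine ⟨fun hf v => contDiffOn_alternating_apply hf fun i => contDiffOn_const, fun hf => ?_⟩
  let b := Module.finBasis ℝ F
  let ev : (F [⋀^Fin k]→L[ℝ] ℝ) →ₗ[ℝ] ((Fin k → Fin (Module.finrank ℝ F)) → ℝ) :=
    { toFun := fun A σ => A (fun i => b (σ i))
      map_add' := fun _ _ => rfl
      map_smul' := fun _ _ => rfl }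
  have hev : LinearMap.ker ev = ⊥ := by
    rw [LinearMap.ker_eq_bot]
    intro A B h
    have : A.toMultilinearMap = B.toMultilinearMap :=
      Module.Basis.ext_multilinear (fun _ => b) fun σ => congrFun h σ
    ext v
    exact congrArg (fun C : MultilinearMap ℝ (fun _ : Fin k => F) ℝ => C v) this
  obtain ⟨L, hL⟩ := LinearMap.exists_leftInverse_of_injective ev hev
  have h : f = fun x => LinearMap.toContinuousLinearMap L (ev (f x)) := by
    funext x
    exact (LinearMap.congr_fun hL (f x)).symm
  rw [h]
  refine (ContinuousLinearMap.contDiff _).comp_contDiffOn (contDiffOn_pi.2 fun σ => hf _)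

theorem contDiffOn_compContinuousLinearMap {m : WithTop ℕ∞} {k : ℕ} [FiniteDimensional ℝ G]
    {f : E → F [⋀^Fin k]→L[ℝ] ℝ} {g : E → G →L[ℝ] F} {s : Set E}
    (hf : ContDiffOn ℝ m f s) (hg : ContDiffOn ℝ m g s) :
    ContDiffOn ℝ m (fun x => (f x).compContinuousLinearMap (g x)) s := by
  rw [contDiffOn_alternating_iff]
  intro v
  exact contDiffOn_alternating_apply (g := fun i x => g x (v i)) hf
    fun i => hg.clm_apply contDiffOn_const

theorem contDiffOn_extDeriv {m : WithTop ℕ∞} {k : ℕ} {f : E → E [⋀^Fin k]→L[ℝ] ℝ} {s : Set E}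
    (hs : IsOpen s) (hf : ContDiffOn ℝ (m + 1) f s) : ContDiffOn ℝ m (extDeriv f) s := by
  have h : ContDiff ℝ m
      (fun A : E →L[ℝ] E [⋀^Fin k]→L[ℝ] ℝ => ContinuousAlternatingMap.alternatizeUncurryFin A) := by
    let L : (E →L[ℝ] E [⋀^Fin k]→L[ℝ] ℝ) →L[ℝ] (E [⋀^Fin (k + 1)]→L[ℝ] ℝ) :=
      ContinuousAlternatingMap.alternatizeUncurryFinCLM ℝ E ℝ
    exact ContinuousLinearMap.contDiff (𝕜 := ℝ) (E := E →L[ℝ] E [⋀^Fin k]→L[ℝ] ℝ)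
      (F := E [⋀^Fin (k + 1)]→L[ℝ] ℝ) L
  exact h.comp_contDiffOn (hf.fderiv_of_isOpen hs le_rfl)

end AlternatingCalculus

/-! ### Charts, coordinate changes and the exterior derivative -/

section Charts

theorem two_le_infty : (2 : WithTop ℕ∞) ≤ (∞ : WithTop ℕ∞) := by
  exact WithTop.coe_le_coe.2 (le_top : (2 : ℕ∞) ≤ ⊤)

theorem one_le_infty : (1 : WithTop ℕ∞) ≤ (∞ : WithTop ℕ∞) := by
  exact WithTop.coe_le_coe.2 (le_top : (1 : ℕ∞) ≤ ⊤)

variable {M : Type*} [TopologicalSpace M] [ChartedSpace E3 M]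

/-- The derivative of the chart `e` at `p`. -/
def dChart (e : OpenPartialHomeomorph M E3) (p : M) : E3 →L[ℝ] E3 := mfderiv (𝓡 3) (𝓡 3) e p

/-- The derivative of the inverse of the chart `e` at `x`. -/
def dChartSymm (e : OpenPartialHomeomorph M E3) (x : E3) : E3 →L[ℝ] E3 :=
  mfderiv (𝓡 3) (𝓡 3) e.symm x

/-- The coordinate change from `e` to `e'`. -/
def transition (e e' : OpenPartialHomeomorph M E3) : E3 → E3 := fun x => e' (e.symm x)

/-- The domain of the coordinate change from `e` to `e'`. -/
def overlap (e e' : OpenPartialHomeomorph M E3) : Set E3 := e.target ∩ e.symm ⁻¹' e'.source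

theorem isOpen_overlap (e e' : OpenPartialHomeomorph M E3) : IsOpen (overlap e e') :=
  e.isOpen_inter_preimage_symm e'.open_source

theorem isOpen_target_inter (e : OpenPartialHomeomorph M E3) {U : Set M} (hU : IsOpen U) :
    IsOpen (e.target ∩ e.symm ⁻¹' U) :=
  e.isOpen_inter_preimage_symm hU

theorem transition_mem {e e' : OpenPartialHomeomorph M E3} {x : E3} (hx : x ∈ overlap e e') :
    transition e e' x ∈ overlap e' e := by
  refine ⟨e'.map_source hx.2, ?_⟩
  change e'.symm (e' (e.symm x)) ∈ e.source
  rw [e'.left_inv hx.2]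
  exact e.map_target hx.1

theorem symm_transition {e e' : OpenPartialHomeomorph M E3} {x : E3} (hx : x ∈ overlap e e') :
    e'.symm (transition e e' x) = e.symm x := e'.left_inv hx.2

theorem transition_transition {e e' : OpenPartialHomeomorph M E3} {x : E3}
    (hx : x ∈ overlap e e') : transition e' e (transition e e' x) = x := by
  change e (e'.symm (transition e e' x)) = x
  rw [symm_transition hx, e.right_inv hx.1]

theorem mem_overlap_of_mem {e e' : OpenPartialHomeomorph M E3} {p : M} (hp : p ∈ e.source)
    (hp' : p ∈ e'.source) : e p ∈ overlap e e' :=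
  ⟨e.map_source hp, by simpa [e.left_inv hp] using hp'⟩

theorem transition_apply {e e' : OpenPartialHomeomorph M E3} {p : M} (hp : p ∈ e.source) :
    transition e e' (e p) = e' p := by
  simp [transition, e.left_inv hp]

variable {k : WithTop ℕ∞} {e e' : OpenPartialHomeomorph M E3}

theorem mdifferentiableAt_chart (he : e ∈ IsManifold.maximalAtlas (𝓡 3) k M) (hk : 1 ≤ k) {p : M}
    (hp : p ∈ e.source) : MDifferentiableAt (𝓡 3) (𝓡 3) e p :=
  mdifferentiableAt_of_mem_maximalAtlas (IsManifold.maximalAtlas_subset_of_le hk he) hp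

theorem mdifferentiableAt_chart_symm (he : e ∈ IsManifold.maximalAtlas (𝓡 3) k M) (hk : 1 ≤ k)
    {x : E3} (hx : x ∈ e.target) : MDifferentiableAt (𝓡 3) (𝓡 3) e.symm x :=
  mdifferentiableAt_symm_of_mem_maximalAtlas (IsManifold.maximalAtlas_subset_of_le hk he) hx

variable [IsManifold (𝓡 3) ∞ M]

theorem dChart_dChartSymm (he : e ∈ IsManifold.maximalAtlas (𝓡 3) k M) (hk : 1 ≤ k)
    {x : E3} (hx : x ∈ e.target) (v : E3) : dChart e (e.symm x) (dChartSymm e x v) = v := by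
  have h : e.MDifferentiable (𝓡 3) (𝓡 3) :=
    ⟨fun p hp => (mdifferentiableAt_chart he hk hp).mdifferentiableWithinAt,
      fun p hp => (mdifferentiableAt_chart_symm he hk hp).mdifferentiableWithinAt⟩
  exact DFunLike.congr_fun (h.comp_symm_deriv hx) v

theorem dChartSymm_dChart (he : e ∈ IsManifold.maximalAtlas (𝓡 3) k M) (hk : 1 ≤ k)
    {p : M} (hp : p ∈ e.source) (v : E3) : dChartSymm e (e p) (dChart e p v) = v := by
  have h : e.MDifferentiable (𝓡 3) (𝓡 3) :=
    ⟨fun p hp => (mdifferentiableAt_chart he hk hp).mdifferentiableWithinAt,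
      fun p hp => (mdifferentiableAt_chart_symm he hk hp).mdifferentiableWithinAt⟩
  exact DFunLike.congr_fun (h.symm_comp_deriv hp) v

theorem dChartSymm_dChart' (he : e ∈ IsManifold.maximalAtlas (𝓡 3) k M) (hk : 1 ≤ k)
    {x : E3} (hx : x ∈ e.target) (v : E3) : dChartSymm e x (dChart e (e.symm x) v) = v := by
  have := dChartSymm_dChart he hk (e.map_target hx) v
  rwa [e.right_inv hx] at this

theorem fderiv_transition (he : e ∈ IsManifold.maximalAtlas (𝓡 3) k M)
    (he' : e' ∈ IsManifold.maximalAtlas (𝓡 3) k M) (hk : 1 ≤ k) {x : E3}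
    (hx : x ∈ overlap e e') :
    fderiv ℝ (transition e e') x = (dChart e' (e.symm x)).comp (dChartSymm e x) := by
  have h := mfderiv_comp x (mdifferentiableAt_chart he' hk hx.2)
    (mdifferentiableAt_chart_symm he hk hx.1)
  rw [← mfderiv_eq_fderiv]
  exact h

theorem contDiffOn_transition (he : e ∈ IsManifold.maximalAtlas (𝓡 3) k M)
    (he' : e' ∈ IsManifold.maximalAtlas (𝓡 3) k M) :
    ContDiffOn ℝ k (transition e e') (overlap e e') := by
  rw [← contMDiffOn_iff_contDiffOn]
  exact (contMDiffOn_of_mem_maximalAtlas he').comp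
    ((contMDiffOn_symm_of_mem_maximalAtlas he).mono inter_subset_left) inter_subset_right

theorem differentiableAt_transition (he : e ∈ IsManifold.maximalAtlas (𝓡 3) k M)
    (he' : e' ∈ IsManifold.maximalAtlas (𝓡 3) k M) (hk : 1 ≤ k) {x : E3}
    (hx : x ∈ overlap e e') : DifferentiableAt ℝ (transition e e') x :=
  ((contDiffOn_transition he he').contDiffAt ((isOpen_overlap e e').mem_nhds hx)).differentiableAt
    (by positivity)

/-- Expressions of a form in two charts are related by pull-back. -/
theorem DForm.inChart_eq_pullback {r : ℕ} (η : DForm r M)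
    (he : e ∈ IsManifold.maximalAtlas (𝓡 3) k M)
    (he' : e' ∈ IsManifold.maximalAtlas (𝓡 3) k M) (hk : 1 ≤ k) {x : E3}
    (hx : x ∈ overlap e e') :
    η.inChart e x = (η.inChart e' (transition e e' x)).compContinuousLinearMap
      (fderiv ℝ (transition e e') x) := by
  ext v
  have hy := (transition_mem hx).1
  have h1 : ∀ i, dChartSymm e' (transition e e' x) (fderiv ℝ (transition e e') x (v i)) =
      dChartSymm e x (v i) := by
    intro i
    rw [fderiv_transition he he' hk hx]
    exact dChartSymm_dChart he' hk hx.2 _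
  change η (e.symm x) (fun i => dChartSymm e x (v i)) =
    η (e'.symm (transition e e' x)) (fun i => dChartSymm e' (transition e e' x)
      (fderiv ℝ (transition e e') x (v i)))
  simp_rw [h1]
  rw [symm_transition hx]

/-- Pull-back involves the first derivative of the coordinate change, hence charts of class C^(m+1)
for forms of class C^m. -/
theorem DForm.contDiffOn_inChart_of_inChart {r : ℕ} {η : DForm r M} {m : WithTop ℕ∞}
    (he : e ∈ IsManifold.maximalAtlas (𝓡 3) (m + 1) M)
    (he' : e' ∈ IsManifold.maximalAtlas (𝓡 3) (m + 1) M) {A : Set M}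
    (h : ContDiffOn ℝ m (η.inChart e') (e'.target ∩ e'.symm ⁻¹' A)) :
    ContDiffOn ℝ m (η.inChart e) (overlap e e' ∩ e.symm ⁻¹' A) := by
  have hτ := contDiffOn_transition he he'
  have h1 : ContDiffOn ℝ m (fun x => η.inChart e' (transition e e' x))
      (overlap e e' ∩ e.symm ⁻¹' A) := by
    refine h.comp ((hτ.of_le le_self_add).mono inter_subset_left) ?_
    rintro x ⟨hx, hxA⟩
    refine ⟨(transition_mem hx).1, ?_⟩
    change e'.symm (transition e e' x) ∈ A
    rwa [symm_transition hx]
  have h2 : ContDiffOn ℝ m (fderiv ℝ (transition e e')) (overlap e e' ∩ e.symm ⁻¹' A) :=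
    (hτ.fderiv_of_isOpen (isOpen_overlap e e') le_rfl).mono inter_subset_left
  exact (contDiffOn_compContinuousLinearMap h1 h2).congr fun x hx =>
    η.inChart_eq_pullback he he' le_add_self hx.1

theorem chartAt_mem (p : M) (hk : k ≤ (∞ : WithTop ℕ∞)) :
    chartAt E3 p ∈ IsManifold.maximalAtlas (𝓡 3) k M :=
  IsManifold.maximalAtlas_subset_of_le hk (IsManifold.chart_mem_maximalAtlas p)

/-- A form that is `C^m` along `A` in the preferred charts is so in all `C^{m+1}` charts. -/
theorem DForm.contDiffOn_inChart {r : ℕ} {η : DForm r M} {m : WithTop ℕ∞}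
    (hm : m + 1 ≤ (∞ : WithTop ℕ∞)) (he : e ∈ IsManifold.maximalAtlas (𝓡 3) (m + 1) M) {A : Set M}
    (h : ∀ p ∈ A, ContDiffOn ℝ m (η.inChart (chartAt E3 p))
      ((chartAt E3 p).target ∩ (chartAt E3 p).symm ⁻¹' A)) :
    ContDiffOn ℝ m (η.inChart e) (e.target ∩ e.symm ⁻¹' A) := by
  rintro x ⟨hx, hxA⟩
  have h1 := DForm.contDiffOn_inChart_of_inChart he (chartAt_mem (e.symm x) hm)
    (h (e.symm x) hxA)
  have hx' : x ∈ overlap e (chartAt E3 (e.symm x)) := ⟨hx, mem_chart_source _ _⟩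
  refine (h1 x ⟨hx', hxA⟩).mono_of_mem_nhdsWithin ?_
  filter_upwards [self_mem_nhdsWithin, mem_nhdsWithin_of_mem_nhds
    ((isOpen_overlap e (chartAt E3 (e.symm x))).mem_nhds hx')] with y hy hy'
  exact ⟨hy', hy.2⟩

theorem DForm.IsClassOn.contDiffOn_inChart {r : ℕ} {η : DForm r M} {m : WithTop ℕ∞} {A : Set M}
    (hη : η.IsClassOn m A) (hm : m + 1 ≤ (∞ : WithTop ℕ∞))
    (he : e ∈ IsManifold.maximalAtlas (𝓡 3) (m + 1) M) :
    ContDiffOn ℝ m (η.inChart e) (e.target ∩ e.symm ⁻¹' A) :=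
  DForm.contDiffOn_inChart hm he fun p _ => hη _ (chartAt_mem p le_rfl)

/-- The exterior derivative may be computed in any `C²` chart. -/
theorem DForm.d_inChart {r : ℕ} {η : DForm r M} (he : e ∈ IsManifold.maximalAtlas (𝓡 3) 2 M)
    {x : E3} (hx : x ∈ e.target)
    (hη : DifferentiableAt ℝ (η.inChart (chartAt E3 (e.symm x)))
      (chartAt E3 (e.symm x) (e.symm x))) :
    η.d.inChart e x = extDeriv (η.inChart e) x := by
  set c := chartAt E3 (e.symm x) with hc
  have hcm : c ∈ IsManifold.maximalAtlas (𝓡 3) 2 M := chartAt_mem _ two_le_infty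
  have hx' : x ∈ overlap e c := ⟨hx, mem_chart_source _ _⟩
  have h12 : (1 : WithTop ℕ∞) ≤ 2 := one_le_two
  have h1 : η.inChart e =ᶠ[𝓝 x] fun y => (η.inChart c (transition e c y)).compContinuousLinearMap
      (fderiv ℝ (transition e c) y) := by
    filter_upwards [(isOpen_overlap e c).mem_nhds hx'] with y hy
    exact η.inChart_eq_pullback he hcm h12 hy
  -- The exterior derivative commutes with pull-back by maps of class C², the regularity of flat
  -- charts.
  rw [h1.extDeriv_eq, extDeriv_pullback (f := transition e c) (r := 2) hη
    ((contDiffOn_transition he hcm).contDiffAt ((isOpen_overlap e c).mem_nhds hx'))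
    (by simp)]
  rw [fderiv_transition he hcm h12 hx']
  rfl

theorem DForm.IsClassOn.differentiableAt {r : ℕ} {η : DForm r M} {m : WithTop ℕ∞} {U : Set M}
    (hη : η.IsClassOn m U) (hm : 1 ≤ m) (hU : IsOpen U)
    (he : e ∈ IsManifold.maximalAtlas (𝓡 3) ∞ M) {x : E3} (hx : x ∈ e.target)
    (hxU : e.symm x ∈ U) : DifferentiableAt ℝ (η.inChart e) x :=
  ((hη e he).contDiffAt ((isOpen_target_inter e hU).mem_nhds ⟨hx, hxU⟩)).differentiableAt
    (by positivity)

theorem DForm.IsClassOn.d_inChart {r : ℕ} {η : DForm r M} {m : WithTop ℕ∞} {U : Set M}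
    (hη : η.IsClassOn m U) (hm : 1 ≤ m) (hU : IsOpen U)
    (he : e ∈ IsManifold.maximalAtlas (𝓡 3) 2 M) {x : E3} (hx : x ∈ e.target)
    (hxU : e.symm x ∈ U) : η.d.inChart e x = extDeriv (η.inChart e) x :=
  DForm.d_inChart he hx <| hη.differentiableAt hm hU (chartAt_mem _ le_rfl)
    (mem_chart_target _ _) (by rwa [(chartAt E3 (e.symm x)).left_inv (mem_chart_source _ _)])

theorem DForm.IsClassOn.d {r : ℕ} {η : DForm r M} {m : WithTop ℕ∞} {U : Set M}
    (hη : η.IsClassOn (m + 1) U) (hU : IsOpen U) : η.d.IsClassOn m U := by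
  intro e he
  refine (contDiffOn_extDeriv (isOpen_target_inter e hU) (hη e he)).congr fun x hx => ?_
  exact hη.d_inChart le_add_self hU
    (IsManifold.maximalAtlas_subset_of_le two_le_infty he) hx.1 hx.2

/-- The expression of a vector field in a chart. -/
def VField.inChart (X : VField M) (e : OpenPartialHomeomorph M E3) : E3 → E3 :=
  fun x => dChart e (e.symm x) (X (e.symm x))

theorem VField.inChart_eq (X : VField M) (he : e ∈ IsManifold.maximalAtlas (𝓡 3) k M)
    (he' : e' ∈ IsManifold.maximalAtlas (𝓡 3) k M) (hk : 1 ≤ k) {x : E3}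
    (hx : x ∈ overlap e e') :
    X.inChart e' (transition e e' x) = fderiv ℝ (transition e e') x (X.inChart e x) := by
  rw [fderiv_transition he he' hk hx]
  have h := congrArg (dChart e' (e.symm x)) (dChartSymm_dChart' he hk hx.1 (X (e.symm x)))
  exact (congrArg (fun q => dChart e' q (X q)) (symm_transition hx)).trans h.symm

end Charts

/-! ### Linear algebra of forms on ℝ³ -/

section LinearAlgebra

/-- The standard basis of `ℝ³`. -/
def stdVec (i : Fin 3) : E3 := EuclideanSpace.single i (1 : ℝ)

@[simp] theorem stdVec_apply (i j : Fin 3) : stdVec i j = if j = i then 1 else 0 := by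
  simp [stdVec]

theorem eq_sum_stdVec (v : E3) : v = v 0 • stdVec 0 + v 1 • stdVec 1 + v 2 • stdVec 2 := by
  ext i
  fin_cases i <;> simp

variable (A : E3 [⋀^Fin 2]→L[ℝ] ℝ)

theorem alt2_add_left (u u' v : E3) : A ![u + u', v] = A ![u, v] + A ![u', v] :=
  congrArg (fun B : E3 [⋀^Fin 1]→L[ℝ] ℝ => B ![v]) (A.curryLeft.map_add u u')

theorem alt2_smul_left (c : ℝ) (u v : E3) : A ![c • u, v] = c * A ![u, v] :=
  congrArg (fun B : E3 [⋀^Fin 1]→L[ℝ] ℝ => B ![v]) (A.curryLeft.map_smul c u)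

theorem alt2_self (v : E3) : A ![v, v] = 0 :=
  A.map_eq_zero_of_eq _ (i := 0) (j := 1) rfl (by decide)

theorem alt2_swap (u v : E3) : A ![u, v] = -A ![v, u] := by
  have h := alt2_self A (u + v)
  have h1 : A ![u + v, u + v] = A ![u, u + v] + A ![v, u + v] := alt2_add_left A _ _ _
  have h2 : ∀ w : E3, A ![w, u + v] = A ![w, u] + A ![w, v] := by
    intro w
    have := (A.curryLeft w).toMultilinearMap.map_update_add ![u] 0 u v
    have h3 : ∀ z : E3, Function.update ![u] (0 : Fin 1) z = ![z] := by
      intro z; funext i; fin_cases i; simp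
    rw [h3, h3, h3] at this
    exact this
  rw [h1, h2, h2, alt2_self, alt2_self] at h
  linarith

theorem alt2_add_right (u v v' : E3) : A ![u, v + v'] = A ![u, v] + A ![u, v'] := by
  rw [alt2_swap, alt2_add_left, alt2_swap A u v, alt2_swap A u v']; ring

theorem alt2_smul_right (c : ℝ) (u v : E3) : A ![u, c • v] = c * A ![u, v] := by
  rw [alt2_swap, alt2_smul_left, alt2_swap A u v]; ring

theorem alt1_add (A : E3 [⋀^Fin 1]→L[ℝ] ℝ) (u v : E3) : A ![u + v] = A ![u] + A ![v] := by
  have := A.toMultilinearMap.map_update_add ![u] 0 u v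
  have h3 : ∀ z : E3, Function.update ![u] (0 : Fin 1) z = ![z] := by
    intro z; funext i; fin_cases i; simp
  rw [h3, h3, h3] at this
  exact this

theorem alt1_smul (A : E3 [⋀^Fin 1]→L[ℝ] ℝ) (c : ℝ) (u : E3) : A ![c • u] = c * A ![u] := by
  have := A.toMultilinearMap.map_update_smul ![u] 0 c u
  have h3 : ∀ z : E3, Function.update ![u] (0 : Fin 1) z = ![z] := by
    intro z; funext i; fin_cases i; simp
  rw [h3, h3] at this
  exact this

theorem alt1_eq (A : E3 [⋀^Fin 1]→L[ℝ] ℝ) (v : E3) :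
    A ![v] = v 0 * A ![stdVec 0] + v 1 * A ![stdVec 1] + v 2 * A ![stdVec 2] := by
  conv_lhs => rw [eq_sum_stdVec v]
  simp only [alt1_add, alt1_smul]

/-- The value of a 2-form on two vectors of a plane. -/
theorem alt2_comb (u v : E3) (a b c d : ℝ) :
    A ![a • u + b • v, c • u + d • v] = (a * d - b * c) * A ![u, v] := by
  simp only [alt2_add_left, alt2_add_right, alt2_smul_left, alt2_smul_right, alt2_self,
    alt2_swap A v u]
  ring

theorem eq_of_apply_two_eq_zero {v : E3} (hv : v 2 = 0) :
    v = v 0 • stdVec 0 + v 1 • stdVec 1 := by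
  conv_lhs => rw [eq_sum_stdVec v, hv]
  simp

theorem alt2_plane {u v : E3} (hu : u 2 = 0) (hv : v 2 = 0) :
    A ![u, v] = (u 0 * v 1 - u 1 * v 0) * A ![stdVec 0, stdVec 1] := by
  conv_lhs => rw [eq_of_apply_two_eq_zero hu, eq_of_apply_two_eq_zero hv]
  rw [alt2_comb]

end LinearAlgebra

/-! ### Tangent planes and boundary do not depend on the flat chart -/

section FlatCharts

variable {M : Type*} [TopologicalSpace M] [ChartedSpace E3 M] [IsManifold (𝓡 3) ∞ M]
  {S : Set M} {e e' : OpenPartialHomeomorph M E3}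

theorem one_le_two' : (1 : WithTop ℕ∞) ≤ 2 := one_le_two

theorem dChart_eq_fderiv_transition {k : WithTop ℕ∞} (hk : 1 ≤ k)
    (he : e ∈ IsManifold.maximalAtlas (𝓡 3) k M)
    (he' : e' ∈ IsManifold.maximalAtlas (𝓡 3) k M) {p : M} (hp : p ∈ e.source)
    (hp' : p ∈ e'.source) (v : E3) :
    dChart e' p v = fderiv ℝ (transition e e') (e p) (dChart e p v) := by
  rw [fderiv_transition he he' hk (mem_overlap_of_mem hp hp'), ContinuousLinearMap.comp_apply,
    dChartSymm_dChart he hk hp, e.left_inv hp]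

theorem fderiv_transition_fderiv_transition {k : WithTop ℕ∞} (hk : 1 ≤ k)
    (he : e ∈ IsManifold.maximalAtlas (𝓡 3) k M)
    (he' : e' ∈ IsManifold.maximalAtlas (𝓡 3) k M) {x : E3} (hx : x ∈ overlap e e') (v : E3) :
    fderiv ℝ (transition e' e) (transition e e' x) (fderiv ℝ (transition e e') x v) = v := by
  rw [fderiv_transition he he' hk hx, fderiv_transition he' he hk (transition_mem hx)]
  simp only [ContinuousLinearMap.comp_apply]
  have h1 := dChartSymm_dChart he' hk hx.2 (dChartSymm e x v)
  rw [symm_transition hx]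
  change dChart e (e.symm x) (dChartSymm e' (e' (e.symm x)) _) = v
  rw [h1, dChart_dChartSymm he hk hx.1]

theorem IsFlatChart.symm_mem (he : IsFlatChart S e) {x : E3} (hx : x ∈ e.target)
    (hx' : x ∈ halfPlane) : e.symm x ∈ S := by
  rw [← he.2 (e.map_target hx), e.right_inv hx]
  exact hx'

theorem IsFlatChart.apply_mem (he : IsFlatChart S e) {p : M} (hp : p ∈ e.source)
    (hpS : p ∈ S) : e p ∈ halfPlane :=
  (he.2 hp).2 hpS

theorem IsFlatChart.transition_mem_halfPlane (he : IsFlatChart S e) (he' : IsFlatChart S e')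
    {x : E3} (hx : x ∈ overlap e e') (hx' : x ∈ halfPlane) : transition e e' x ∈ halfPlane :=
  he'.apply_mem hx.2 (he.symm_mem hx.1 hx')

/-- The derivative of a curve `t ↦ τ(x + tv)` in a coordinate. -/
theorem hasDerivAt_transition_line (he : e ∈ IsManifold.maximalAtlas (𝓡 3) 2 M)
    (he' : e' ∈ IsManifold.maximalAtlas (𝓡 3) 2 M) {x : E3} (hx : x ∈ overlap e e') (v : E3)
    (i : Fin 3) :
    HasDerivAt (fun t : ℝ => transition e e' (x + t • v) i)
      (fderiv ℝ (transition e e') x v i) 0 := by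
  have hd := (differentiableAt_transition he he' one_le_two' hx).hasFDerivAt
  have hl : HasDerivAt (fun t : ℝ => x + t • v) v 0 := by
    simpa using ((hasDerivAt_id (0 : ℝ)).smul_const v).const_add x
  have hd' : HasFDerivAt (transition e e') (fderiv ℝ (transition e e') x)
      (x + (0 : ℝ) • v) := by simpa using hd
  have h := hd'.comp_hasDerivAt (0 : ℝ) hl
  exact ((EuclideanSpace.proj i : E3 →L[ℝ] ℝ).hasFDerivAt.comp_hasDerivAt (0 : ℝ) h)

theorem eventually_line_mem_overlap {x : E3} (hx : x ∈ overlap e e') (v : E3) :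
    ∀ᶠ t : ℝ in 𝓝 0, x + t • v ∈ overlap e e' := by
  have hc : ContinuousAt (fun t : ℝ => x + t • v) 0 := by fun_prop
  apply hc.eventually_mem
  simpa using (isOpen_overlap e e').mem_nhds hx

/-- Coordinate changes between flat charts of a surface respect the tangent planes. -/
theorem IsFlatChart.fderiv_transition_plane (he : IsFlatChart S e) (he' : IsFlatChart S e')
    {x : E3} (hx : x ∈ overlap e e') (hx' : x ∈ halfPlane) {v : E3} (hv : v 2 = 0) :
    fderiv ℝ (transition e e') x v 2 = 0 := by
  -- At a boundary point only rays into the half-plane are available, so one-sided derivatives are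
  -- used. The opposite directions follow by linearity.
  have key : ∀ w : E3, w 2 = 0 → 0 ≤ w 0 → fderiv ℝ (transition e e') x w 2 = 0 := by
    intro w hw hw0
    have h := (hasDerivAt_transition_line he.1 he'.1 hx w 2).hasDerivWithinAt (s := Ici 0)
    have h0 : HasDerivWithinAt (fun t : ℝ => transition e e' (x + t • w) 2) 0 (Ici 0) 0 := by
      refine (hasDerivWithinAt_const (0 : ℝ) (Ici 0) (0 : ℝ)).congr_of_eventuallyEq ?_ ?_
      · filter_upwards [self_mem_nhdsWithin,
          mem_nhdsWithin_of_mem_nhds (eventually_line_mem_overlap hx w)] with t ht ht'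
        refine (he.transition_mem_halfPlane he' ht' ⟨?_, ?_⟩).1
        · simp [hx'.1, hw]
        · have : 0 ≤ t * w 0 := mul_nonneg ht hw0
          simpa using add_nonneg hx'.2 this
      · simpa using (he.transition_mem_halfPlane he' hx hx').1
    exact (uniqueDiffWithinAt_Ici (0 : ℝ)).eq_deriv _ h h0
  rcases le_total 0 (v 0) with h | h
  · exact key v hv h
  · have := key (-v) (by simp [hv]) (by simpa using h)
    simpa using this

/-- Invariance of the boundary. If x were interior, the first new coordinate would have a local
minimum at x along the plane, so the derivative would send the whole plane into a line, against its
injectivity. -/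
theorem IsFlatChart.transition_zero_pos (he : IsFlatChart S e) (he' : IsFlatChart S e')
    {x : E3} (hx : x ∈ overlap e e') (hx' : x ∈ halfPlane) (h0 : transition e e' x 0 = 0) :
    x 0 = 0 := by
  by_contra hne
  have hpos : 0 < x 0 := lt_of_le_of_ne hx'.2 (Ne.symm hne)
  have key : ∀ w : E3, w 2 = 0 → fderiv ℝ (transition e e') x w 0 = 0 := by
    intro w hw
    refine IsLocalMin.hasDerivAt_eq_zero ?_ (hasDerivAt_transition_line he.1 he'.1 hx w 0)
    have hc : ContinuousAt (fun t : ℝ => (x + t • w) 0) 0 := by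
      have : (fun t : ℝ => (x + t • w) 0) = fun t => x 0 + t * w 0 := by
        funext t; simp
      rw [this]; fun_prop
    have hev : ∀ᶠ t : ℝ in 𝓝 0, 0 < (x + t • w) 0 :=
      hc.eventually (lt_mem_nhds (by simpa using hpos))
    filter_upwards [hev, eventually_line_mem_overlap hx w] with t ht ht'
    have h1 := (he.transition_mem_halfPlane he' ht' ⟨by simp [hx'.1, hw], ht.le⟩).2
    simpa [h0] using h1
  set D := fderiv ℝ (transition e e') x
  have hD : ∀ w : E3, w 2 = 0 → D w = (D w 1) • stdVec 1 := by
    intro w hw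
    conv_lhs => rw [eq_of_apply_two_eq_zero (he.fderiv_transition_plane he' hx hx' hw), key w hw]
    simp [D]
  have hinj : ∀ w, D w = 0 → w = 0 := by
    intro w hw
    have := fderiv_transition_fderiv_transition one_le_two' he.1 he'.1 hx w
    rw [← this]
    change fderiv ℝ (transition e' e) (transition e e' x) (D w) = 0
    rw [hw, map_zero]
  -- The images of the first two basis vectors both lie on the line of `stdVec 1`; w is the linear
  -- relation between them.
  set w : E3 := (D (stdVec 1) 1) • stdVec 0 - (D (stdVec 0) 1) • stdVec 1 with hwdef
  have hw : D w = 0 := by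
    rw [hwdef, map_sub, map_smul, map_smul, hD (stdVec 0) (by simp), hD (stdVec 1) (by simp)]
    ext i
    fin_cases i <;> simp [mul_comm]
  have h1 := hinj w hw
  have h2 : D (stdVec 1) 1 = 0 := by
    have := congrArg (fun z : E3 => z 0) h1
    simpa [hwdef] using this
  have h3 := hinj (stdVec 1) (by rw [hD (stdVec 1) (by simp), h2, zero_smul])
  have := congrArg (fun z : E3 => z 1) h3
  simp at this

/-- Since coordinate changes preserve the plane, the existential over flat charts in `IsTangent` can
be tested in any single one. -/
theorem IsFlatChart.isTangent_iff (he : IsFlatChart S e) {p : M} (hp : p ∈ e.source)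
    (hpS : p ∈ S) (v : E3) :
    IsTangent S p v ↔ dChart e p v 2 = 0 := by
  constructor
  · rintro ⟨e', he', hp', hv⟩
    rw [dChart_eq_fderiv_transition one_le_two' he'.1 he.1 hp' hp]
    exact he'.fderiv_transition_plane he (mem_overlap_of_mem hp' hp) (he'.apply_mem hp' hpS) hv
  · exact fun h => ⟨e, he, hp, h⟩

theorem IsFlatChart.mem_boundary_iff (he : IsFlatChart S e) {p : M} (hp : p ∈ e.source)
    (hpS : p ∈ S) : p ∈ boundary S ↔ e p 0 = 0 := by
  constructor
  · rintro ⟨-, e', he', hp', h0⟩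
    refine he.transition_zero_pos he' (mem_overlap_of_mem hp hp') (he.apply_mem hp hpS) ?_
    rwa [transition_apply hp]
  · exact fun h => ⟨hpS, e, he, hp, h⟩

end FlatCharts

/-! ### Regularity of vector fields in charts -/

section VectorFields

variable {M : Type*} [TopologicalSpace M] [ChartedSpace E3 M] [IsManifold (𝓡 3) ∞ M]

/-- Over a preferred chart, the trivialization of the tangent bundle is the derivative of that
chart. -/
theorem VField.isClassOn_iff {m : WithTop ℕ∞} {X : VField M} {A : Set M} :
    X.IsClassOn m A ↔ ∀ p ∈ A, ContMDiffWithinAt (𝓡 3) 𝓘(ℝ, E3) m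
      (fun q => dChart (chartAt E3 p) q (X q)) A p := by
  have : IsManifold (𝓡 3) 1 M := IsManifold.of_le (n := ∞) one_le_infty
  refine forall₂_congr fun p _ => ?_
  rw [Bundle.contMDiffWithinAt_section]
  have h : ∀ q ∈ (chartAt E3 p).source,
      (trivializationAt E3 (TangentSpace (𝓡 3)) p ⟨q, X q⟩).2 = dChart (chartAt E3 p) q (X q) := by
    intro q hq
    have h1 := TangentBundle.continuousLinearMapAt_trivializationAt (𝕜 := ℝ) (I := 𝓡 3)
      (x₀ := p) hq
    have h2 := DFunLike.congr_fun h1 (X q)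
    rw [Bundle.Trivialization.continuousLinearMapAt_apply,
      Bundle.Trivialization.linearMapAt_apply, if_pos (by simpa using hq)] at h2
    exact h2
  refine Filter.EventuallyEq.contMDiffWithinAt_iff ?_ (h p (mem_chart_source _ _))
  filter_upwards [mem_nhdsWithin_of_mem_nhds
    ((chartAt E3 p).open_source.mem_nhds (mem_chart_source E3 p))] with q hq
  exact h q hq

theorem VField.IsClassOn.contDiffOn_inChart {m : WithTop ℕ∞} {X : VField M} {A : Set M}
    (hX : X.IsClassOn m A) (hm : m + 1 ≤ (∞ : WithTop ℕ∞)) {e : OpenPartialHomeomorph M E3}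
    (he : e ∈ IsManifold.maximalAtlas (𝓡 3) (m + 1) M) :
    ContDiffOn ℝ m (X.inChart e) (e.target ∩ e.symm ⁻¹' A) := by
  rintro x ⟨hx, hxA⟩
  set c := chartAt E3 (e.symm x) with hc
  have hcm : c ∈ IsManifold.maximalAtlas (𝓡 3) (m + 1) M := chartAt_mem _ hm
  have hx' : x ∈ overlap e c := ⟨hx, mem_chart_source _ _⟩
  have h1 := VField.isClassOn_iff.1 hX (e.symm x) hxA
  have h2 : ContMDiffWithinAt (𝓡 3) (𝓡 3) m e.symm (overlap e c ∩ e.symm ⁻¹' A) x :=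
    (contMDiffAt_symm_of_mem_maximalAtlas
      (IsManifold.maximalAtlas_subset_of_le le_self_add he) hx).contMDiffWithinAt
  have h3 := contMDiffWithinAt_iff_contDiffWithinAt.1
    (ContMDiffWithinAt.comp x h1 h2 fun y hy => hy.2)
  have h4 : ContDiffWithinAt ℝ m (fun y => fderiv ℝ (transition c e) (transition e c y))
      (overlap e c ∩ e.symm ⁻¹' A) x := by
    have h5 := (contDiffOn_transition hcm he).fderiv_of_isOpen (m := m) (isOpen_overlap c e) le_rfl
    have h6 := (contDiffOn_transition he hcm).of_le (m := m) le_self_add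
    exact ((h5.comp h6 fun y hy => transition_mem hy) x hx').mono inter_subset_left
  have h7 := h4.clm_apply h3
  have h8 : ContDiffWithinAt ℝ m (X.inChart e) (overlap e c ∩ e.symm ⁻¹' A) x := by
    refine h7.congr_of_mem (fun y hy => ?_) ⟨hx', hxA⟩
    have := X.inChart_eq hcm he le_add_self (transition_mem hy.1)
    rw [transition_transition hy.1] at this
    rw [this]
    exact congrArg (fderiv ℝ (transition c e) (transition e c y))
      (congrArg (fun q => dChart c q (X q)) (symm_transition hy.1))
  refine h8.mono_of_mem_nhdsWithin ?_
  filter_upwards [self_mem_nhdsWithin, mem_nhdsWithin_of_mem_nhds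
    ((isOpen_overlap e c).mem_nhds hx')] with y hy hy'
  exact ⟨hy', hy.2⟩

theorem VField.isClassOn_of_inChart {m : WithTop ℕ∞} (hm : m ≤ (∞ : WithTop ℕ∞)) {X : VField M}
    {A : Set M} (h : ∀ p ∈ A, ContDiffWithinAt ℝ m (X.inChart (chartAt E3 p))
      ((chartAt E3 p).target ∩ (chartAt E3 p).symm ⁻¹' A) (chartAt E3 p p)) :
    X.IsClassOn m A := by
  refine VField.isClassOn_iff.2 fun p hp => ?_
  set c := chartAt E3 p with hc
  have hcm : c ∈ IsManifold.maximalAtlas (𝓡 3) m M := chartAt_mem _ hm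
  have hps : p ∈ c.source := mem_chart_source _ _
  have h2 : ContMDiffWithinAt (𝓡 3) (𝓡 3) m c (c.source ∩ A) p :=
    (contMDiffAt_of_mem_maximalAtlas hcm hps).contMDiffWithinAt
  have h3 := ContMDiffWithinAt.comp p (contMDiffWithinAt_iff_contDiffWithinAt.2 (h p hp)) h2
    (fun q hq => ⟨c.map_source hq.1, (congrArg (· ∈ A) (c.left_inv hq.1)).mpr hq.2⟩)
  have h4 : ContMDiffWithinAt (𝓡 3) 𝓘(ℝ, E3) m (fun q => dChart c q (X q)) (c.source ∩ A) p := by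
    refine h3.congr_of_mem (fun q hq => ?_) ⟨hps, hp⟩
    exact congrArg (fun q => dChart c q (X q)) (c.left_inv hq.1).symm
  refine h4.mono_of_mem_nhdsWithin ?_
  filter_upwards [self_mem_nhdsWithin, mem_nhdsWithin_of_mem_nhds
    (c.open_source.mem_nhds hps)] with y hy hy'
  exact ⟨hy', hy⟩

end VectorFields

/-! ### Adapted frames and the pointwise calibration inequality -/

section PointwiseAlgebra

/-- The wedge product of two linear forms. -/
def wedge11 (α β : E3 [⋀^Fin 1]→L[ℝ] ℝ) : E3 [⋀^Fin 2]→L[ℝ] ℝ :=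
  ContinuousAlternatingMap.alternatizeUncurryFin (LinearMap.toContinuousLinearMap
    { toFun := fun u => α ![u] • β
      map_add' := fun u v => by rw [alt1_add, add_smul]
      map_smul' := fun c u => by rw [alt1_smul, mul_smul, RingHom.id_apply] })

theorem wedge11_apply (α β : E3 [⋀^Fin 1]→L[ℝ] ℝ) (u v : E3) :
    wedge11 α β ![u, v] = α ![u] * β ![v] - α ![v] * β ![u] := by
  rw [wedge11, ContinuousAlternatingMap.alternatizeUncurryFin_apply]
  have h0 : (0 : Fin 2).removeNth ![u, v] = ![v] := by funext i; fin_cases i; rfl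
  have h1 : (1 : Fin 2).removeNth ![u, v] = ![u] := by funext i; fin_cases i; rfl
  rw [Fin.sum_univ_two, h0, h1]
  simp
  ring

/-- The frame `(T, x, y)` of `ℝ³`, where `x, y` span the kernel of `θ` and `T` spans the kernel of
the 2-form `Ω`. -/
theorem exists_frame (θ : E3 [⋀^Fin 1]→L[ℝ] ℝ) (Ω : E3 [⋀^Fin 2]→L[ℝ] ℝ) {x y : E3}
    (hθ : θ ≠ 0) (hx : θ ![x] = 0) (hy : θ ![y] = 0) (hxy : Ω ![x, y] = 2) :
    ∃ T : E3, θ ![T] = 1 ∧ (∀ w, Ω ![T, w] = 0) ∧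
      ∀ v : E3, v = θ ![v] • T + ((1 / 2) * Ω ![v, y]) • x + ((1 / 2) * Ω ![x, v]) • y := by
  obtain ⟨z, hz⟩ : ∃ z : E3, θ ![z] ≠ 0 := by
    by_contra! h
    refine hθ (ContinuousAlternatingMap.ext fun v => ?_)
    have : v = ![v 0] := by funext i; fin_cases i; rfl
    rw [this]
    exact h _
  -- The functionals θ, Ω(·, y) and Ω(·, x) detect the three coefficients in turn.
  have hli : LinearIndependent ℝ ![z, x, y] := by
    rw [Fintype.linearIndependent_iff]
    intro g hg
    simp only [Fin.sum_univ_three, Matrix.cons_val_zero, Matrix.cons_val_one,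
      Matrix.cons_val_two, Matrix.head_cons, Matrix.tail_cons] at hg
    have h0 : g 0 = 0 := by
      have := congrArg (fun v : E3 => θ ![v]) hg
      have hzero : θ ![(0 : E3)] = 0 := θ.map_coord_zero 0 rfl
      simp only [alt1_add, alt1_smul, hx, hy, hzero, mul_zero, add_zero] at this
      exact (mul_eq_zero.1 this).resolve_right hz
    rw [h0, zero_smul, zero_add] at hg
    have hzl : ∀ w, Ω ![(0 : E3), w] = 0 := fun w => Ω.map_coord_zero 0 rfl
    have h1 : g 1 = 0 := by
      have := congrArg (fun v : E3 => Ω ![v, y]) hg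
      simp only [alt2_add_left, alt2_smul_left, hxy, alt2_self, hzl, mul_zero, add_zero] at this
      linarith
    have h2 : g 2 = 0 := by
      have := congrArg (fun v : E3 => Ω ![v, x]) hg
      simp only [alt2_add_left, alt2_smul_left, alt2_swap Ω y x, hxy, alt2_self, hzl, mul_zero,
        zero_add] at this
      linarith
    intro i
    fin_cases i
    exacts [h0, h1, h2]
  set b := basisOfLinearIndependentOfCardEqFinrank hli (by simp) with hb
  have hdec : ∀ v : E3, ∃ c₀ c₁ c₂ : ℝ, v = c₀ • z + c₁ • x + c₂ • y := by
    intro v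
    refine ⟨b.repr v 0, b.repr v 1, b.repr v 2, ?_⟩
    have := b.sum_repr v
    rw [Fin.sum_univ_three] at this
    simp only [hb, coe_basisOfLinearIndependentOfCardEqFinrank, Matrix.cons_val_zero,
      Matrix.cons_val_one, Matrix.cons_val_two, Matrix.head_cons, Matrix.tail_cons] at this
    exact this.symm
  -- The corrections along x and y make Ω(T, y) and Ω(T, x) vanish; the factor 1/2 comes from Ω(x,
  -- y) = 2. The scaling gives θ(T) = 1.
  set T : E3 := (θ ![z])⁻¹ • (z + (-(1 / 2) * Ω ![z, y]) • x + (-(1 / 2) * Ω ![x, z]) • y) with hT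
  have hyx : Ω ![y, x] = -2 := by rw [alt2_swap, hxy]
  have hTθ : θ ![T] = 1 := by
    simp only [hT, alt1_smul, alt1_add, hx, hy, mul_zero, add_zero]
    field_simp
  have hTx : Ω ![T, x] = 0 := by
    simp only [hT, alt2_smul_left, alt2_add_left, alt2_self, hyx, alt2_swap Ω x z]
    ring
  have hTy : Ω ![T, y] = 0 := by
    simp only [hT, alt2_smul_left, alt2_add_left, alt2_self, hxy]
    ring
  have hdecT : ∀ v : E3, v = θ ![v] • T + ((1 / 2) * Ω ![v, y]) • x
      + ((1 / 2) * Ω ![x, v]) • y := by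
    intro v
    obtain ⟨c₀, c₁, c₂, hv⟩ := hdec v
    have hθv : θ ![v] = c₀ * θ ![z] := by
      rw [hv]; simp only [alt1_add, alt1_smul, hx, hy, mul_zero, add_zero]
    have hvy : Ω ![v, y] = c₀ * Ω ![z, y] + 2 * c₁ := by
      rw [hv]; simp only [alt2_add_left, alt2_smul_left, alt2_self, hxy]; ring
    have hxv : Ω ![x, v] = c₀ * Ω ![x, z] + 2 * c₂ := by
      rw [hv]; simp only [alt2_add_right, alt2_smul_right, alt2_self, hxy]; ring
    rw [hθv, hvy, hxv, hT, smul_smul, mul_assoc, mul_inv_cancel₀ hz, hv]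
    module
  refine ⟨T, hTθ, fun w => ?_, hdecT⟩
  rw [hdecT w]
  simp only [alt2_add_right, alt2_smul_right, hTx, hTy, alt2_self, mul_zero, add_zero]

/-- A unit vector `x'` in the plane spanned by the orthonormal vectors `x, y = j x` has a first
coordinate of absolute value at most one. -/
theorem abs_coord_le_one (θ : E3 [⋀^Fin 1]→L[ℝ] ℝ) (Ω : E3 [⋀^Fin 2]→L[ℝ] ℝ) (j : E3 →L[ℝ] E3)
    {x x' : E3} (hθ : θ ≠ 0) (hx : θ ![x] = 0) (hjx : θ ![j x] = 0) (hjj : j (j x) = -x)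
    (hxx : (1 / 2) * Ω ![x, j x] = 1) (hx' : θ ![x'] = 0) (hxx' : (1 / 2) * Ω ![x', j x'] = 1) :
    |(1 / 2) * Ω ![x', j x]| ≤ 1 := by
  have hxy : Ω ![x, j x] = 2 := by linarith
  obtain ⟨T, -, -, hdec⟩ := exists_frame θ Ω hθ hx hjx hxy
  have h := hdec x'
  rw [hx', zero_smul, zero_add] at h
  set a : ℝ := (1 / 2) * Ω ![x', j x] with ha
  set b : ℝ := (1 / 2) * Ω ![x, x'] with hb
  -- With x' = a x + b (j x), the map j rotates the coordinates by a right angle, so the unit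
  -- condition on x' becomes a² + b² = 1.
  have hJ : j x' = (-b) • x + a • j x := by
    rw [h, map_add, map_smul, map_smul, hjj]
    module
  have h2 : Ω ![x', j x'] = (a * a - b * (-b)) * Ω ![x, j x] := by
    rw [hJ]
    conv_lhs => rw [h]
    exact alt2_comb Ω x (j x) a b (-b) a
  rw [h2, hxy] at hxx'
  rw [abs_le]
  constructor <;> nlinarith [sq_nonneg b, sq_nonneg a]

end PointwiseAlgebra

/-! ### The p-area form at a point -/

section AreaForm

variable {M : Type*} [TopologicalSpace M] [ChartedSpace E3 M] [IsManifold (𝓡 3) ∞ M]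
  (P : PseudohermitianStructure M)

/-- The contact form at a point, as a form on `ℝ³`. -/
def PseudohermitianStructure.theta (p : M) : E3 [⋀^Fin 1]→L[ℝ] ℝ := P.Θ p

/-- The form `dΘ` at a point, as a form on `ℝ³`. -/
def PseudohermitianStructure.dtheta (p : M) : E3 [⋀^Fin 2]→L[ℝ] ℝ := P.Θ.d p

/-- The endomorphism `J` at a point, as an endomorphism of `ℝ³`. -/
def PseudohermitianStructure.jmap (p : M) : E3 →L[ℝ] E3 := P.J p

/-- The value of a vector field as a vector of `ℝ³`. -/
def VField.vec (X : VField M) (p : M) : E3 := X p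

/-- The form `e¹` at a point, as a form on `ℝ³`. -/
def eOne (X : VField M) (p : M) : E3 [⋀^Fin 1]→L[ℝ] ℝ := P.coframe₁ X p

/-- The 2-form `Θ ∧ e¹` at a point. -/
def areaAlt (X : VField M) (p : M) : E3 [⋀^Fin 2]→L[ℝ] ℝ := wedge11 (P.theta p) (eOne P X p)

/-- The 2-form `Θ ∧ e¹`. -/
def areaForm (X : VField M) : DForm 2 M := fun p => areaAlt P X p

theorem areaAlt_apply (X : VField M) (p : M) (u v : E3) :
    areaAlt P X p ![u, v] = pAreaForm P X p u v :=
  wedge11_apply _ _ u v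

theorem isUnitLegendrian_iff {p : M} {v : E3} : P.IsUnitLegendrian p v ↔
    P.theta p ![v] = 0 ∧ (1 / 2) * P.dtheta p ![v, P.jmap p v] = 1 := Iff.rfl

theorem theta_ne_zero (p : M) : P.theta p ≠ 0 := P.Θ_ne_zero p

theorem theta_jmap {p : M} {v : E3} (h : P.theta p ![v] = 0) : P.theta p ![P.jmap p v] = 0 :=
  P.J_mem p v h

theorem jmap_jmap {p : M} {v : E3} (h : P.theta p ![v] = 0) : P.jmap p (P.jmap p v) = -v :=
  P.J_sq p v h

theorem eOne_apply (X : VField M) (p : M) (w : E3) :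
    eOne P X p ![w] = (1 / 2) * P.dtheta p ![w, P.jmap p (X.vec p)] :=
  P.coframe₁_apply X p w

theorem exists_unitary_frame {p : M} {x : E3} (hx : P.IsUnitLegendrian p x) :
    ∃ T : E3, P.theta p ![T] = 1 ∧ (∀ w : E3, P.dtheta p ![T, w] = 0) ∧
      ∀ v : E3, v = P.theta p ![v] • T + ((1 / 2) * P.dtheta p ![v, P.jmap p x]) • x
        + ((1 / 2) * P.dtheta p ![x, v]) • P.jmap p x :=
  exists_frame (P.theta p) (P.dtheta p) (theta_ne_zero P p) hx.1 (theta_jmap P hx.1)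
    (by have := ((isUnitLegendrian_iff P).1 hx).2; linarith)

/-- The function `e¹(e₁')` is bounded by one. -/
theorem abs_eOne_le (X X' : VField M) {p : M} (hX : P.IsUnitLegendrian p (X p))
    (hX' : P.IsUnitLegendrian p (X' p)) : |eOne P X p ![X'.vec p]| ≤ 1 := by
  rw [eOne_apply]
  exact abs_coord_le_one (P.theta p) (P.dtheta p) (P.jmap p) (theta_ne_zero P p) hX.1
    (theta_jmap P hX.1) (jmap_jmap P hX.1) hX.2 hX'.1 hX'.2

theorem eOne_self (X : VField M) {p : M} (hX : P.IsUnitLegendrian p (X p)) :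
    eOne P X p ![X.vec p] = 1 := P.coframe₁_apply_self X p hX

/-- One term of the wedge product drops out because Θ(X') = 0. Compared with the case X = X', the
contraction carries the extra factor e¹(X'), which is the source of the calibration. -/
theorem areaAlt_apply_self (X X' : VField M) {p : M} (hX' : P.IsUnitLegendrian p (X' p))
    (v : E3) :
    areaAlt P X p ![X'.vec p, v] = -(P.theta p ![v] * eOne P X p ![X'.vec p]) := by
  rw [areaAlt, wedge11_apply]
  have h : P.theta p ![X'.vec p] = 0 := hX'.1
  rw [h]
  ring

end AreaForm

/-! ### Regularity of the coframe and of the p-area form -/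

section AreaFormRegularity

variable {M : Type*} [TopologicalSpace M] [ChartedSpace E3 M] [IsManifold (𝓡 3) ∞ M]
  (P : PseudohermitianStructure M)

theorem comp_vec1 (L : E3 →L[ℝ] E3) (u : E3) : (fun i => L (![u] i)) = ![L u] := by
  funext i; fin_cases i; rfl

theorem comp_vec2 (L : E3 →L[ℝ] E3) (u v : E3) : (fun i => L (![u, v] i)) = ![L u, L v] := by
  funext i; fin_cases i <;> rfl

theorem alt1_ext {A B : E3 [⋀^Fin 1]→L[ℝ] ℝ} (h : ∀ u : E3, A ![u] = B ![u]) : A = B := by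
  ext v
  have : v = ![v 0] := by funext i; fin_cases i; rfl
  rw [this]
  exact h _

theorem alt2_ext {A B : E3 [⋀^Fin 2]→L[ℝ] ℝ} (h : ∀ u v : E3, A ![u, v] = B ![u, v]) : A = B := by
  ext v
  have : v = ![v 0, v 1] := by funext i; fin_cases i <;> rfl
  rw [this]
  exact h _ _

variable {e : OpenPartialHomeomorph M E3}

theorem theta_inChart (x : E3) (u : E3) :
    P.Θ.inChart e x ![u] = P.theta (e.symm x) ![dChartSymm e x u] :=
  congrArg (P.theta (e.symm x)) (comp_vec1 (dChartSymm e x) u)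

theorem dtheta_inChart (x : E3) (u v : E3) :
    P.Θ.d.inChart e x ![u, v] = P.dtheta (e.symm x) ![dChartSymm e x u, dChartSymm e x v] :=
  congrArg (P.dtheta (e.symm x)) (comp_vec2 (dChartSymm e x) u v)

theorem eOne_inChart (X : VField M) (x : E3) (u : E3) :
    (P.coframe₁ X).inChart e x ![u] = eOne P X (e.symm x) ![dChartSymm e x u] :=
  congrArg (eOne P X (e.symm x)) (comp_vec1 (dChartSymm e x) u)

theorem areaForm_inChart_apply (X : VField M) (x : E3) (u v : E3) :
    (areaForm P X).inChart e x ![u, v] =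
      areaAlt P X (e.symm x) ![dChartSymm e x u, dChartSymm e x v] :=
  congrArg (areaAlt P X (e.symm x)) (comp_vec2 (dChartSymm e x) u v)

theorem areaForm_inChart (X : VField M) (x : E3) :
    (areaForm P X).inChart e x =
      wedge11 (P.Θ.inChart e x) ((P.coframe₁ X).inChart e x) := by
  refine alt2_ext fun u v => ?_
  rw [areaForm_inChart_apply, areaAlt, wedge11_apply, wedge11_apply, theta_inChart, theta_inChart,
    eOne_inChart, eOne_inChart]

/-- The endomorphism `J` in a chart. -/
def PseudohermitianStructure.jChart (e : OpenPartialHomeomorph M E3) (x : E3) : E3 →L[ℝ] E3 :=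
  (dChart e (e.symm x)).comp ((P.jmap (e.symm x)).comp (dChartSymm e x))

theorem contDiffOn_jChart (he : e ∈ IsManifold.maximalAtlas (𝓡 3) ∞ M) :
    ContDiffOn ℝ ∞ (P.jChart e) e.target := P.J_smooth e he

theorem dChartSymm_jChart (he : e ∈ IsManifold.maximalAtlas (𝓡 3) 1 M) {x : E3}
    (hx : x ∈ e.target) (v : E3) :
    dChartSymm e x (P.jChart e x v) = P.jmap (e.symm x) (dChartSymm e x v) :=
  dChartSymm_dChart' he le_rfl hx _

theorem VField.dChartSymm_inChart_vec (X : VField M)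
    (he : e ∈ IsManifold.maximalAtlas (𝓡 3) 1 M) {x : E3} (hx : x ∈ e.target) :
    dChartSymm e x (X.inChart e x) = X.vec (e.symm x) :=
  dChartSymm_dChart' he le_rfl hx _

/-- No derivative of X enters: e¹ is algebraic in X, J and dΘ, so it is as regular as X. -/
theorem coframe₁_inChart (X : VField M) (he : e ∈ IsManifold.maximalAtlas (𝓡 3) 1 M) {x : E3}
    (hx : x ∈ e.target) (u : E3) : (P.coframe₁ X).inChart e x ![u] =
      (1 / 2) * P.Θ.d.inChart e x ![u, P.jChart e x (X.inChart e x)] := by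
  rw [eOne_inChart, eOne_apply, dtheta_inChart, dChartSymm_jChart P he hx,
    X.dChartSymm_inChart_vec he hx]

theorem coframe₂_inChart (X : VField M) (he : e ∈ IsManifold.maximalAtlas (𝓡 3) 1 M) {x : E3}
    (hx : x ∈ e.target) (u : E3) : (P.coframe₂ X).inChart e x ![u] =
      (1 / 2) * P.Θ.d.inChart e x ![X.inChart e x, u] := by
  rw [dtheta_inChart, X.dChartSymm_inChart_vec he hx]
  exact congrArg ((P.coframe₂ X) (e.symm x)) (comp_vec1 (dChartSymm e x) u)

theorem dtheta_isClassOn : P.Θ.d.IsClassOn ∞ univ :=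
  DForm.IsClassOn.d (m := ∞) (by exact P.Θ_smooth) isOpen_univ

variable {m : WithTop ℕ∞} {X : VField M} {A : Set M}

theorem contDiffOn_alt2_apply {f : E3 → E3 [⋀^Fin 2]→L[ℝ] ℝ} {u v : E3 → E3} {s : Set E3}
    (hf : ContDiffOn ℝ m f s) (hu : ContDiffOn ℝ m u s) (hv : ContDiffOn ℝ m v s) :
    ContDiffOn ℝ m (fun x => f x ![u x, v x]) s := by
  have := contDiffOn_alternating_apply (g := ![u, v]) hf
    (fun i => by fin_cases i <;> [exact hu; exact hv])
  refine this.congr fun x _ => ?_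
  congr 1
  funext i
  fin_cases i <;> rfl

theorem contDiffOn_alt1_iff {f : E3 → E3 [⋀^Fin 1]→L[ℝ] ℝ} {s : Set E3} :
    ContDiffOn ℝ m f s ↔ ∀ u : E3, ContDiffOn ℝ m (fun x => f x ![u]) s := by
  rw [contDiffOn_alternating_iff]
  refine ⟨fun h u => h _, fun h v => ?_⟩
  have : v = ![v 0] := by funext i; fin_cases i; rfl
  rw [this]
  exact h _

theorem contDiffOn_alt2_iff {f : E3 → E3 [⋀^Fin 2]→L[ℝ] ℝ} {s : Set E3} :
    ContDiffOn ℝ m f s ↔ ∀ u v : E3, ContDiffOn ℝ m (fun x => f x ![u, v]) s := by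
  rw [contDiffOn_alternating_iff]
  refine ⟨fun h u v => h _, fun h v => ?_⟩
  have : v = ![v 0, v 1] := by funext i; fin_cases i <;> rfl
  rw [this]
  exact h _ _

theorem contDiffOn_wedge11 {α β : E3 → E3 [⋀^Fin 1]→L[ℝ] ℝ} {s : Set E3}
    (hα : ContDiffOn ℝ m α s) (hβ : ContDiffOn ℝ m β s) :
    ContDiffOn ℝ m (fun x => wedge11 (α x) (β x)) s := by
  rw [contDiffOn_alt2_iff]
  intro u v
  simp only [wedge11_apply]
  rw [contDiffOn_alt1_iff] at hα hβ
  exact ((hα u).mul (hβ v)).sub ((hα v).mul (hβ u))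

theorem contDiffOn_coframe₁ (hm : m ≤ (∞ : WithTop ℕ∞))
    (he : e ∈ IsManifold.maximalAtlas (𝓡 3) ∞ M)
    (hX : ContDiffOn ℝ m (X.inChart e) (e.target ∩ e.symm ⁻¹' A)) :
    ContDiffOn ℝ m ((P.coframe₁ X).inChart e) (e.target ∩ e.symm ⁻¹' A) := by
  rw [contDiffOn_alt1_iff]
  intro u
  have hd : ContDiffOn ℝ m (P.Θ.d.inChart e) (e.target ∩ e.symm ⁻¹' A) :=
    ((dtheta_isClassOn P e he).of_le hm).mono (inter_subset_inter_right _ fun _ _ => mem_univ _)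
  have hj : ContDiffOn ℝ m (P.jChart e) (e.target ∩ e.symm ⁻¹' A) :=
    ((contDiffOn_jChart P he).of_le hm).mono inter_subset_left
  refine (contDiffOn_const (c := (1 / 2 : ℝ)).mul
    (contDiffOn_alt2_apply hd (contDiffOn_const (c := u)) (hj.clm_apply hX))).congr fun x hx => ?_
  exact coframe₁_inChart P X (IsManifold.maximalAtlas_subset_of_le one_le_infty he) hx.1 u

theorem contDiffOn_coframe₂ (hm : m ≤ (∞ : WithTop ℕ∞))
    (he : e ∈ IsManifold.maximalAtlas (𝓡 3) ∞ M)
    (hX : ContDiffOn ℝ m (X.inChart e) (e.target ∩ e.symm ⁻¹' A)) :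
    ContDiffOn ℝ m ((P.coframe₂ X).inChart e) (e.target ∩ e.symm ⁻¹' A) := by
  rw [contDiffOn_alt1_iff]
  intro u
  have hd : ContDiffOn ℝ m (P.Θ.d.inChart e) (e.target ∩ e.symm ⁻¹' A) :=
    ((dtheta_isClassOn P e he).of_le hm).mono (inter_subset_inter_right _ fun _ _ => mem_univ _)
  refine (contDiffOn_const (c := (1 / 2 : ℝ)).mul
    (contDiffOn_alt2_apply hd hX (contDiffOn_const (c := u)))).congr fun x hx => ?_
  exact coframe₂_inChart P X (IsManifold.maximalAtlas_subset_of_le one_le_infty he) hx.1 u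

theorem contDiffOn_areaForm (hm : m ≤ (∞ : WithTop ℕ∞))
    (he : e ∈ IsManifold.maximalAtlas (𝓡 3) ∞ M)
    (hX : ContDiffOn ℝ m (X.inChart e) (e.target ∩ e.symm ⁻¹' A)) :
    ContDiffOn ℝ m ((areaForm P X).inChart e) (e.target ∩ e.symm ⁻¹' A) := by
  have hθ : ContDiffOn ℝ m (P.Θ.inChart e) (e.target ∩ e.symm ⁻¹' A) :=
    ((P.Θ_smooth e he).of_le hm).mono (inter_subset_inter_right _ fun _ _ => mem_univ _)
  exact (contDiffOn_wedge11 hθ (contDiffOn_coframe₁ P hm he hX)).congr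
    fun x _ => areaForm_inChart P X x

/-- The p-area form of a continuous field is continuous in all `C²` charts. -/
theorem continuousOn_areaForm (hX : X.IsClassOn 0 A)
    (he : e ∈ IsManifold.maximalAtlas (𝓡 3) 2 M) :
    ContinuousOn ((areaForm P X).inChart e) (e.target ∩ e.symm ⁻¹' A) := by
  have h01 : (0 : WithTop ℕ∞) + 1 ≤ (∞ : WithTop ℕ∞) := by rw [zero_add]; exact one_le_infty
  rw [← contDiffOn_zero (𝕜 := ℝ)]
  refine DForm.contDiffOn_inChart h01
    (IsManifold.maximalAtlas_subset_of_le (by rw [zero_add]; exact one_le_two') he)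
    fun p _ => contDiffOn_areaForm P zero_le (chartAt_mem p le_rfl) ?_
  exact hX.contDiffOn_inChart h01 (chartAt_mem p h01)

end AreaFormRegularity

/-! ### Densities of p-area forms in flat charts -/

section Density

variable {M : Type*} [TopologicalSpace M] [ChartedSpace E3 M] [IsManifold (𝓡 3) ∞ M]
  (P : PseudohermitianStructure M)

/-- The value of a 2-form on the first two coordinate vectors of a chart. -/
def DForm.density (η : DForm 2 M) (e : OpenPartialHomeomorph M E3) (x : E3) : ℝ :=
  η.inChart e x ![stdVec 0, stdVec 1]

variable {e : OpenPartialHomeomorph M E3} {S : Set M} {X X' : VField M}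

theorem apply_eq_density (he : e ∈ IsManifold.maximalAtlas (𝓡 3) 2 M) {x : E3}
    (hx : x ∈ e.target) (Y : VField M) {u v : E3} (hu : dChart e (e.symm x) u 2 = 0)
    (hv : dChart e (e.symm x) v 2 = 0) :
    areaAlt P Y (e.symm x) ![u, v] =
      (dChart e (e.symm x) u 0 * dChart e (e.symm x) v 1
        - dChart e (e.symm x) u 1 * dChart e (e.symm x) v 0) * (areaForm P Y).density e x := by
  rw [DForm.density, ← alt2_plane _ hu hv, areaForm_inChart_apply,
    dChartSymm_dChart' he one_le_two' hx, dChartSymm_dChart' he one_le_two' hx]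

/-- At a nonsingular point, some tangent vector is not in the contact plane. -/
theorem exists_tangent_theta_ne_zero (he : IsFlatChart S e) {p : M} (hp : p ∈ e.source)
    (hpS : p ∈ S) (hns : ¬ IsSingularPoint P S p) :
    ∃ v : E3, dChart e p v 2 = 0 ∧ P.theta p ![v] ≠ 0 := by
  by_contra! h
  refine hns fun v => ?_
  change IsTangent S p v ↔ P.theta p ![(v : E3)] = 0
  have key := he.isTangent_iff hp hpS v
  rw [key]
  refine ⟨h v, fun hv => ?_⟩
  have hD : ∀ i, dChart e p (dChartSymm e (e p) (stdVec i)) = stdVec i := fun i => by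
    have := dChart_dChartSymm he.1 one_le_two' (e.map_source hp) (stdVec i)
    rwa [e.left_inv hp] at this
  have h0 := h (dChartSymm e (e p) (stdVec 0)) (by rw [hD]; simp)
  have h1 := h (dChartSymm e (e p) (stdVec 1)) (by rw [hD]; simp)
  -- A contact form that kills the tangent plane is a multiple of the third coordinate of the chart.
  -- The multiple is nonzero, so the two planes coincide and the point is singular.
  have hall : ∀ w : E3, P.theta p ![w] =
      dChart e p w 2 * P.theta p ![dChartSymm e (e p) (stdVec 2)] := by
    intro w
    have hw : w = dChartSymm e (e p) (dChart e p w) :=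
      (dChartSymm_dChart he.1 one_le_two' hp w).symm
    conv_lhs => rw [hw, eq_sum_stdVec (dChart e p w)]
    simp only [map_add, map_smul, alt1_add, alt1_smul, h0, h1, mul_zero, zero_add]
  have h2 : P.theta p ![dChartSymm e (e p) (stdVec 2)] ≠ 0 := by
    intro h2
    refine theta_ne_zero P p (alt1_ext fun u => ?_)
    rw [hall, h2, mul_zero]
    rfl
  have := hall v
  change P.theta p ![(v : E3)] = 0 at hv
  rw [hv] at this
  exact (mul_eq_zero.1 this.symm).resolve_right h2

/-- On the tangent vectors X and v the form takes the value -Θ(v) ≠ 0, which is also a determinant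
times the density. -/
theorem areaForm_density_ne_zero_of_tangent (he : e ∈ IsManifold.maximalAtlas (𝓡 3) 2 M) {x : E3}
    (hx : x ∈ e.target) (hX : P.IsUnitLegendrian (e.symm x) (X (e.symm x)))
    (hXt : dChart e (e.symm x) (X.vec (e.symm x)) 2 = 0) {v : E3}
    (hv : dChart e (e.symm x) v 2 = 0) (hvθ : P.theta (e.symm x) ![v] ≠ 0) :
    (areaForm P X).density e x ≠ 0 := by
  intro h0
  have h := apply_eq_density P he hx X hXt hv
  rw [h0, mul_zero, areaAlt_apply_self P X X hX, eOne_self P X hX, mul_one] at h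
  exact hvθ (neg_eq_zero.1 h)

theorem areaForm_density_ne_zero (he : IsFlatChart S e) (hS : IsNonsingular P S)
    (hX : IsCharacteristicField P S X) {x : E3} (hx : x ∈ e.target) (hx' : x ∈ halfPlane) :
    (areaForm P X).density e x ≠ 0 := by
  have hpS := he.symm_mem hx hx'
  have hp := e.map_target hx
  obtain ⟨v, hv, hvθ⟩ := exists_tangent_theta_ne_zero P he hp hpS (hS _ hpS)
  obtain ⟨h1, h2⟩ := hX.2 _ hpS
  exact areaForm_density_ne_zero_of_tangent P he.1 hx h1 ((he.isTangent_iff hp hpS _).1 h2) hv hvθ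

/-- A 2-form on a plane is determined by its contraction with a nonzero vector. Here the vector is
e₁', and the contractions of the two p-area forms differ by the factor e¹(e₁'). -/
theorem areaForm_density_eq (he : IsFlatChart S e) (hX' : IsCharacteristicField P S X')
    {x : E3} (hx : x ∈ e.target) (hx' : x ∈ halfPlane) :
    (areaForm P X).density e x =
      eOne P X (e.symm x) ![X'.vec (e.symm x)] * (areaForm P X').density e x := by
  have hpS := he.symm_mem hx hx'
  have hp := e.map_target hx
  obtain ⟨h1, h2⟩ := hX'.2 _ hpS
  have h3 : dChart e (e.symm x) (X'.vec (e.symm x)) 2 = 0 := (he.isTangent_iff hp hpS _).1 h2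
  set p := e.symm x with hpdef
  set a := eOne P X p ![X'.vec p]
  have key : ∀ v : E3, areaAlt P X p ![X'.vec p, v] = a * areaAlt P X' p ![X'.vec p, v] := by
    intro v
    rw [areaAlt_apply_self P X X' h1, areaAlt_apply_self P X' X' h1, eOne_self P X' h1]
    ring
  have hbas : ∀ i, dChart e p (dChartSymm e x (stdVec i)) = stdVec i := fun i =>
    dChart_dChartSymm he.1 one_le_two' hx _
  have k0 := key (dChartSymm e x (stdVec 0))
  have k1 := key (dChartSymm e x (stdVec 1))
  have hb : ∀ i : Fin 3, i ≠ 2 → dChart e p (dChartSymm e x (stdVec i)) 2 = 0 := by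
    intro i hi
    rw [hbas]
    simp [Ne.symm hi]
  rw [apply_eq_density P he.1 hx X h3 (hb 0 (by decide)),
    apply_eq_density P he.1 hx X' h3 (hb 0 (by decide)), ← hpdef, hbas] at k0
  rw [apply_eq_density P he.1 hx X h3 (hb 1 (by decide)),
    apply_eq_density P he.1 hx X' h3 (hb 1 (by decide)), ← hpdef, hbas] at k1
  simp only [stdVec_apply] at k0 k1
  norm_num at k0 k1
  -- Up to sign, `k0` and `k1` are the desired identity multiplied by the second and the first
  -- coordinate of e₁'. If it failed, both coordinates would vanish, hence e₁' = 0, against e¹'(e₁')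
  -- = 1.
  by_contra hne
  have c1 : dChart e p (X'.vec p) 1 = 0 := by
    by_contra hc
    exact hne (mul_left_cancel₀ hc (by linear_combination k0))
  have c0 : dChart e p (X'.vec p) 0 = 0 := by
    by_contra hc
    exact hne (mul_left_cancel₀ hc (by linear_combination k1))
  have hz : dChart e p (X'.vec p) = 0 := by
    rw [eq_sum_stdVec (dChart e p (X'.vec p)), c0, c1, h3]
    simp
  have hz' : X'.vec p = 0 := by
    rw [← dChartSymm_dChart he.1 one_le_two' hp (X'.vec p), hz, map_zero]
  have h4 := eOne_self P X' h1
  rw [hz'] at h4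
  have h5 : eOne P X' p ![(0 : E3)] = 0 := (eOne P X' p).map_coord_zero 0 rfl
  rw [h5] at h4
  exact zero_ne_one h4

end Density

/-! ### The measure of a 2-form in one flat chart -/

section ChartMeasure

variable {M : Type*} [TopologicalSpace M] [ChartedSpace E3 M]

/-- The projection of `ℝ³` onto the first two coordinates. -/
def planeProj : E3 →L[ℝ] ℝ × ℝ :=
  (EuclideanSpace.proj 0 : E3 →L[ℝ] ℝ).prod (EuclideanSpace.proj 1 : E3 →L[ℝ] ℝ)

theorem planeProj_apply (x : E3) : planeProj x = (x 0, x 1) := rfl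

/-- The inclusion of the coordinate plane as a linear map. -/
def planeIncl : ℝ × ℝ →L[ℝ] E3 :=
  (ContinuousLinearMap.fst ℝ ℝ ℝ).smulRight (stdVec 0) +
    (ContinuousLinearMap.snd ℝ ℝ ℝ).smulRight (stdVec 1)

theorem planeIncl_apply (y : ℝ × ℝ) : planeIncl y = planePoint y := by
  ext i
  fin_cases i <;> simp [planeIncl, planePoint]

theorem planePoint_eq_planeIncl : planePoint = planeIncl := funext fun y => (planeIncl_apply y).symm

theorem continuous_planePoint : Continuous planePoint := by
  rw [planePoint_eq_planeIncl]; exact planeIncl.continuous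

@[simp] theorem planePoint_zero (y : ℝ × ℝ) : planePoint y 0 = y.1 := rfl

@[simp] theorem planePoint_one (y : ℝ × ℝ) : planePoint y 1 = y.2 := rfl

@[simp] theorem planePoint_two (y : ℝ × ℝ) : planePoint y 2 = 0 := rfl

@[simp] theorem planeProj_planePoint (y : ℝ × ℝ) : planeProj (planePoint y) = y := rfl

theorem planePoint_planeProj {x : E3} (hx : x 2 = 0) : planePoint (planeProj x) = x := by
  ext i
  fin_cases i <;> simp [planeProj_apply, hx]

theorem planePoint_mem_halfPlane {y : ℝ × ℝ} (hy : 0 ≤ y.1) : planePoint y ∈ halfPlane :=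
  ⟨rfl, hy⟩

/-- The parameter domain of the part of a surface in a flat chart. -/
def chartDom (e : OpenPartialHomeomorph M E3) : Set (ℝ × ℝ) :=
  {y | planePoint y ∈ e.target ∧ 0 ≤ y.1}

/-- The parametrization of a surface in a flat chart. -/
def chartParam (e : OpenPartialHomeomorph M E3) (y : ℝ × ℝ) : M := e.symm (planePoint y)

/-- The measure on a surface given by the absolute value of a 2-form in a flat chart. -/
def chartMeasure [MeasurableSpace M] (σ : DForm 2 M) (e : OpenPartialHomeomorph M E3) : Measure M :=
  Measure.map (chartParam e) ((volume.restrict (chartDom e)).withDensity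
    (fun y => ENNReal.ofReal |σ.density e (planePoint y)|))

/-- The measure on a surface given by the absolute value of a 2-form. -/
def surfMeasure [MeasurableSpace M] (σ : DForm 2 M) (S : Set M) : Measure M :=
  ⨆ e ∈ {e : OpenPartialHomeomorph M E3 | IsFlatChart S e}, chartMeasure σ e

/-- The 2-form `σ` is continuous along the surface `S` and restricts to an area form of `S`. -/
structure IsAreaForm (S : Set M) (σ : DForm 2 M) : Prop where
  cont : ∀ e, IsFlatChart S e → ContinuousOn (σ.inChart e) (e.target ∩ e.symm ⁻¹' S)
  ne_zero : ∀ e, IsFlatChart S e → ∀ x ∈ e.target, x ∈ halfPlane → σ.density e x ≠ 0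

variable {S : Set M} {e e' : OpenPartialHomeomorph M E3} {σ η : DForm 2 M}

theorem measurableSet_chartDom (e : OpenPartialHomeomorph M E3) : MeasurableSet (chartDom e) :=
  ((e.open_target.preimage continuous_planePoint).measurableSet).inter
    (isClosed_le continuous_const continuous_fst).measurableSet

theorem continuousOn_chartParam (e : OpenPartialHomeomorph M E3) :
    ContinuousOn (chartParam e) (chartDom e) :=
  e.continuousOn_symm.comp continuous_planePoint.continuousOn fun _ hy => hy.1

theorem chartParam_mem_source {y : ℝ × ℝ} (hy : y ∈ chartDom e) : chartParam e y ∈ e.source :=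
  e.map_target hy.1

theorem IsFlatChart.chartParam_mem (he : IsFlatChart S e) {y : ℝ × ℝ} (hy : y ∈ chartDom e) :
    chartParam e y ∈ S := by
  have h := he.2 (e.map_target hy.1)
  rw [e.right_inv hy.1] at h
  exact h.1 (planePoint_mem_halfPlane hy.2)

theorem continuousOn_density {A : Set E3} (h : ContinuousOn (σ.inChart e) A) :
    ContinuousOn (σ.density e) A := by
  have h1 := contDiffOn_alt2_iff.1 ((contDiffOn_zero (𝕜 := ℝ)).2 h)
  exact contDiffOn_zero.1 (h1 (stdVec 0) (stdVec 1))

theorem IsFlatChart.continuousOn_density_planePoint (he : IsFlatChart S e)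
    (h : ContinuousOn (σ.inChart e) (e.target ∩ e.symm ⁻¹' S)) :
    ContinuousOn (fun y => σ.density e (planePoint y)) (chartDom e) :=
  (continuousOn_density h).comp continuous_planePoint.continuousOn
    fun _ hy => ⟨hy.1, he.chartParam_mem hy⟩

/-- Serves for `chartParam`, whose continuity is known only on `chartDom`. -/
theorem measurableSet_inter_preimage {α β : Type*} [TopologicalSpace α] [MeasurableSpace α]
    [OpensMeasurableSpace α] [TopologicalSpace β] [MeasurableSpace β] [BorelSpace β] {f : α → β}
    {s : Set α} (hf : ContinuousOn f s) (hs : MeasurableSet s) {B : Set β}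
    (hB : MeasurableSet B) : MeasurableSet (s ∩ f ⁻¹' B) := by
  have h2 := MeasurableSet.subtype_image hs
    ((continuousOn_iff_continuous_domRestrict.1 hf).measurable hB)
  convert h2 using 1
  ext x
  simp [Set.domRestrict, and_comm]

variable [MeasurableSpace M] [BorelSpace M]

theorem aemeasurable_chartParam (f : ℝ × ℝ → ℝ≥0∞) :
    AEMeasurable (chartParam e) ((volume.restrict (chartDom e)).withDensity f) :=
  ((continuousOn_chartParam e).aemeasurable (measurableSet_chartDom e)).mono_ac
    (withDensity_absolutelyContinuous _ _)

theorem chartMeasure_apply {B : Set M} (hB : MeasurableSet B) :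
    chartMeasure σ e B = ∫⁻ y in chartDom e ∩ chartParam e ⁻¹' B,
      ENNReal.ofReal |σ.density e (planePoint y)| := by
  rw [chartMeasure, Measure.map_apply_of_aemeasurable (aemeasurable_chartParam _) hB,
    withDensity_apply', Measure.restrict_restrict' (measurableSet_chartDom e), inter_comm]

theorem chartMeasure_eq_zero (he : IsFlatChart S e) {B : Set M} (hB : MeasurableSet B)
    (h : Disjoint B (S ∩ e.source)) : chartMeasure σ e B = 0 := by
  rw [chartMeasure_apply hB]
  have : chartDom e ∩ chartParam e ⁻¹' B = ∅ := by
    ext y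
    simp only [mem_inter_iff, mem_preimage, mem_empty_iff_false, iff_false, not_and]
    intro hy hyB
    exact disjoint_left.1 h hyB ⟨he.chartParam_mem hy, chartParam_mem_source hy⟩
  rw [this, Measure.restrict_empty, lintegral_zero_measure]

end ChartMeasure

/-! ### Gluing the chart measures into one finite measure -/

section ChangeOfCharts

variable {M : Type*} [TopologicalSpace M] [ChartedSpace E3 M] [IsManifold (𝓡 3) ∞ M]
  {S : Set M} {e e' : OpenPartialHomeomorph M E3} {σ η : DForm 2 M}

/-- The Jacobian of the coordinate change between two flat charts, in the plane. -/
def planeJac (e e' : OpenPartialHomeomorph M E3) (x : E3) : ℝ :=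
  fderiv ℝ (transition e e') x (stdVec 0) 0 * fderiv ℝ (transition e e') x (stdVec 1) 1 -
    fderiv ℝ (transition e e') x (stdVec 0) 1 * fderiv ℝ (transition e e') x (stdVec 1) 0

/-- The derivative of the coordinate change preserves the plane, so pull-back of a 2-form reduces
there to a 2 × 2 determinant. -/
theorem density_eq_planeJac_mul (he : IsFlatChart S e) (he' : IsFlatChart S e') {x : E3}
    (hx : x ∈ overlap e e') (hx' : x ∈ halfPlane) :
    η.density e x = planeJac e e' x * η.density e' (transition e e' x) := by
  rw [DForm.density, η.inChart_eq_pullback he.1 he'.1 one_le_two' hx]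
  have h : ((η.inChart e' (transition e e' x)).compContinuousLinearMap
      (fderiv ℝ (transition e e') x)) ![stdVec 0, stdVec 1] =
      η.inChart e' (transition e e' x) ![fderiv ℝ (transition e e') x (stdVec 0),
        fderiv ℝ (transition e e') x (stdVec 1)] :=
    congrArg (η.inChart e' (transition e e' x)) (comp_vec2 _ _ _)
  rw [h, alt2_plane _ (he.fderiv_transition_plane he' hx hx' (by simp))
    (he.fderiv_transition_plane he' hx hx' (by simp))]
  rfl

theorem det_plane (L : E3 →L[ℝ] E3) : (planeProj.comp (L.comp planeIncl)).det =
    L (stdVec 0) 0 * L (stdVec 1) 1 - L (stdVec 0) 1 * L (stdVec 1) 0 := by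
  rw [ContinuousLinearMap.det, ← LinearMap.det_toMatrix (Module.Basis.finTwoProd ℝ),
    Matrix.det_fin_two]
  simp only [LinearMap.toMatrix_apply, Module.Basis.finTwoProd_zero, Module.Basis.finTwoProd_one]
  have h0 : planeIncl (1, 0) = stdVec 0 := by simp [planeIncl]
  have h1 : planeIncl (0, 1) = stdVec 1 := by simp [planeIncl]
  simp [h0, h1, planeProj_apply]
  ring

variable [MeasurableSpace M] [BorelSpace M]

/-- The measures given by `σ` in two flat charts agree on the intersection of their domains. -/
theorem chartMeasure_inter_source (he : IsFlatChart S e) (he' : IsFlatChart S e') {B : Set M}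
    (hB : MeasurableSet B) :
    chartMeasure σ e (B ∩ e'.source) = chartMeasure σ e' (B ∩ e.source) := by
  rw [chartMeasure_apply (hB.inter e'.open_source.measurableSet),
    chartMeasure_apply (hB.inter e.open_source.measurableSet)]
  set D := chartDom e ∩ chartParam e ⁻¹' (B ∩ e'.source) with hD
  set D' := chartDom e' ∩ chartParam e' ⁻¹' (B ∩ e.source) with hD'
  -- ψ is the coordinate change read on the surface parameters, a bijection from D to D' with
  -- Jacobian `planeJac`.
  set ψ : ℝ × ℝ → ℝ × ℝ := fun y => planeProj (transition e e' (planePoint y)) with hψ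
  have hov : ∀ y ∈ D, planePoint y ∈ overlap e e' := fun y hy => ⟨hy.1.1, hy.2.2⟩
  have hplane : ∀ y ∈ D, planePoint (ψ y) = transition e e' (planePoint y) := fun y hy =>
    planePoint_planeProj (he.transition_mem_halfPlane he' (hov y hy)
      (planePoint_mem_halfPlane hy.1.2)).1
  have hmaps : ∀ y ∈ D, ψ y ∈ D' := by
    intro y hy
    have h1 := he.transition_mem_halfPlane he' (hov y hy) (planePoint_mem_halfPlane hy.1.2)
    have h2 := transition_mem (hov y hy)
    refine ⟨⟨?_, ?_⟩, ?_⟩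
    · rw [hplane y hy]; exact h2.1
    · exact h1.2
    · have h3 : chartParam e' (ψ y) = chartParam e y := by
        unfold chartParam
        rw [hplane y hy, symm_transition (hov y hy)]
      rw [mem_preimage, h3]
      exact ⟨hy.2.1, e.map_target hy.1.1⟩
  have himg : ψ '' D = D' := by
    refine Subset.antisymm (by rintro _ ⟨y, hy, rfl⟩; exact hmaps y hy) fun z hz => ?_
    have hzov : planePoint z ∈ overlap e' e := ⟨hz.1.1, hz.2.2⟩
    have h1 := he'.transition_mem_halfPlane he hzov (planePoint_mem_halfPlane hz.1.2)
    have h2 := transition_mem hzov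
    have h3 := planePoint_planeProj h1.1
    refine ⟨planeProj (transition e' e (planePoint z)), ⟨⟨?_, h1.2⟩, ?_⟩, ?_⟩
    · rw [h3]; exact h2.1
    · rw [mem_preimage, chartParam, h3, symm_transition hzov]
      exact ⟨hz.2.1, e'.map_target hz.1.1⟩
    · simp only [hψ]
      rw [h3, transition_transition hzov, planeProj_planePoint]
  have hinj : InjOn ψ D := by
    intro y hy z hz hyz
    have h1 : transition e e' (planePoint y) = transition e e' (planePoint z) := by
      rw [← hplane y hy, ← hplane z hz, hyz]
    have h2 := congrArg (transition e' e) h1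
    rw [transition_transition (hov y hy), transition_transition (hov z hz)] at h2
    simpa using congrArg planeProj h2
  have hmeas : MeasurableSet D := measurableSet_inter_preimage (continuousOn_chartParam e)
    (measurableSet_chartDom e) (hB.inter e'.open_source.measurableSet)
  have hder : ∀ y ∈ D, HasFDerivWithinAt ψ
      (planeProj.comp ((fderiv ℝ (transition e e') (planePoint y)).comp planeIncl)) D y := by
    intro y hy
    have h1 := (differentiableAt_transition he.1 he'.1 one_le_two' (hov y hy)).hasFDerivAt
    have h2 : HasFDerivAt planePoint planeIncl y := by
      rw [planePoint_eq_planeIncl]; exact planeIncl.hasFDerivAt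
    exact (planeProj.hasFDerivAt.comp y (h1.comp y h2)).hasFDerivWithinAt
  -- D need not be open, as it may contain boundary parameters, so derivatives within D are used.
  rw [← himg, lintegral_image_eq_lintegral_abs_det_fderiv_mul volume hmeas hder hinj]
  refine setLIntegral_congr_fun hmeas fun y hy => ?_
  simp only
  rw [hplane y hy, det_plane, ← ENNReal.ofReal_mul (abs_nonneg _), ← abs_mul,
    density_eq_planeJac_mul he he' (hov y hy) (planePoint_mem_halfPlane hy.1.2)]
  rfl

/-- A finite family of flat charts dominates all measures given by `σ` in flat charts, on the union
of their domains. -/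
theorem exists_dominating_measure (σ : DForm 2 M) (l : List (OpenPartialHomeomorph M E3))
    (hl : ∀ e ∈ l, IsFlatChart S e) : ∃ ν : Measure M,
      (∀ e', IsFlatChart S e' → ∀ B, MeasurableSet B → (∀ p ∈ B, ∃ e ∈ l, p ∈ e.source) →
        chartMeasure σ e' B ≤ ν B) ∧
      (∀ e l', l = e :: l' → ∀ B, MeasurableSet B → B ⊆ e.source → ν B ≤ chartMeasure σ e B) := by
  induction l with
  | nil =>
    refine ⟨0, fun e' _ B _ h => ?_, fun e l' h => by simp at h⟩
    have : B = ∅ := by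
      ext p
      simp only [mem_empty_iff_false, iff_false]
      intro hp
      obtain ⟨e, he, -⟩ := h p hp
      simp at he
    simp [this]
  | cons e l ih =>
    obtain ⟨ν, hν, -⟩ := ih fun e' he' => hl e' (List.mem_cons_of_mem _ he')
    have he := hl e List.mem_cons_self
    have hem := e.open_source.measurableSet
    -- The head chart is used on its whole domain and the remaining charts only outside it. Nothing
    -- is counted twice, and the sum is exact on the head chart.
    refine ⟨chartMeasure σ e + ν.restrict e.sourceᶜ, fun e' he' B hB h => ?_,
      fun e₂ l' h B hB hBe => ?_⟩
    · rw [← measure_inter_add_sdiff B hem, Measure.add_apply, Measure.restrict_apply hB]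
      refine add_le_add ?_ ?_
      · rw [chartMeasure_inter_source he' he hB]
        exact measure_mono inter_subset_left
      · rw [← sdiff_eq]
        refine hν e' he' _ (hB.diff hem) fun p hp => ?_
        obtain ⟨e₁, he₁, hp₁⟩ := h p hp.1
        rcases List.mem_cons.1 he₁ with h2 | h2
        · exact absurd (h2 ▸ hp₁) hp.2
        · exact ⟨e₁, h2, hp₁⟩
    · obtain ⟨h1, -⟩ := List.cons.inj h
      subst h1
      rw [Measure.add_apply, Measure.restrict_apply hB]
      have : B ∩ e.sourceᶜ = ∅ := by
        rw [← sdiff_eq]; exact sdiff_eq_empty.2 hBe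
      simp [this]

theorem exists_flat_cover (hS : IsSurface S) (hSc : IsCompact S) :
    ∃ l : List (OpenPartialHomeomorph M E3), (∀ e ∈ l, IsFlatChart S e) ∧
      ∀ p ∈ S, ∃ e ∈ l, p ∈ e.source := by
  classical
  rcases S.eq_empty_or_nonempty with rfl | ⟨p₀, -⟩
  · exact ⟨[], by simp, by simp⟩
  have : Nonempty (OpenPartialHomeomorph M E3) := ⟨chartAt E3 p₀⟩
  choose! c hc using hS
  obtain ⟨t, ht, hcov⟩ := hSc.elim_nhds_subcover (fun p => (c p).source)
    fun p hp => (c p).open_source.mem_nhds (hc p hp).2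
  refine ⟨t.toList.map c, ?_, ?_⟩
  · intro e he
    obtain ⟨p, hp, rfl⟩ := List.mem_map.1 he
    exact (hc p (ht p (Finset.mem_toList.1 hp))).1
  · intro p hp
    obtain ⟨q, hq, hpq⟩ := mem_iUnion₂.1 (hcov hp)
    exact ⟨c q, List.mem_map.2 ⟨q, Finset.mem_toList.2 hq, rfl⟩, hpq⟩

theorem chartMeasure_le_surfMeasure (he : IsFlatChart S e) :
    chartMeasure σ e ≤ surfMeasure σ S :=
  le_iSup₂ (f := fun e (_ : e ∈ {e : OpenPartialHomeomorph M E3 | IsFlatChart S e}) =>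
    chartMeasure σ e) e he

/-- The supremum over all flat charts is bounded by one measure: complete e to a finite cover of S
with e at the head. The resulting dominating measure does not exceed the chart measure of e on the
domain of e. -/
theorem surfMeasure_apply_of_subset [T2Space M] (hS : IsSurface S) (hSc : IsCompact S)
    (he : IsFlatChart S e) {B : Set M} (hB : MeasurableSet B) (hBe : B ⊆ e.source) :
    surfMeasure σ S B = chartMeasure σ e B := by
  refine le_antisymm ?_ (chartMeasure_le_surfMeasure he B)
  obtain ⟨l, hl, hcov⟩ := exists_flat_cover hS hSc
  obtain ⟨ν, hν, hν'⟩ := exists_dominating_measure (S := S) σ (e :: l) (by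
    intro e' he'
    rcases List.mem_cons.1 he' with h | h
    · exact h ▸ he
    · exact hl e' h)
  have hle : surfMeasure σ S ≤ ν := by
    refine iSup₂_le fun e' he' => Measure.le_iff.2 fun A hA => ?_
    have hSm := hSc.isClosed.measurableSet
    rw [← measure_inter_add_sdiff A hSm, chartMeasure_eq_zero he' (hA.diff hSm)
      (disjoint_left.2 fun p hp hp' => hp.2 hp'.1), add_zero]
    refine (hν e' he' _ (hA.inter hSm) fun p hp => ?_).trans (measure_mono inter_subset_left)
    obtain ⟨e₁, h1, h2⟩ := hcov p hp.2
    exact ⟨e₁, List.mem_cons_of_mem _ h1, h2⟩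
  exact (hle B).trans (hν' e l rfl B hB hBe)

theorem surfMeasure_restrict_source [T2Space M] (hS : IsSurface S) (hSc : IsCompact S)
    (he : IsFlatChart S e) : (surfMeasure σ S).restrict e.source = chartMeasure σ e := by
  ext B hB
  rw [Measure.restrict_apply hB, surfMeasure_apply_of_subset hS hSc he
    (hB.inter e.open_source.measurableSet) inter_subset_right]
  have h := measure_inter_add_sdiff (μ := chartMeasure σ e) B e.open_source.measurableSet
  rwa [chartMeasure_eq_zero he (hB.diff e.open_source.measurableSet)
    (disjoint_left.2 fun p hp hp' => hp.2 hp'.2), add_zero] at h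

/-- The measure of a compact surface is finite. -/
theorem surfMeasure_lt_top [T2Space M] (hS : IsSurface S) (hSc : IsCompact S)
    (hσ : IsAreaForm S σ) : surfMeasure σ S S < ⊤ := by
  refine hSc.measure_lt_top_of_nhdsWithin fun p hp => ?_
  obtain ⟨e, he, hpe⟩ := hS p hp
  obtain ⟨r, hr, hball⟩ := Metric.nhds_basis_closedBall.mem_iff.1
    (e.open_target.mem_nhds (e.map_source hpe))
  set N := e.source ∩ e ⁻¹' Metric.ball (e p) r with hN
  have hNo : IsOpen N := e.isOpen_inter_preimage Metric.isOpen_ball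
  refine ⟨N, mem_nhdsWithin_of_mem_nhds (hNo.mem_nhds ⟨hpe, Metric.mem_ball_self hr⟩), ?_⟩
  rw [surfMeasure_apply_of_subset hS hSc he hNo.measurableSet inter_subset_left,
    chartMeasure_apply hNo.measurableSet]
  -- N is parametrized from within a compact piece K of the half-plane, where the continuous density
  -- is bounded.
  set K := {y : ℝ × ℝ | planePoint y ∈ Metric.closedBall (e p) r ∧ 0 ≤ y.1} with hK
  have hKc : IsCompact K := by
    refine Metric.isCompact_of_isClosed_isBounded ?_ ?_
    · exact (Metric.isClosed_closedBall.preimage continuous_planePoint).inter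
        (isClosed_le continuous_const continuous_fst)
    · have h1 := (isCompact_closedBall (e p) r).image planeProj.continuous
      refine h1.isBounded.subset fun y hy => ⟨planePoint y, hy.1, planeProj_planePoint y⟩
  have hKd : K ⊆ chartDom e := fun y hy => ⟨hball hy.1, hy.2⟩
  have hsub : chartDom e ∩ chartParam e ⁻¹' N ⊆ K := by
    rintro y ⟨hy, -, hy2⟩
    refine ⟨?_, hy.2⟩
    have : e (chartParam e y) ∈ Metric.ball (e p) r := hy2
    rw [chartParam, e.right_inv hy.1] at this
    exact Metric.ball_subset_closedBall this
  obtain ⟨C, hC⟩ := hKc.exists_bound_of_continuousOn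
    ((he.continuousOn_density_planePoint (hσ.cont e he)).mono hKd)
  calc _ ≤ ∫⁻ y in K, ENNReal.ofReal |σ.density e (planePoint y)| := lintegral_mono_set hsub
    _ ≤ ∫⁻ _ in K, ENNReal.ofReal C := by
        refine setLIntegral_mono' hKc.measurableSet fun y hy => ?_
        exact ENNReal.ofReal_le_ofReal (hC y hy)
    _ = ENNReal.ofReal C * volume K := by rw [setLIntegral_const]
    _ < ⊤ := ENNReal.mul_lt_top ENNReal.ofReal_lt_top hKc.measure_lt_top

end ChangeOfCharts

/-! ### Integration of 2-forms over a surface oriented by an area form -/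

section FormRatio

variable {M : Type*} [TopologicalSpace M] [ChartedSpace E3 M]

open Classical in
/-- The quotient `η/σ` of the restrictions of two 2-forms to the surface `S`. -/
def formRatio (S : Set M) (η σ : DForm 2 M) (p : M) : ℝ :=
  if h : ∃ e, IsFlatChart S e ∧ p ∈ e.source then
    η.density h.choose (h.choose p) / σ.density h.choose (h.choose p) else 0

/-- The integral of the 2-form `η` over the surface `S`, oriented by the form `σ`. -/
def surfIntegral [MeasurableSpace M] (S : Set M) (σ η : DForm 2 M) : ℝ :=
  ∫ p in S, formRatio S η σ p ∂(surfMeasure σ S)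

/-- The 2-form `η` is continuous along the surface `S`. -/
def IsContinuousAlong (S : Set M) (η : DForm 2 M) : Prop :=
  ∀ e, IsFlatChart S e → ContinuousOn (η.inChart e) (e.target ∩ e.symm ⁻¹' S)

variable [IsManifold (𝓡 3) ∞ M] {S : Set M} {e e' : OpenPartialHomeomorph M E3} {σ η η' : DForm 2 M}

/-- Both densities change by the same nonzero Jacobian, so the quotient does not depend on the
chosen flat chart. -/
theorem formRatio_eq (hσ : IsAreaForm S σ) (he : IsFlatChart S e) {p : M} (hp : p ∈ e.source)
    (hpS : p ∈ S) : formRatio S η σ p = η.density e (e p) / σ.density e (e p) := by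
  have h : ∃ e, IsFlatChart S e ∧ p ∈ e.source := ⟨e, he, hp⟩
  rw [formRatio, dif_pos h]
  obtain ⟨h1, h2⟩ := h.choose_spec
  set e' := h.choose
  have hx := mem_overlap_of_mem hp h2
  have hx' := he.apply_mem hp hpS
  have hη := density_eq_planeJac_mul (η := η) he h1 hx hx'
  have hs := density_eq_planeJac_mul (η := σ) he h1 hx hx'
  rw [transition_apply hp] at hη hs
  have hne := hσ.ne_zero e he _ (e.map_source hp) hx'
  have hJ : planeJac e e' (e p) ≠ 0 := by
    intro h0
    rw [h0, zero_mul] at hs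
    exact hne hs
  rw [hη, hs, mul_div_mul_left _ _ hJ]

theorem continuousOn_formRatio (hS : IsSurface S) (hσ : IsAreaForm S σ)
    (hη : IsContinuousAlong S η) : ContinuousOn (formRatio S η σ) S := by
  intro p hp
  obtain ⟨e, he, hpe⟩ := hS p hp
  have h1 : ContinuousOn (fun q => η.density e (e q) / σ.density e (e q)) (e.source ∩ S) := by
    have hm : MapsTo e (e.source ∩ S) (e.target ∩ e.symm ⁻¹' S) := fun q hq =>
      ⟨e.map_source hq.1, by simpa [e.left_inv hq.1] using hq.2⟩
    refine ContinuousOn.div ((continuousOn_density (hη e he)).comp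
      (e.continuousOn.mono inter_subset_left) hm) ((continuousOn_density (hσ.cont e he)).comp
      (e.continuousOn.mono inter_subset_left) hm) fun q hq => ?_
    exact hσ.ne_zero e he _ (e.map_source hq.1) (he.apply_mem hq.1 hq.2)
  have h2 : ContinuousOn (formRatio S η σ) (e.source ∩ S) :=
    h1.congr fun q hq => formRatio_eq hσ he hq.1 hq.2
  refine (h2 p ⟨hpe, hp⟩).mono_of_mem_nhdsWithin ?_
  filter_upwards [self_mem_nhdsWithin, mem_nhdsWithin_of_mem_nhds
    (e.open_source.mem_nhds hpe)] with q hq hq'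
  exact ⟨hq', hq⟩

theorem formRatio_add (hS : IsSurface S) (hσ : IsAreaForm S σ) {p : M} (hp : p ∈ S) {ζ : DForm 2 M}
    (h : ζ p = η p + η' p) :
    formRatio S ζ σ p = formRatio S η σ p + formRatio S η' σ p := by
  obtain ⟨e, he, hpe⟩ := hS p hp
  rw [formRatio_eq hσ he hpe hp, formRatio_eq hσ he hpe hp, formRatio_eq hσ he hpe hp, ← add_div]
  congr 1
  change ζ (e.symm (e p)) _ = η (e.symm (e p)) _ + η' (e.symm (e p)) _
  rw [e.left_inv hpe, h]
  rfl

theorem formRatio_congr (hS : IsSurface S) (hσ : IsAreaForm S σ) {p : M} (hp : p ∈ S)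
    (h : η p = η' p) : formRatio S η σ p = formRatio S η' σ p := by
  obtain ⟨e, he, hpe⟩ := hS p hp
  rw [formRatio_eq hσ he hpe hp, formRatio_eq hσ he hpe hp]
  congr 1
  change η (e.symm (e p)) _ = η' (e.symm (e p)) _
  rw [e.left_inv hpe, h]

theorem formRatio_zero (hS : IsSurface S) (hσ : IsAreaForm S σ) {p : M} (hp : p ∈ S)
    (h : η p = 0) : formRatio S η σ p = 0 := by
  obtain ⟨e, he, hpe⟩ := hS p hp
  rw [formRatio_eq hσ he hpe hp]
  have : η.density e (e p) = 0 := by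
    change η (e.symm (e p)) _ = 0
    rw [e.left_inv hpe, h]
    rfl
  rw [this, zero_div]

theorem formRatio_self (hS : IsSurface S) (hσ : IsAreaForm S σ) {p : M} (hp : p ∈ S) :
    formRatio S σ σ p = 1 := by
  obtain ⟨e, he, hpe⟩ := hS p hp
  rw [formRatio_eq hσ he hpe hp]
  exact div_self (hσ.ne_zero e he _ (e.map_source hpe) (he.apply_mem hpe hp))

variable [MeasurableSpace M] [BorelSpace M] [T2Space M]

theorem integrableOn_formRatio (hS : IsSurface S) (hSc : IsCompact S) (hσ : IsAreaForm S σ)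
    (hη : IsContinuousAlong S η) : IntegrableOn (formRatio S η σ) S (surfMeasure σ S) := by
  have hc := continuousOn_formRatio hS hσ hη
  obtain ⟨C, hC⟩ := hSc.exists_bound_of_continuousOn hc
  exact IntegrableOn.of_bound (surfMeasure_lt_top hS hSc hσ)
    (hc.aestronglyMeasurable hSc.isClosed.measurableSet) C
    (ae_restrict_of_forall_mem hSc.isClosed.measurableSet hC)

theorem surfIntegral_self (hS : IsSurface S) (hSc : IsCompact S) (hσ : IsAreaForm S σ) :
    surfIntegral S σ σ = (surfMeasure σ S S).toReal := by
  rw [surfIntegral, setIntegral_congr_fun (g := fun _ => (1 : ℝ)) hSc.isClosed.measurableSet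
    fun p hp => formRatio_self hS hσ hp]
  simp [Measure.real]

theorem surfIntegral_le (hS : IsSurface S) (hSc : IsCompact S) (hσ : IsAreaForm S σ)
    (hη : IsContinuousAlong S η) (h : ∀ p ∈ S, formRatio S η σ p ≤ 1) :
    surfIntegral S σ η ≤ (surfMeasure σ S S).toReal := by
  rw [← surfIntegral_self hS hSc hσ]
  refine setIntegral_mono_on (integrableOn_formRatio hS hSc hσ hη)
    (integrableOn_formRatio hS hSc hσ hσ.cont) hSc.isClosed.measurableSet fun p hp => ?_
  rw [formRatio_self hS hσ hp]
  exact h p hp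

theorem surfIntegral_add (hS : IsSurface S) (hSc : IsCompact S) (hσ : IsAreaForm S σ)
    (hη : IsContinuousAlong S η) (hη' : IsContinuousAlong S η') {ζ : DForm 2 M}
    (h : ∀ p ∈ S, ζ p = η p + η' p) :
    surfIntegral S σ ζ = surfIntegral S σ η + surfIntegral S σ η' := by
  rw [surfIntegral, setIntegral_congr_fun hSc.isClosed.measurableSet
    fun p hp => formRatio_add hS hσ hp (h p hp)]
  exact integral_add (integrableOn_formRatio hS hSc hσ hη) (integrableOn_formRatio hS hSc hσ hη')

theorem surfIntegral_congr (hS : IsSurface S) (hSc : IsCompact S) (hσ : IsAreaForm S σ)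
    (h : ∀ p ∈ S, η p = η' p) : surfIntegral S σ η = surfIntegral S σ η' :=
  setIntegral_congr_fun hSc.isClosed.measurableSet fun p hp => formRatio_congr hS hσ hp (h p hp)

theorem surfIntegral_eq_zero (hS : IsSurface S) (hSc : IsCompact S) (hσ : IsAreaForm S σ)
    (h : ∀ p ∈ S, η p = 0) : surfIntegral S σ η = 0 := by
  rw [surfIntegral, setIntegral_congr_fun (g := fun _ => (0 : ℝ)) hSc.isClosed.measurableSet
    fun p hp => formRatio_zero hS hσ hp (h p hp)]
  simp

/-- The integral over a surface of a form supported in the domain of a flat chart. -/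
theorem surfIntegral_eq_chart (hS : IsSurface S) (hSc : IsCompact S) (hσ : IsAreaForm S σ)
    (hη : IsContinuousAlong S η) (he : IsFlatChart S e) (h : ∀ p ∈ S, p ∉ e.source → η p = 0) :
    surfIntegral S σ η = ∫ y in chartDom e,
      SignType.sign (σ.density e (planePoint y)) * η.density e (planePoint y) := by
  have hSm := hSc.isClosed.measurableSet
  have hem := e.open_source.measurableSet
  have h1 : surfIntegral S σ η = ∫ p in S ∩ e.source, formRatio S η σ p ∂(surfMeasure σ S) := by
    rw [surfIntegral, setIntegral_eq_of_subset_of_forall_sdiff_eq_zero hSm inter_subset_left]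
    intro p hp
    exact formRatio_zero hS hσ hp.1 (h p hp.1 fun hpe => hp.2 ⟨hp.1, hpe⟩)
  have h2 : chartMeasure σ e = (surfMeasure σ S).restrict (S ∩ e.source) := by
    rw [← Measure.restrict_restrict hSm, surfMeasure_restrict_source hS hSc he]
    symm
    refine Measure.restrict_eq_self_of_ae_mem ?_
    rw [ae_iff]
    exact chartMeasure_eq_zero he hSm.compl (disjoint_left.2 fun p hp hp' => hp hp'.1)
  rw [h1, ← h2, chartMeasure, integral_map (aemeasurable_chartParam _)]
  · rw [integral_withDensity_eq_integral_toReal_smul₀]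
    · refine setIntegral_congr_fun (measurableSet_chartDom e) fun y hy => ?_
      have hp := chartParam_mem_source hy
      have hpS := he.chartParam_mem hy
      have hex : e (chartParam e y) = planePoint y := e.right_inv hy.1
      rw [formRatio_eq hσ he hp hpS, hex, ENNReal.toReal_ofReal (abs_nonneg _), smul_eq_mul]
      have hne := hσ.ne_zero e he _ hy.1 (planePoint_mem_halfPlane hy.2)
      -- |σ| · (η/σ) = sign(σ) · η: the measure |σ| turns the quotient into the oriented integrand.
      rw [← sign_mul_self (σ.density e (planePoint y))]
      field_simp
    · exact ((he.continuousOn_density_planePoint (hσ.cont e he)).abs.aemeasurable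
        (measurableSet_chartDom e)).ennreal_ofReal
    · exact Filter.Eventually.of_forall fun y => ENNReal.ofReal_lt_top
  · change AEStronglyMeasurable _ (chartMeasure σ e)
    rw [h2]
    exact ((continuousOn_formRatio hS hσ hη).mono inter_subset_left).aestronglyMeasurable
      (hSm.inter hem)

end FormRatio

/-! ### Stokes' theorem in the half-plane -/

section HalfPlaneStokes

theorem integrable_of_compactSupport {f : ℝ × ℝ → ℝ} (hf : Continuous f)
    (hc : HasCompactSupport f) : Integrable f := hf.integrable_of_hasCompactSupport hc

theorem hasCompactSupport_slice_left {f : ℝ × ℝ → ℝ} (hc : HasCompactSupport f) (s : ℝ) :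
    HasCompactSupport (fun t => f (s, t)) := by
  refine HasCompactSupport.intro (hc.image continuous_snd) fun t ht => ?_
  by_contra h
  exact ht ⟨(s, t), subset_tsupport _ h, rfl⟩

theorem hasCompactSupport_slice_right {f : ℝ × ℝ → ℝ} (hc : HasCompactSupport f) (t : ℝ) :
    HasCompactSupport (fun s => f (s, t)) := by
  refine HasCompactSupport.intro (hc.image continuous_fst) fun s hs => ?_
  by_contra h
  exact hs ⟨(s, t), subset_tsupport _ h, rfl⟩

/-- Stokes' theorem in the half-plane. -/
theorem integral_halfPlane {a b : ℝ × ℝ → ℝ} (ha : ContDiff ℝ 1 a) (hb : ContDiff ℝ 1 b)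
    (hac : HasCompactSupport a) (hbc : HasCompactSupport b) :
    ∫ y in {y : ℝ × ℝ | 0 ≤ y.1}, (fderiv ℝ b y (1, 0) - fderiv ℝ a y (0, 1)) =
      -∫ t, b (0, t) := by
  have hset : {y : ℝ × ℝ | 0 ≤ y.1} = Ici (0 : ℝ) ×ˢ (univ : Set ℝ) := by
    ext y; simp
  have hcont : ∀ {f : ℝ × ℝ → ℝ} (v : ℝ × ℝ), ContDiff ℝ 1 f →
      Continuous fun y => fderiv ℝ f y v := fun v hf =>
    (hf.continuous_fderiv one_ne_zero).clm_apply continuous_const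
  have hcs : ∀ {f : ℝ × ℝ → ℝ} (v : ℝ × ℝ), HasCompactSupport f →
      HasCompactSupport fun y => fderiv ℝ f y v := fun v hf => hf.fderiv_apply ℝ v
  have hbi : Integrable fun y => fderiv ℝ b y (1, 0) :=
    integrable_of_compactSupport (hcont _ hb) (hcs _ hbc)
  have hai : Integrable fun y => fderiv ℝ a y (0, 1) :=
    integrable_of_compactSupport (hcont _ ha) (hcs _ hac)
  have hda : ∀ s t : ℝ, HasDerivAt (fun t => a (s, t)) (fderiv ℝ a (s, t) (0, 1)) t := by
    intro s t
    have h1 : HasDerivAt (fun t : ℝ => (s, t)) ((0 : ℝ), (1 : ℝ)) t :=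
      (hasDerivAt_const t s).prodMk (hasDerivAt_id t)
    exact ((ha.differentiable one_ne_zero) (s, t)).hasFDerivAt.comp_hasDerivAt t h1
  have hdb : ∀ s t : ℝ, HasDerivAt (fun s => b (s, t)) (fderiv ℝ b (s, t) (1, 0)) s := by
    intro s t
    have h1 : HasDerivAt (fun s : ℝ => (s, t)) ((1 : ℝ), (0 : ℝ)) s :=
      (hasDerivAt_id s).prodMk (hasDerivAt_const s t)
    exact ((hb.differentiable one_ne_zero) (s, t)).hasFDerivAt.comp_hasDerivAt s h1
  -- The second variable runs over a full line, so compact support leaves no boundary term.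
  have Ia : ∫ y in Ici (0 : ℝ) ×ˢ (univ : Set ℝ), fderiv ℝ a y (0, 1) = 0 := by
    rw [Measure.volume_eq_prod, setIntegral_prod _ (by exact hai.integrableOn)]
    simp only [Measure.restrict_univ]
    have : ∀ s : ℝ, ∫ t, fderiv ℝ a (s, t) (0, 1) = 0 := by
      intro s
      refine integral_eq_zero_of_hasDerivAt_of_integrable (hda s) ?_ ?_
      · exact ((hcont (0, 1) ha).comp (by fun_prop : Continuous fun t : ℝ => (s, t)))
          |>.integrable_of_hasCompactSupport (hasCompactSupport_slice_left (hcs (0, 1) hac) s)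
      · exact (ha.continuous.comp (by fun_prop : Continuous fun t : ℝ => (s, t)))
          |>.integrable_of_hasCompactSupport (hasCompactSupport_slice_left hac s)
    simp [this]
  -- The first variable runs over a half-line, integrated first after swapping the factors. The
  -- lower endpoint 0 gives the minus sign.
  have Ib : ∫ y in Ici (0 : ℝ) ×ˢ (univ : Set ℝ), fderiv ℝ b y (1, 0) = -∫ t, b (0, t) := by
    rw [Measure.volume_eq_prod, ← setIntegral_prod_swap,
      setIntegral_prod _ (by exact hbi.swap.integrableOn)]
    simp only [Measure.restrict_univ]
    rw [← integral_neg]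
    refine integral_congr_ae (Filter.Eventually.of_forall fun t => ?_)
    simp only [Prod.swap_prod_mk]
    have h := (hasCompactSupport_slice_right hbc t).integral_Ioi_deriv_eq
      (hb.comp (by fun_prop : ContDiff ℝ 1 fun s : ℝ => (s, t))) 0
    rw [integral_Ici_eq_integral_Ioi]
    refine Eq.trans ?_ h
    refine setIntegral_congr_fun measurableSet_Ioi fun s _ => ?_
    exact ((hdb s t).deriv).symm
  rw [hset, integral_sub hbi.integrableOn hai.integrableOn, Ia, Ib, sub_zero]

theorem extDeriv_one_apply {f : E3 → E3 [⋀^Fin 1]→L[ℝ] ℝ} {x : E3} (hf : DifferentiableAt ℝ f x)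
    (u v : E3) : extDeriv f x ![u, v] =
      fderiv ℝ (fun x => f x ![v]) x u - fderiv ℝ (fun x => f x ![u]) x v := by
  rw [extDeriv_apply hf, Fin.sum_univ_two]
  have h0 : (0 : Fin 2).removeNth ![u, v] = ![v] := by funext i; fin_cases i; rfl
  have h1 : (1 : Fin 2).removeNth ![u, v] = ![u] := by funext i; fin_cases i; rfl
  rw [h0, h1]
  simp
  ring

/-- Stokes' theorem in the half-plane `{x₃ = 0, x₁ ≥ 0}` for a 1-form with compact support. -/
theorem integral_extDeriv_halfPlane {g : E3 → E3 [⋀^Fin 1]→L[ℝ] ℝ} (hg : ContDiff ℝ 1 g)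
    (hc : HasCompactSupport g) :
    ∫ y in {y : ℝ × ℝ | 0 ≤ y.1}, extDeriv g (planePoint y) ![stdVec 0, stdVec 1] =
      -∫ t : ℝ, g (planePoint (0, t)) ![stdVec 1] := by
  have hgu : ∀ u : E3, ContDiff ℝ 1 fun x => g x ![u] := fun u =>
    contDiffOn_univ.1 (contDiffOn_alt1_iff.1 (contDiffOn_univ.2 hg) u)
  have hpc : ContDiff ℝ 1 planePoint := by rw [planePoint_eq_planeIncl]; exact planeIncl.contDiff
  have hcs : ∀ u : E3, HasCompactSupport fun y => g (planePoint y) ![u] := by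
    intro u
    refine HasCompactSupport.intro (hc.image planeProj.continuous) fun y hy => ?_
    by_contra h
    refine hy ⟨planePoint y, subset_tsupport _ fun h0 => h ?_, planeProj_planePoint y⟩
    rw [h0]
    rfl
  rw [← integral_halfPlane (a := fun y => g (planePoint y) ![stdVec 0])
    (b := fun y => g (planePoint y) ![stdVec 1]) ((hgu _).comp hpc) ((hgu _).comp hpc)
    (hcs _) (hcs _)]
  refine integral_congr_ae (Filter.Eventually.of_forall fun y => ?_)
  have hd : ∀ (u : E3) (w : ℝ × ℝ), fderiv ℝ (fun y => g (planePoint y) ![u]) y w =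
      fderiv ℝ (fun x => g x ![u]) (planePoint y) (planeIncl w) := by
    intro u w
    have h1 : HasFDerivAt planePoint planeIncl y := by
      rw [planePoint_eq_planeIncl]; exact planeIncl.hasFDerivAt
    have h2 := (((hgu u).differentiable one_ne_zero) (planePoint y)).hasFDerivAt.comp y h1
    exact congrArg (fun L : ℝ × ℝ →L[ℝ] ℝ => L w) h2.fderiv
  have h0 : planeIncl (1, 0) = stdVec 0 := by simp [planeIncl]
  have h1 : planeIncl (0, 1) = stdVec 1 := by simp [planeIncl]
  simp only
  rw [hd, hd, h0, h1, extDeriv_one_apply ((hg.differentiable one_ne_zero) _)]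

end HalfPlaneStokes

/-! ### Stokes' theorem in one flat chart -/

section LocalStokes

variable {M : Type*} [TopologicalSpace M] [ChartedSpace E3 M] [IsManifold (𝓡 3) ∞ M]

theorem DForm.d_eq_zero {r : ℕ} {η : DForm r M} {p : M} (h : ∀ᶠ q in 𝓝 p, η q = 0) :
    η.d p = 0 := by
  have h1 : η.inChart (chartAt E3 p) =ᶠ[𝓝 (chartAt E3 p p)] fun _ => 0 := by
    have hc : ContinuousAt (chartAt E3 p).symm (chartAt E3 p p) :=
      (chartAt E3 p).continuousAt_symm (mem_chart_target _ _)
    have h' : ∀ᶠ q in 𝓝 ((chartAt E3 p).symm (chartAt E3 p p)), η q = 0 := by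
      rwa [(chartAt E3 p).left_inv (mem_chart_source _ _)]
    filter_upwards [hc.eventually h'] with y hy
    unfold DForm.inChart
    rw [hy]
    rfl
  have h2 : extDeriv (η.inChart (chartAt E3 p)) (chartAt E3 p p) = 0 := by
    rw [h1.extDeriv_eq]
    unfold extDeriv
    rw [fderiv_fun_const]
    exact map_zero (ContinuousAlternatingMap.alternatizeUncurryFinCLM ℝ E3 ℝ)
  unfold DForm.d
  rw [h2]
  rfl

theorem DForm.IsClassOn.isContinuousAlong_d {Φ : DForm 1 M} {U S : Set M}
    (hΦ : Φ.IsClassOn 1 U) (hU : IsOpen U) (hSU : S ⊆ U) : IsContinuousAlong S Φ.d := by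
  intro e he
  have h1 : ContDiffOn ℝ 1 (Φ.inChart e) (e.target ∩ e.symm ⁻¹' U) :=
    hΦ.contDiffOn_inChart (by rw [one_add_one_eq_two]; exact two_le_infty)
      (by rw [one_add_one_eq_two]; exact he.1)
  have h2 : ContDiffOn ℝ 0 (extDeriv (Φ.inChart e)) (e.target ∩ e.symm ⁻¹' U) :=
    contDiffOn_extDeriv (isOpen_target_inter e hU) (by rwa [zero_add])
  refine (h2.continuousOn.mono (inter_subset_inter_right _ (preimage_mono hSU))).congr
    fun x hx => ?_
  exact hΦ.d_inChart le_rfl hU he.1 hx.1 (hSU hx.2)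

variable {S : Set M} {e e' : OpenPartialHomeomorph M E3} {σ : DForm 2 M} {Φ : DForm 1 M}
  {U N K : Set M}

/-- The parameters of the boundary points of a surface in a flat chart that lie in `N`. -/
def boundaryDom (e : OpenPartialHomeomorph M E3) (N : Set M) : Set ℝ :=
  {t | planePoint (0, t) ∈ e.target ∩ e.symm ⁻¹' N}

theorem isOpen_boundaryDom (e : OpenPartialHomeomorph M E3) (hN : IsOpen N) :
    IsOpen (boundaryDom e N) :=
  (isOpen_target_inter e hN).preimage (continuous_planePoint.comp (by fun_prop))

variable [MeasurableSpace M] [BorelSpace M] [T2Space M]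

/-- Stokes' theorem for a form supported in the domain of a flat chart. -/
theorem surfIntegral_d_eq (hS : IsSurface S) (hSc : IsCompact S) (hσ : IsAreaForm S σ)
    (hU : IsOpen U) (hSU : S ⊆ U) (hΦ : Φ.IsClassOn 1 U) (he : IsFlatChart S e)
    (hNe : N ⊆ e.source) (hNU : N ⊆ U) (hN : IsOpen N) (hKN : K ⊆ N) (hK : IsCompact K)
    (hΦK : ∀ q, q ∉ K → Φ q = 0) {ε : ℝ}
    (hε : ∀ q ∈ S, q ∈ N → (SignType.sign (σ.density e (e q)) : ℝ) = ε) :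
    surfIntegral S σ Φ.d =
      -(ε * ∫ t in boundaryDom e N, Φ.inChart e (planePoint (0, t)) ![stdVec 1]) := by
  have hdK : ∀ q, q ∉ K → Φ.d q = 0 := fun q hq => DForm.d_eq_zero
    ((hK.isClosed.isOpen_compl.mem_nhds hq : _ ∈ 𝓝 q) |> Filter.eventually_of_mem <| hΦK)
  set O := e.target ∩ e.symm ⁻¹' N with hO
  have hOo : IsOpen O := isOpen_target_inter e hN
  set C := e '' K with hC
  have hCc : IsCompact C := hK.image_of_continuousOn (e.continuousOn.mono (hKN.trans hNe))
  have hCO : C ⊆ O := by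
    rintro _ ⟨q, hq, rfl⟩
    exact ⟨e.map_source (hNe (hKN hq)), by simpa [e.left_inv (hNe (hKN hq))] using hKN hq⟩
  have hz : ∀ x ∈ O, x ∉ C → Φ.inChart e x = 0 := by
    intro x hx hxC
    have : Φ (e.symm x) = 0 := hΦK _ fun h => hxC ⟨_, h, e.right_inv hx.1⟩
    unfold DForm.inChart
    rw [this]
    rfl
  have hf : ContDiffOn ℝ 1 (Φ.inChart e) O :=
    (hΦ.contDiffOn_inChart (by rw [one_add_one_eq_two]; exact two_le_infty)
      (by rw [one_add_one_eq_two]; exact he.1)).mono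
      (inter_subset_inter_right _ (preimage_mono hNU))
  -- Extension by zero outside O. It is of class C¹ on ℝ³ since Φ vanishes outside the compact set C
  -- ⊆ O.
  set g : E3 → E3 [⋀^Fin 1]→L[ℝ] ℝ := O.indicator (Φ.inChart e) with hg
  have hgO : ∀ x ∈ O, g x = Φ.inChart e x := fun x hx => indicator_of_mem hx _
  have hgC : ∀ x, x ∉ C → g x = 0 := by
    intro x hx
    by_cases hxO : x ∈ O
    · rw [hgO x hxO, hz x hxO hx]
    · exact indicator_of_notMem hxO _
  have hgO' : ∀ x ∈ O, g =ᶠ[𝓝 x] Φ.inChart e := fun x hx =>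
    Filter.eventually_of_mem (hOo.mem_nhds hx) hgO
  have hgC' : ∀ x, x ∉ C → g =ᶠ[𝓝 x] fun _ => 0 := fun x hx =>
    Filter.eventually_of_mem (hCc.isClosed.isOpen_compl.mem_nhds hx) hgC
  have hgsm : ContDiff ℝ 1 g := by
    rw [contDiff_iff_contDiffAt]
    intro x
    by_cases hx : x ∈ C
    · exact ((hf.contDiffAt (hOo.mem_nhds (hCO hx))).congr_of_eventuallyEq (hgO' x (hCO hx)))
    · exact contDiffAt_const.congr_of_eventuallyEq (hgC' x hx)
  have hgcs : HasCompactSupport g := HasCompactSupport.intro hCc hgC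
  have key := integral_extDeriv_halfPlane hgsm hgcs
  have hgd : ∀ x, x ∉ C → extDeriv g x = 0 := by
    intro x hx
    rw [(hgC' x hx).extDeriv_eq]
    unfold extDeriv
    rw [fderiv_fun_const]
    exact map_zero (ContinuousAlternatingMap.alternatizeUncurryFinCLM ℝ E3 ℝ)
  rw [surfIntegral_eq_chart hS hSc hσ (hΦ.isContinuousAlong_d hU hSU) he
    fun p _ hpe => hdK p fun h => hpe (hNe (hKN h))]
  have h1 : ∀ y ∈ chartDom e, SignType.sign (σ.density e (planePoint y))
      * Φ.d.density e (planePoint y) =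
      ε * extDeriv g (planePoint y) ![stdVec 0, stdVec 1] := by
    intro y hy
    have hpS := he.chartParam_mem hy
    have hd : Φ.d.density e (planePoint y) =
        extDeriv (Φ.inChart e) (planePoint y) ![stdVec 0, stdVec 1] := by
      unfold DForm.density
      rw [hΦ.d_inChart le_rfl hU he.1 hy.1 (hSU hpS)]
    by_cases hyC : planePoint y ∈ C
    · rw [hd, (hgO' _ (hCO hyC)).extDeriv_eq, ← hε _ hpS (hCO hyC).2]
      congr 4
      exact (e.right_inv hy.1).symm
    · have h0 : Φ.d.density e (planePoint y) = 0 := by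
        have : Φ.d (e.symm (planePoint y)) = 0 := hdK _ fun h =>
          hyC ⟨_, h, e.right_inv hy.1⟩
        unfold DForm.density DForm.inChart
        rw [this]
        rfl
      rw [h0, hgd _ hyC]
      simp
  rw [setIntegral_congr_fun (measurableSet_chartDom e) h1, integral_const_mul, ← mul_neg]
  congr 1
  have h2 : ∫ y in chartDom e, extDeriv g (planePoint y) ![stdVec 0, stdVec 1] =
      ∫ y in {y : ℝ × ℝ | 0 ≤ y.1}, extDeriv g (planePoint y) ![stdVec 0, stdVec 1] := by
    symm
    refine setIntegral_eq_of_subset_of_forall_sdiff_eq_zero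
      (isClosed_le continuous_const continuous_fst).measurableSet (fun y hy => hy.2) ?_
    rintro y ⟨hy, hy'⟩
    rw [hgd _ fun h => hy' ⟨(hCO h).1, hy⟩]
    rfl
  rw [h2, key]
  congr 1
  rw [← integral_indicator (isOpen_boundaryDom e hN).measurableSet]
  refine integral_congr_ae (Filter.Eventually.of_forall fun t => ?_)
  simp only
  by_cases ht : t ∈ boundaryDom e N
  · rw [indicator_of_mem ht, hgO _ ht]
  · have ht' : planePoint (0, t) ∉ O := ht
    have h0 : g (planePoint (0, t)) = 0 := indicator_of_notMem ht' _
    rw [indicator_of_notMem ht, h0]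
    rfl

end LocalStokes

/-! ### Sums and smooth multiples of forms -/

section FormOperations

variable {M : Type*} [TopologicalSpace M] [ChartedSpace E3 M] [IsManifold (𝓡 3) ∞ M]
  {r : ℕ} {η η' : DForm r M} {U : Set M}

theorem DForm.IsClassOn.d_add (hη : η.IsClassOn 1 U) (hη' : η'.IsClassOn 1 U) (hU : IsOpen U)
    {p : M} (hp : p ∈ U) : DForm.d (fun q => η q + η' q) p = η.d p + η'.d p := by
  have hd : ∀ {ζ : DForm r M}, ζ.IsClassOn 1 U →
      DifferentiableAt ℝ (ζ.inChart (chartAt E3 p)) (chartAt E3 p p) := fun hζ =>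
    hζ.differentiableAt le_rfl hU (chartAt_mem p le_rfl) (mem_chart_target _ _)
      (by rwa [(chartAt E3 p).left_inv (mem_chart_source _ _)])
  have h : DForm.inChart (fun q => η q + η' q) (chartAt E3 p) =
      η.inChart (chartAt E3 p) + η'.inChart (chartAt E3 p) := rfl
  unfold DForm.d
  rw [h, extDeriv_add (hd hη) (hd hη')]
  rfl

theorem DForm.IsClassOn.smul {m : WithTop ℕ∞} (hm : m ≤ (∞ : WithTop ℕ∞)) {f : M → ℝ}
    (hf : ContMDiff (𝓡 3) 𝓘(ℝ, ℝ) ∞ f) (hη : η.IsClassOn m U) :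
    DForm.IsClassOn m (fun q => f q • η q) U := by
  intro e he
  have h1 : ContDiffOn ℝ m (fun x => f (e.symm x)) e.target := by
    rw [← contMDiffOn_iff_contDiffOn]
    exact ((hf.comp_contMDiffOn (contMDiffOn_symm_of_mem_maximalAtlas he))).of_le hm
  exact (h1.mono inter_subset_left).smul (hη e he)

end FormOperations

/-! ### Exact forms on two surfaces with the same oriented boundary -/

section BoundaryComparison

variable {M : Type*} [TopologicalSpace M] [ChartedSpace E3 M] [IsManifold (𝓡 3) ∞ M]
  {S S' : Set M} {e e' : OpenPartialHomeomorph M E3} {σ σ' : DForm 2 M} {Φ : DForm 1 M}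
  {U N K : Set M}

/-- A continuous function without zeros has locally constant sign. This provides the constant ε
needed in `surfIntegral_d_eq`. -/
theorem exists_nhds_sign_density (hσ : IsAreaForm S σ) (he : IsFlatChart S e) {p : M}
    (hp : p ∈ e.source) (hpS : p ∈ S) : ∃ N, IsOpen N ∧ p ∈ N ∧ N ⊆ e.source ∧
      ∀ q ∈ S, q ∈ N → SignType.sign (σ.density e (e q)) = SignType.sign (σ.density e (e p)) := by
  have hne := hσ.ne_zero e he _ (e.map_source hp) (he.apply_mem hp hpS)
  have hc : ContinuousWithinAt (fun q => σ.density e (e q)) (e.source ∩ S) p := by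
    have hm : MapsTo e (e.source ∩ S) (e.target ∩ e.symm ⁻¹' S) := fun q hq =>
      ⟨e.map_source hq.1, by simpa [e.left_inv hq.1] using hq.2⟩
    exact ((continuousOn_density (hσ.cont e he)).comp (e.continuousOn.mono inter_subset_left)
      hm) p ⟨hp, hpS⟩
  have hs : ContinuousWithinAt (fun q => SignType.sign (σ.density e (e q))) (e.source ∩ S) p :=
    ContinuousAt.comp_continuousWithinAt (g := SignType.sign)
      (f := fun q => σ.density e (e q)) (continuousAt_sign_of_ne_zero hne) hc
  have hev : ∀ᶠ q in 𝓝[e.source ∩ S] p, SignType.sign (σ.density e (e q)) =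
      SignType.sign (σ.density e (e p)) :=
    hs (mem_nhds_discrete.2 (mem_singleton _))
  rw [eventually_nhdsWithin_iff] at hev
  obtain ⟨V, hV, hVo, hpV⟩ := eventually_nhds_iff.1 hev
  exact ⟨V ∩ e.source, hVo.inter e.open_source, ⟨hpV, hp⟩, inter_subset_right,
    fun q hq hqN => hV q hqN.1 ⟨hqN.2, hq⟩⟩

theorem boundaryDom_mem_boundary (he : IsFlatChart S e) {t : ℝ} (ht : t ∈ boundaryDom e N) :
    e.symm (planePoint (0, t)) ∈ boundary S := by
  have hS := he.symm_mem ht.1 (planePoint_mem_halfPlane le_rfl)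
  rw [he.mem_boundary_iff (e.map_target ht.1) hS, e.right_inv ht.1]
  rfl

/-- The coordinate change between flat charts of two surfaces, along their common boundary. -/
def boundaryTransition (e e' : OpenPartialHomeomorph M E3) (t : ℝ) : ℝ :=
  transition e e' (planePoint (0, t)) 1

/-- The charts e and e' are flat for different surfaces, so the coordinate change need not preserve
the plane. It does preserve the boundary line, since a common boundary point has coordinates (0, t,
0) in both. -/
theorem planePoint_boundaryTransition (he : IsFlatChart S e) (he' : IsFlatChart S' e')
    (hb : boundary S ⊆ boundary S') (hNe' : N ⊆ e'.source) {t : ℝ} (ht : t ∈ boundaryDom e N) :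
    planePoint (0, boundaryTransition e e' t) = transition e e' (planePoint (0, t)) := by
  have h1 := hb (boundaryDom_mem_boundary he ht)
  have h2 := he'.apply_mem (hNe' ht.2) h1.1
  have h3 := (he'.mem_boundary_iff (hNe' ht.2) h1.1).1 h1
  ext i
  fin_cases i
  · exact h3.symm
  · rfl
  · exact h2.1.symm

theorem boundaryTransition_mem (he : IsFlatChart S e) (he' : IsFlatChart S' e')
    (hb : boundary S ⊆ boundary S') (hNe' : N ⊆ e'.source)
    {t : ℝ} (ht : t ∈ boundaryDom e N) : boundaryTransition e e' t ∈ boundaryDom e' N := by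
  unfold boundaryDom
  rw [mem_ofPred_eq, planePoint_boundaryTransition he he' hb hNe' ht]
  have hx : planePoint (0, t) ∈ overlap e e' := ⟨ht.1, hNe' ht.2⟩
  refine ⟨e'.map_source (hNe' ht.2), ?_⟩
  rw [mem_preimage, symm_transition hx]
  exact ht.2

theorem boundaryTransition_boundaryTransition (he : IsFlatChart S e) (he' : IsFlatChart S' e')
    (hb : boundary S ⊆ boundary S') (hNe' : N ⊆ e'.source) {t : ℝ} (ht : t ∈ boundaryDom e N) :
    boundaryTransition e' e (boundaryTransition e e' t) = t := by
  have hx : planePoint (0, t) ∈ overlap e e' := ⟨ht.1, hNe' ht.2⟩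
  unfold boundaryTransition
  change transition e' e (planePoint (0, boundaryTransition e e' t)) 1 = t
  rw [planePoint_boundaryTransition he he' hb hNe' ht, transition_transition hx]
  rfl

theorem hasDerivAt_boundaryTransition (he : IsFlatChart S e) (he' : IsFlatChart S' e')
    (hNe' : N ⊆ e'.source) {t : ℝ} (ht : t ∈ boundaryDom e N) (i : Fin 3) :
    HasDerivAt (fun t => transition e e' (planePoint (0, t)) i)
      (fderiv ℝ (transition e e') (planePoint (0, t)) (stdVec 1) i) t := by
  have hx : planePoint (0, t) ∈ overlap e e' := ⟨ht.1, hNe' ht.2⟩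
  have hd := (differentiableAt_transition he.1 he'.1 one_le_two' hx).hasFDerivAt
  have hl : HasDerivAt (fun t : ℝ => planePoint (0, t)) (stdVec 1) t := by
    have h1 : HasDerivAt (fun t : ℝ => ((0 : ℝ), t)) ((0 : ℝ), (1 : ℝ)) t :=
      (hasDerivAt_const t 0).prodMk (hasDerivAt_id t)
    have h2 := planeIncl.hasFDerivAt.comp_hasDerivAt t h1
    have h3 : planeIncl (0, 1) = stdVec 1 := by simp [planeIncl]
    rw [h3, ← planePoint_eq_planeIncl] at h2
    exact h2
  have h4 : HasDerivAt (fun t => transition e e' (planePoint (0, t)))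
      (fderiv ℝ (transition e e') (planePoint (0, t)) (stdVec 1)) t :=
    HasFDerivAt.comp_hasDerivAt (l := transition e e') (f := fun t : ℝ => planePoint (0, t))
      t hd hl
  have hp : HasFDerivAt (fun x : E3 => x i) (EuclideanSpace.proj i : E3 →L[ℝ] ℝ)
      (transition e e' (planePoint (0, t))) :=
    (EuclideanSpace.proj i : E3 →L[ℝ] ℝ).hasFDerivAt
  exact hp.comp_hasDerivAt t h4

theorem fderiv_transition_stdVec_one (he : IsFlatChart S e) (he' : IsFlatChart S' e')
    (hb : boundary S ⊆ boundary S') (hN : IsOpen N) (hNe' : N ⊆ e'.source) {t : ℝ}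
    (ht : t ∈ boundaryDom e N) :
    fderiv ℝ (transition e e') (planePoint (0, t)) (stdVec 1) =
      (fderiv ℝ (transition e e') (planePoint (0, t)) (stdVec 1) 1) • stdVec 1 := by
  have hev : ∀ᶠ s in 𝓝 t, s ∈ boundaryDom e N := (isOpen_boundaryDom e hN).mem_nhds ht
  have hz : ∀ i : Fin 3, (∀ s, planePoint (0, s) i = 0) →
      fderiv ℝ (transition e e') (planePoint (0, t)) (stdVec 1) i = 0 := by
    intro i hi
    refine (hasDerivAt_boundaryTransition he he' hNe' ht i).unique ?_
    refine (hasDerivAt_const t (0 : ℝ)).congr_of_eventuallyEq ?_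
    filter_upwards [hev] with s hs
    rw [← planePoint_boundaryTransition he he' hb hNe' hs, hi]
  conv_lhs => rw [eq_of_apply_two_eq_zero (hz 2 fun s => rfl), hz 0 fun s => rfl]
  simp

theorem boundaryTransition_deriv_ne_zero (he : IsFlatChart S e) (he' : IsFlatChart S' e')
    (hb : boundary S ⊆ boundary S') (hN : IsOpen N) (hNe' : N ⊆ e'.source) {t : ℝ}
    (ht : t ∈ boundaryDom e N) :
    fderiv ℝ (transition e e') (planePoint (0, t)) (stdVec 1) 1 ≠ 0 := by
  intro h
  have hx : planePoint (0, t) ∈ overlap e e' := ⟨ht.1, hNe' ht.2⟩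
  have h1 := fderiv_transition_fderiv_transition one_le_two' he.1 he'.1 hx (stdVec 1)
  rw [fderiv_transition_stdVec_one he he' hb hN hNe' ht, h, zero_smul, map_zero] at h1
  have := congrArg (fun z : E3 => z 1) h1
  simp at this

/-- The compatibility of two area forms with the orientation of a common boundary. -/
def SameBoundaryOrientation (S S' : Set M) (σ σ' : DForm 2 M) : Prop :=
  ∀ p ∈ boundary S, ∀ w ν ν' : E3, IsBoundaryTangent S p w → IsBoundaryTangent S' p w →
    IsOutward S p ν → IsOutward S' p ν' → (0 < σ p ![ν, w] ↔ 0 < σ' p ![ν', w])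

/-- In a flat chart -∂/∂x₁ points outward and ∂/∂x₂ spans the boundary direction. Equality of the
induced orientations thus ties the signs of the two densities to the sign of the derivative c of the
boundary reparametrization, which is what turns |c| in the change of variables into c. -/
theorem sign_density_eq (hσ : IsAreaForm S σ) (hσ' : IsAreaForm S' σ')
    (hor : SameBoundaryOrientation S S' σ σ') (he : IsFlatChart S e) (he' : IsFlatChart S' e')
    (hb : boundary S ⊆ boundary S') (hN : IsOpen N) (hNe' : N ⊆ e'.source) {t : ℝ}
    (ht : t ∈ boundaryDom e N) :
    (SignType.sign (σ.density e (planePoint (0, t))) : ℝ) *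
        fderiv ℝ (transition e e') (planePoint (0, t)) (stdVec 1) 1 =
      SignType.sign (σ'.density e' (planePoint (0, boundaryTransition e e' t))) *
        |fderiv ℝ (transition e e') (planePoint (0, t)) (stdVec 1) 1| := by
  have hx : planePoint (0, t) ∈ overlap e e' := ⟨ht.1, hNe' ht.2⟩
  have hc0 := boundaryTransition_deriv_ne_zero he he' hb hN hNe' ht
  have hD := fderiv_transition_stdVec_one he he' hb hN hNe' ht
  rw [planePoint_boundaryTransition he he' hb hNe' ht]
  set x := planePoint (0, t) with hxdef
  set c := fderiv ℝ (transition e e') x (stdVec 1) 1 with hc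
  set q := e.symm x with hq
  have hqe : e q = x := e.right_inv ht.1
  have hqe' : q ∈ e'.source := hNe' ht.2
  have hqs : q ∈ e.source := e.map_target ht.1
  have hqb : q ∈ boundary S := boundaryDom_mem_boundary he ht
  have hqb' := hb hqb
  have hw : dChart e q (dChartSymm e x (stdVec 1)) = stdVec 1 :=
    dChart_dChartSymm he.1 one_le_two' ht.1 _
  have hν : dChart e q (dChartSymm e x (stdVec 0)) = stdVec 0 :=
    dChart_dChartSymm he.1 one_le_two' ht.1 _
  have hx' : transition e e' x = e' q := rfl
  have hν' : dChart e' q (dChartSymm e' (e' q) (stdVec 0)) = stdVec 0 := by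
    have := dChart_dChartSymm he'.1 one_le_two' (e'.map_source hqe') (stdVec 0)
    rwa [e'.left_inv hqe'] at this
  have hw' : dChart e' q (dChartSymm e x (stdVec 1)) = c • stdVec 1 := by
    rw [← hD, fderiv_transition he.1 he'.1 one_le_two' hx]
    rfl
  have hww : dChartSymm e x (stdVec 1) = c • dChartSymm e' (e' q) (stdVec 1) := by
    rw [← map_smul, ← hw', dChartSymm_dChart he'.1 one_le_two' hqe']
  have e0 : e' q 0 = 0 := (he'.mem_boundary_iff hqe' hqb'.1).1 hqb'
  -- The common boundary tangent is ∂/∂x₂ of the chart e, which is c times that of e'; the outward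
  -- vectors are -∂/∂x₁ in the respective charts.
  have key := hor q hqb (dChartSymm e x (stdVec 1)) (-dChartSymm e x (stdVec 0))
    (-dChartSymm e' (e' q) (stdVec 0))
    ⟨e, he, hqs, by rw [hqe]; rfl, by
      change dChart e q (dChartSymm e x (stdVec 1)) 2 = 0
      rw [hw]; simp, by
      change dChart e q (dChartSymm e x (stdVec 1)) 0 = 0
      rw [hw]; simp⟩
    ⟨e', he', hqe', e0, by
      change dChart e' q (dChartSymm e x (stdVec 1)) 2 = 0
      rw [hw']; simp, by
      change dChart e' q (dChartSymm e x (stdVec 1)) 0 = 0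
      rw [hw']; simp⟩
    ⟨e, he, hqs, by rw [hqe]; rfl, by
      change dChart e q (-dChartSymm e x (stdVec 0)) 2 = 0
      rw [map_neg, hν]; simp, by
      change dChart e q (-dChartSymm e x (stdVec 0)) 0 < 0
      rw [map_neg, hν]; simp⟩
    ⟨e', he', hqe', e0, by
      change dChart e' q (-dChartSymm e' (e' q) (stdVec 0)) 2 = 0
      rw [map_neg, hν']; simp, by
      change dChart e' q (-dChartSymm e' (e' q) (stdVec 0)) 0 < 0
      rw [map_neg, hν']; simp⟩
  have h1 : σ q ![-dChartSymm e x (stdVec 0), dChartSymm e x (stdVec 1)] =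
      -σ.density e x := by
    have h2 : σ.density e x = σ q ![dChartSymm e x (stdVec 0), dChartSymm e x (stdVec 1)] :=
      congrArg (σ q) (comp_vec2 (dChartSymm e x) _ _)
    rw [h2, ← neg_one_smul ℝ (dChartSymm e x (stdVec 0))]
    exact (alt2_smul_left (σ q) _ _ _).trans (neg_one_mul _)
  have h1' : σ' q ![-dChartSymm e' (e' q) (stdVec 0), dChartSymm e x (stdVec 1)] =
      -(c * σ'.density e' (e' q)) := by
    have h2 : σ'.density e' (e' q) =
        σ' q ![dChartSymm e' (e' q) (stdVec 0), dChartSymm e' (e' q) (stdVec 1)] := by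
      have := congrArg (σ' (e'.symm (e' q))) (comp_vec2 (dChartSymm e' (e' q))
        (stdVec 0) (stdVec 1))
      rw [e'.left_inv hqe'] at this
      refine Eq.trans ?_ this
      unfold DForm.density DForm.inChart
      rw [e'.left_inv hqe']
      rfl
    rw [h2, hww, ← neg_one_smul ℝ (dChartSymm e' (e' q) (stdVec 0))]
    refine (alt2_smul_left (σ' q) _ _ _).trans ?_
    rw [neg_one_mul]
    exact congrArg _ (alt2_smul_right (σ' q) _ _ _)
  rw [hx']
  have hd : σ.density e x ≠ 0 := hσ.ne_zero e he x ht.1 (planePoint_mem_halfPlane le_rfl)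
  have hd' : σ'.density e' (e' q) ≠ 0 :=
    hσ'.ne_zero e' he' _ (e'.map_source hqe') (he'.apply_mem hqe' hqb'.1)
  replace key : 0 < -σ.density e x ↔ 0 < -(c * σ'.density e' (e' q)) := by
    rw [← h1, ← h1']; exact key
  generalize σ.density e x = d at *
  generalize σ'.density e' (e' q) = d' at *
  clear_value c
  -- `key` says that d and c d' have the same sign, which excludes four of the eight sign patterns.
  rcases hc0.lt_or_gt with hc' | hc' <;> rcases hd.lt_or_gt with h | h <;>
    rcases hd'.lt_or_gt with h' | h'
  · exfalso; nlinarith [key.1 (by linarith), mul_pos_of_neg_of_neg hc' h']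
  · simp [sign_neg h, sign_pos h', abs_of_neg hc']
  · simp [sign_pos h, sign_neg h', abs_of_neg hc']
  · exfalso; nlinarith [key.2 (by nlinarith)]
  · simp [sign_neg h, sign_neg h', abs_of_pos hc']
  · exfalso; nlinarith [key.1 (by linarith), mul_pos hc' h']
  · exfalso; nlinarith [key.2 (by nlinarith)]
  · simp [sign_pos h, sign_pos h', abs_of_pos hc']

theorem image_boundaryTransition (he : IsFlatChart S e) (he' : IsFlatChart S' e')
    (hb : boundary S = boundary S') (hNe : N ⊆ e.source) (hNe' : N ⊆ e'.source) :
    boundaryTransition e e' '' boundaryDom e N = boundaryDom e' N := by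
  refine subset_antisymm (image_subset_iff.2 fun t ht =>
    boundaryTransition_mem he he' hb.le hNe' ht) fun t ht => ?_
  exact ⟨_, boundaryTransition_mem he' he hb.ge hNe ht,
    boundaryTransition_boundaryTransition he' he hb.ge hNe ht⟩

theorem inChart_boundary_eq (he : IsFlatChart S e) (he' : IsFlatChart S' e')
    (hb : boundary S ⊆ boundary S') (hN : IsOpen N) (hNe' : N ⊆ e'.source) {t : ℝ}
    (ht : t ∈ boundaryDom e N) :
    Φ.inChart e (planePoint (0, t)) ![stdVec 1] =
      fderiv ℝ (transition e e') (planePoint (0, t)) (stdVec 1) 1 *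
        Φ.inChart e' (planePoint (0, boundaryTransition e e' t)) ![stdVec 1] := by
  have hx : planePoint (0, t) ∈ overlap e e' := ⟨ht.1, hNe' ht.2⟩
  rw [planePoint_boundaryTransition he he' hb hNe' ht,
    Φ.inChart_eq_pullback he.1 he'.1 one_le_two' hx, ← alt1_smul,
    ← fderiv_transition_stdVec_one he he' hb hN hNe' ht]
  exact congrArg (Φ.inChart e' (transition e e' (planePoint (0, t)))) (comp_vec1 _ _)

variable [MeasurableSpace M] [BorelSpace M] [T2Space M]

/-- Local Stokes turns both sides into integrals over parameters of the same piece of boundary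
curve. Substituting `boundaryTransition` identifies them, with the signs matched by
`sign_density_eq`. -/
theorem surfIntegral_d_eq_of_chart (hS : IsSurface S) (hSc : IsCompact S) (hσ : IsAreaForm S σ)
    (hS' : IsSurface S') (hSc' : IsCompact S') (hσ' : IsAreaForm S' σ') (hU : IsOpen U)
    (hSU : S ⊆ U) (hSU' : S' ⊆ U) (hb : boundary S = boundary S')
    (hor : SameBoundaryOrientation S S' σ σ') (hΦ : Φ.IsClassOn 1 U) (he : IsFlatChart S e)
    (he' : IsFlatChart S' e') (hNe : N ⊆ e.source) (hNe' : N ⊆ e'.source) (hNU : N ⊆ U)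
    (hN : IsOpen N) (hKN : K ⊆ N) (hK : IsCompact K) (hΦK : ∀ q, q ∉ K → Φ q = 0) {ε ε' : ℝ}
    (hε : ∀ q ∈ S, q ∈ N → (SignType.sign (σ.density e (e q)) : ℝ) = ε)
    (hε' : ∀ q ∈ S', q ∈ N → (SignType.sign (σ'.density e' (e' q)) : ℝ) = ε') :
    surfIntegral S σ Φ.d = surfIntegral S' σ' Φ.d := by
  rw [surfIntegral_d_eq hS hSc hσ hU hSU hΦ he hNe hNU hN hKN hK hΦK hε,
    surfIntegral_d_eq hS' hSc' hσ' hU hSU' hΦ he' hNe' hNU hN hKN hK hΦK hε',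
    ← image_boundaryTransition he he' hb hNe hNe',
    integral_image_eq_integral_abs_deriv_smul (isOpen_boundaryDom e hN).measurableSet
      (f := boundaryTransition e e')
      (f' := fun t => fderiv ℝ (transition e e') (planePoint (0, t)) (stdVec 1) 1)
      (fun t ht => (hasDerivAt_boundaryTransition he he' hNe' ht 1).hasDerivWithinAt)
      (LeftInvOn.injOn (f₁' := boundaryTransition e' e) fun t ht =>
        boundaryTransition_boundaryTransition he he' hb.le hNe' ht),
    ← integral_const_mul, ← integral_const_mul]
  congr 1
  refine setIntegral_congr_fun (isOpen_boundaryDom e hN).measurableSet fun t ht => ?_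
  simp only [smul_eq_mul]
  rw [inChart_boundary_eq he he' hb.le hN hNe' ht, ← mul_assoc, ← mul_assoc]
  congr 1
  have hqS := (boundaryDom_mem_boundary he ht).1
  have hqS' := (hb ▸ boundaryDom_mem_boundary he ht : e.symm (planePoint (0, t)) ∈ boundary S').1
  rw [← hε _ hqS ht.2, ← hε' _ hqS' ht.2, e.right_inv ht.1,
    sign_density_eq hσ hσ' hor he he' hb.le hN hNe' ht,
    planePoint_boundaryTransition he he' hb.le hNe' ht]
  rfl

/-- Away from the boundary, the integral of an exact form over a surface vanishes locally. -/
theorem exists_nhds_surfIntegral_d_eq_zero (hS : IsSurface S) (hSc : IsCompact S)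
    (hσ : IsAreaForm S σ) (hU : IsOpen U) (hSU : S ⊆ U) {p : M} (hp : p ∉ boundary S) :
    ∃ N, IsOpen N ∧ p ∈ N ∧ ∀ K ⊆ N, IsCompact K → ∀ Φ : DForm 1 M, Φ.IsClassOn 1 U →
      (∀ q, q ∉ K → Φ q = 0) → surfIntegral S σ Φ.d = 0 := by
  by_cases hpS : p ∈ S
  · obtain ⟨e, he, hpe⟩ := hS p hpS
    obtain ⟨N, hN, hpN, hNe, hsign⟩ := exists_nhds_sign_density hσ he hpe hpS
    have h0 : e p 0 ≠ 0 := fun h => hp ((he.mem_boundary_iff hpe hpS).2 h)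
    -- Shrinking the neighbourhood to x₁ ≠ 0 empties the boundary parameter set, so local Stokes
    -- gives zero.
    have hV : IsOpen (e.source ∩ e ⁻¹' {x | x 0 ≠ 0}) :=
      e.isOpen_inter_preimage (isOpen_ne_fun (by fun_prop) continuous_const)
    refine ⟨N ∩ U ∩ (e.source ∩ e ⁻¹' {x | x 0 ≠ 0}), (hN.inter hU).inter hV,
      ⟨⟨hpN, hSU hpS⟩, hpe, h0⟩, fun K hKN hK Φ hΦ hΦK => ?_⟩
    have hempty : boundaryDom e (N ∩ U ∩ (e.source ∩ e ⁻¹' {x | x 0 ≠ 0})) = ∅ := by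
      refine eq_empty_of_forall_notMem fun t ht => ht.2.2.2 ?_
      rw [e.right_inv ht.1]
      rfl
    rw [surfIntegral_d_eq hS hSc hσ hU hSU hΦ he (fun q hq => hNe hq.1.1) (fun q hq => hq.1.2)
      ((hN.inter hU).inter hV) hKN hK hΦK (fun q hq hqN => congrArg _ (hsign q hq hqN.1.1)),
      hempty]
    simp
  · refine ⟨Sᶜ, hSc.isClosed.isOpen_compl, hpS, fun K hKN hK Φ _ hΦK =>
      surfIntegral_eq_zero hS hSc hσ fun q hq => DForm.d_eq_zero ?_⟩
    exact Filter.eventually_of_mem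
      (hK.isClosed.isOpen_compl.mem_nhds fun h => hKN h hq) hΦK

/-- The local form of the comparison of the integrals of an exact form over two surfaces with
the same oriented boundary. -/
theorem exists_nhds_surfIntegral_d_eq (hS : IsSurface S) (hSc : IsCompact S)
    (hσ : IsAreaForm S σ) (hS' : IsSurface S') (hSc' : IsCompact S') (hσ' : IsAreaForm S' σ')
    (hU : IsOpen U) (hSU : S ⊆ U) (hSU' : S' ⊆ U) (hb : boundary S = boundary S')
    (hor : SameBoundaryOrientation S S' σ σ') (p : M) :
    ∃ N, IsOpen N ∧ p ∈ N ∧ ∀ K ⊆ N, IsCompact K → ∀ Φ : DForm 1 M, Φ.IsClassOn 1 U →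
      (∀ q, q ∉ K → Φ q = 0) → surfIntegral S σ Φ.d = surfIntegral S' σ' Φ.d := by
  by_cases hp : p ∈ boundary S
  · have hp' : p ∈ boundary S' := hb ▸ hp
    obtain ⟨e, he, hpe⟩ := hS p hp.1
    obtain ⟨e', he', hpe'⟩ := hS' p hp'.1
    obtain ⟨N, hN, hpN, hNe, hsign⟩ := exists_nhds_sign_density hσ he hpe hp.1
    obtain ⟨N', hN', hpN', hNe', hsign'⟩ := exists_nhds_sign_density hσ' he' hpe' hp'.1
    refine ⟨N ∩ N' ∩ U, (hN.inter hN').inter hU, ⟨⟨hpN, hpN'⟩, hSU hp.1⟩,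
      fun K hKN hK Φ hΦ hΦK => ?_⟩
    exact surfIntegral_d_eq_of_chart hS hSc hσ hS' hSc' hσ' hU hSU hSU' hb hor hΦ he he'
      (fun q hq => hNe hq.1.1) (fun q hq => hNe' hq.1.2) (fun q hq => hq.2)
      ((hN.inter hN').inter hU) hKN hK hΦK (fun q hq hqN => congrArg _ (hsign q hq hqN.1.1))
      (fun q hq hqN => congrArg _ (hsign' q hq hqN.1.2))
  · obtain ⟨N, hN, hpN, h⟩ := exists_nhds_surfIntegral_d_eq_zero hS hSc hσ hU hSU hp
    obtain ⟨N', hN', hpN', h'⟩ :=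
      exists_nhds_surfIntegral_d_eq_zero hS' hSc' hσ' hU hSU' (hb ▸ hp)
    refine ⟨N ∩ N', hN.inter hN', ⟨hpN, hpN'⟩, fun K hKN hK Φ hΦ hΦK => ?_⟩
    rw [h K (hKN.trans inter_subset_left) hK Φ hΦ hΦK,
      h' K (hKN.trans inter_subset_right) hK Φ hΦ hΦK]

/-- Exact forms have the same integral over two compact surfaces with the same oriented
boundary. -/
theorem surfIntegral_d_eq_surfIntegral_d (hS : IsSurface S) (hSc : IsCompact S)
    (hσ : IsAreaForm S σ) (hS' : IsSurface S') (hSc' : IsCompact S') (hσ' : IsAreaForm S' σ')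
    (hU : IsOpen U) (hSU : S ⊆ U) (hSU' : S' ⊆ U) (hb : boundary S = boundary S')
    (hor : SameBoundaryOrientation S S' σ σ') {Φ : DForm 1 M} (hΦ : Φ.IsClassOn 1 U) :
    surfIntegral S σ Φ.d = surfIntegral S' σ' Φ.d := by
  choose N hN hpN hloc using exists_nhds_surfIntegral_d_eq hS hSc hσ hS' hSc' hσ' hU hSU hSU'
    hb hor
  have hbump : ∀ p : M, ∃ f : SmoothBumpFunction (𝓡 3) p, tsupport f ⊆ N p := fun p => by
    obtain ⟨f, -, hf⟩ := (SmoothBumpFunction.nhds_basis_tsupport (I := 𝓡 3) p).mem_iff.1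
      ((hN p).mem_nhds (hpN p))
    exact ⟨f, hf⟩
  choose f hf using hbump
  have hV : ∀ p : M, ∃ V, IsOpen V ∧ p ∈ V ∧ ∀ q ∈ V, f p q = 1 := fun p => by
    obtain ⟨V, hV, hVo, hpV⟩ := eventually_nhds_iff.1 (f p).eventuallyEq_one
    exact ⟨V, hVo, hpV, hV⟩
  choose V hVo hpV hV using hV
  -- In place of a partition of unity, one bump function is split off at a time. The induction is on
  -- the number of sets V p needed to cover the points of S ∪ S' near which Φ does not vanish
  -- identically.
  have main : ∀ (t : Finset M) (Φ : DForm 1 M), Φ.IsClassOn 1 U →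
      (∀ q ∈ S ∪ S', q ∉ ⋃ p ∈ t, V p → ∀ᶠ z in 𝓝 q, Φ z = 0) →
      surfIntegral S σ Φ.d = surfIntegral S' σ' Φ.d := by
    classical
    intro t
    induction t using Finset.induction_on with
    | empty =>
      intro Φ _ h
      rw [surfIntegral_eq_zero hS hSc hσ fun q hq => DForm.d_eq_zero (h q (Or.inl hq) (by simp)),
        surfIntegral_eq_zero hS' hSc' hσ' fun q hq => DForm.d_eq_zero (h q (Or.inr hq) (by simp))]
    | insert a t _ ih =>
      intro Φ hΦ h
      have h1 : DForm.IsClassOn 1 (fun q => f a q • Φ q) U :=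
        hΦ.smul one_le_infty (f a).contMDiff
      have h2 : DForm.IsClassOn 1 (fun q => (1 - f a q) • Φ q) U :=
        hΦ.smul one_le_infty (contMDiff_const.sub (f a).contMDiff)
      have hsum : ∀ q ∈ U, Φ.d q = DForm.d (fun q => f a q • Φ q) q +
          DForm.d (fun q => (1 - f a q) • Φ q) q := by
        intro q hq
        rw [← h1.d_add h2 hU hq]
        congr 1
        funext z
        rw [← add_smul, add_sub_cancel, one_smul]
      rw [surfIntegral_add hS hSc hσ (h1.isContinuousAlong_d hU hSU)
          (h2.isContinuousAlong_d hU hSU) (fun q hq => hsum q (hSU hq)),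
        surfIntegral_add hS' hSc' hσ' (h1.isContinuousAlong_d hU hSU')
          (h2.isContinuousAlong_d hU hSU') (fun q hq => hsum q (hSU' hq))]
      refine congrArg₂ (fun x y : ℝ => x + y) ?_ ?_
      · refine hloc a (tsupport (f a)) (hf a) (f a).hasCompactSupport _ h1 fun q hq => ?_
        rw [image_eq_zero_of_notMem_tsupport hq, zero_smul]
      · refine ih _ h2 fun q hq hqt => ?_
        -- On V a the bump function equals 1, so the remainder (1 - f) Φ vanishes there and V a is
        -- no longer needed in the cover.
        by_cases hqa : q ∈ V a
        · filter_upwards [(hVo a).mem_nhds hqa] with z hz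
          rw [hV a z hz, sub_self, zero_smul]
        · have := h q hq (by
            rw [Finset.set_biUnion_insert]
            exact fun h => h.elim hqa hqt)
          filter_upwards [this] with z hz
          rw [hz, smul_zero]
  obtain ⟨t, ht⟩ := (hSc.union hSc').elim_finite_subcover V hVo
    fun q _ => mem_iUnion.2 ⟨q, hpV q⟩
  exact main t Φ hΦ fun q hq hqt => absurd (ht hq) hqt

end BoundaryComparison

/-! ### Slices of foliated charts and surfaces contained in a leaf -/

section Slices

variable {M : Type*} [TopologicalSpace M] [ChartedSpace E3 M] [IsManifold (𝓡 3) ∞ M]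
  {f : OpenPartialHomeomorph M E3}

/-- Around each of its points, a slice of a `C²` chart has a flat chart. -/
theorem exists_isFlatChart_slice (hf : f ∈ IsManifold.maximalAtlas (𝓡 3) 2 M) {q : M}
    (hq : q ∈ f.source) : ∃ e, IsFlatChart (slice f (f q 2)) e ∧ q ∈ e.source ∧
      ∀ v : E3, dChart e q v = dChart f q v := by
  have : IsManifold (𝓡 3) 2 M := IsManifold.of_le (n := ∞) two_le_infty
  -- The translation puts q at (1, 0, 0). On the ball of radius 1 about f q the first coordinate
  -- stays positive, so the half-plane condition reduces to x₃ = 0.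
  set b : E3 := stdVec 0 - f q with hb
  have hopen : IsOpen (f.source ∩ f ⁻¹' Metric.ball (f q) 1) :=
    f.isOpen_inter_preimage Metric.isOpen_ball
  set e := (f.restrOpen _ hopen).transHomeomorph (Homeomorph.addRight b) with he
  have hes : e.source = f.source ∩ f ⁻¹' Metric.ball (f q) 1 := by
    change (f.restrOpen _ hopen).source = _
    rw [f.restrOpen_source, ← inter_assoc, inter_self]
  have hef : ∀ z, e z = f z + b := fun z => rfl
  have hesymm : ∀ x, e.symm x = f.symm (x - b) := fun x => by
    change f.symm (x + -b) = _
    rw [sub_eq_add_neg]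
  have het : ∀ x ∈ e.target, x - b ∈ f.target := fun x hx => by
    have h1 := e.map_target hx
    have h2 : f (e.symm x) + b = x := e.right_inv hx
    rw [← h2, add_sub_cancel_right]
    rw [hes] at h1
    exact f.map_source h1.1
  have hqe : q ∈ e.source := by rw [hes]; exact ⟨hq, Metric.mem_ball_self one_pos⟩
  have hmem : e ∈ IsManifold.maximalAtlas (𝓡 3) 2 M := by
    refine OpenPartialHomeomorph.mem_maximalAtlas_of_contMDiffOn (I := 𝓡 3) (n := 2) e ?_ ?_
    · have h1 : ContMDiffOn (𝓡 3) (𝓡 3) 2 (fun z => f z + b) f.source :=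
        (((contDiff_id (𝕜 := ℝ) (E := E3)).add
          (contDiff_const (c := b))).contMDiff).comp_contMDiffOn
          (contMDiffOn_of_mem_maximalAtlas hf)
      exact h1.mono (by rw [hes]; exact inter_subset_left)
    · have h1 : ContMDiffOn (𝓡 3) (𝓡 3) 2 (fun x => f.symm (x - b)) e.target :=
        (contMDiffOn_symm_of_mem_maximalAtlas hf).comp
          ((((contDiff_id (𝕜 := ℝ) (E := E3)).sub (contDiff_const (c := b))).contMDiff).contMDiffOn)
          het
      exact h1.congr fun x _ => hesymm x
  refine ⟨e, ⟨hmem, fun z hz => ?_⟩, hqe, fun v => ?_⟩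
  · rw [hes] at hz
    have h0 : 0 ≤ e z 0 := by
      have h1 : |(f z - f q) 0| ≤ ‖f z - f q‖ := by
        rw [← Real.norm_eq_abs]; exact PiLp.norm_apply_le _ _
      have h2 : ‖f z - f q‖ < 1 := by
        rw [← dist_eq_norm]; exact hz.2
      rw [hef, hb]
      have h3 := (abs_lt.1 (h1.trans_lt h2)).1
      simp at h3 ⊢
      linarith
    have h2 : e z 2 = f z 2 - f q 2 := by
      rw [hef, hb]
      simp
      ring
    constructor
    · rintro ⟨h, -⟩
      exact ⟨hz.1, by linarith⟩
    · rintro ⟨-, h⟩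
      exact ⟨by linarith, h0⟩
  · rw [dChart_eq_fderiv_transition one_le_two' hf hmem hq hqe]
    have hev : transition f e =ᶠ[𝓝 (f q)] fun x => x + b := by
      filter_upwards [f.open_target.mem_nhds (f.map_source hq)] with x hx
      change f (f.symm x) + b = x + b
      rw [f.right_inv hx]
    rw [hev.fderiv_eq]
    simp

theorem isTangent_slice_iff (hf : f ∈ IsManifold.maximalAtlas (𝓡 3) 2 M) {q : M}
    (hq : q ∈ f.source) (v : E3) : IsTangent (slice f (f q 2)) q v ↔ dChart f q v 2 = 0 := by
  obtain ⟨e, he, hqe, hd⟩ := exists_isFlatChart_slice hf hq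
  rw [he.isTangent_iff hqe ⟨hq, rfl⟩, hd]

theorem exists_dChart_eq_zero_theta_ne_zero (P : PseudohermitianStructure M)
    (hf : f ∈ IsManifold.maximalAtlas (𝓡 3) 2 M) {q : M} (hq : q ∈ f.source)
    (hns : IsNonsingular P (slice f (f q 2))) :
    ∃ v : E3, dChart f q v 2 = 0 ∧ P.theta q ![v] ≠ 0 := by
  obtain ⟨e, he, hqe, hd⟩ := exists_isFlatChart_slice hf hq
  obtain ⟨v, hv, hv'⟩ := exists_tangent_theta_ne_zero P he hqe ⟨hq, rfl⟩ (hns q ⟨hq, rfl⟩)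
  exact ⟨v, by rw [← hd]; exact hv, hv'⟩

/-- A connected set of reals contains the interval between any two of its points, and a
nondegenerate interval is uncountable. -/
theorem subsingleton_of_isPreconnected_of_countable {A : Set ℝ} (hA : IsPreconnected A)
    (hc : A.Countable) : A.Subsingleton := by
  have key : ∀ a ∈ A, ∀ b ∈ A, b ≤ a := fun a ha b hb =>
    Cardinal.Real.Icc_countable_iff.1 (hc.mono (hA.ordConnected.out ha hb))
  exact fun a ha b hb => le_antisymm (key b hb a ha) (key a ha b hb)

/-- A surface contained in a leaf of a foliation is tangent to the slices of foliated charts. -/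
theorem IsFlatChart.fderiv_transition_foliated {S : Set M} {e : OpenPartialHomeomorph M E3}
    (he : IsFlatChart S e) (hf : f ∈ IsManifold.maximalAtlas (𝓡 3) 2 M) {C : Set ℝ}
    (hC : C.Countable) (hSC : ∀ q ∈ S, q ∈ f.source → f q 2 ∈ C) {x : E3}
    (hx : x ∈ overlap e f) (hx' : x ∈ halfPlane) {v : E3} (hv : v 2 = 0) :
    fderiv ℝ (transition e f) x v 2 = 0 := by
  have key : ∀ w : E3, w 2 = 0 → 0 ≤ w 0 → fderiv ℝ (transition e f) x w 2 = 0 := by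
    intro w hw hw0
    have h := (hasDerivAt_transition_line he.1 hf hx w 2).hasDerivWithinAt (s := Ici 0)
    obtain ⟨δ, hδ, hball⟩ := Metric.eventually_nhds_iff_ball.1 (eventually_line_mem_overlap hx w)
    have hmem : ∀ t ∈ Ico (0 : ℝ) δ, x + t • w ∈ overlap e f := fun t ht =>
      hball t (by rw [Metric.mem_ball, Real.dist_eq, sub_zero, abs_of_nonneg ht.1]; exact ht.2)
    have hcont : ContinuousOn (fun t : ℝ => transition e f (x + t • w) 2) (Ico 0 δ) := by
      have h1 : ContinuousOn (transition e f) (overlap e f) :=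
        (contDiffOn_transition he.1 hf).continuousOn
      have h2 : ContinuousOn (fun t : ℝ => transition e f (x + t • w)) (Ico 0 δ) :=
        h1.comp (by fun_prop) hmem
      exact (EuclideanSpace.proj 2 : E3 →L[ℝ] ℝ).continuous.comp_continuousOn h2
    -- Along a ray in the surface, the third foliated coordinate is continuous with values in the
    -- countable set C, hence constant.
    have hsub := subsingleton_of_isPreconnected_of_countable (isPreconnected_Ico.image _ hcont)
      (hC.mono (by
        rintro _ ⟨t, ht, rfl⟩
        refine hSC _ (he.symm_mem (hmem t ht).1 ⟨?_, ?_⟩) (hmem t ht).2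
        · simp [hx'.1, hw]
        · simpa using add_nonneg hx'.2 (mul_nonneg ht.1 hw0)))
    have h0 : HasDerivWithinAt (fun t : ℝ => transition e f (x + t • w) 2) 0 (Ici 0) 0 := by
      refine (hasDerivWithinAt_const (0 : ℝ) (Ici 0)
        (transition e f (x + (0 : ℝ) • w) 2)).congr_of_eventuallyEq ?_ rfl
      filter_upwards [Ico_mem_nhdsGE hδ] with t ht
      exact hsub ⟨t, ht, rfl⟩ ⟨0, ⟨le_rfl, hδ⟩, rfl⟩
    exact (uniqueDiffWithinAt_Ici (0 : ℝ)).eq_deriv _ h h0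
  rcases le_total 0 (v 0) with h | h
  · exact key v hv h
  · have := key (-v) (by simp [hv]) (by simpa using h)
    simpa using this

/-- The tangent planes of a surface in a leaf are those of the slices of foliated charts. -/
theorem IsFlatChart.dChart_two_eq_zero_iff {S : Set M} {e : OpenPartialHomeomorph M E3}
    (he : IsFlatChart S e) (hf : f ∈ IsManifold.maximalAtlas (𝓡 3) 2 M) {C : Set ℝ}
    (hC : C.Countable) (hSC : ∀ q ∈ S, q ∈ f.source → f q 2 ∈ C) {p : M} (hp : p ∈ e.source)
    (hpf : p ∈ f.source) (hpS : p ∈ S) (v : E3) : dChart e p v 2 = 0 ↔ dChart f p v 2 = 0 := by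
  have key : ∀ v : E3, dChart e p v 2 = 0 → dChart f p v 2 = 0 := fun v hv => by
    rw [dChart_eq_fderiv_transition one_le_two' he.1 hf hp hpf]
    exact he.fderiv_transition_foliated hf hC hSC (mem_overlap_of_mem hp hpf)
      (he.apply_mem hp hpS) hv
  refine ⟨key v, fun h => ?_⟩
  have hu : dChart e p (dChartSymm e (e p) (stdVec 2)) = stdVec 2 := by
    have := dChart_dChartSymm he.1 one_le_two' (e.map_source hp) (stdVec 2)
    rwa [e.left_inv hp] at this
  have hu' : dChart f p (dChartSymm f (f p) (stdVec 2)) = stdVec 2 := by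
    have := dChart_dChartSymm hf one_le_two' (f.map_source hpf) (stdVec 2)
    rwa [f.left_inv hpf] at this
  set u := dChartSymm e (e p) (stdVec 2)
  set u' := dChartSymm f (f p) (stdVec 2)
  -- One functional vanishes on the kernel of the other, so it is a multiple of it. Evaluation at u'
  -- shows that the factor is nonzero, so the kernels agree.
  have hlin : ∀ z : E3, dChart f p z 2 = dChart e p z 2 * dChart f p u 2 := by
    intro z
    have h1 := key (z - (dChart e p z 2) • u) (by rw [map_sub, map_smul, hu]; simp)
    rw [map_sub, map_smul] at h1
    simp at h1
    linarith
  have h1 := hlin u'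
  rw [hu'] at h1
  have h2 := hlin v
  rw [h] at h2
  rcases mul_eq_zero.1 h2.symm with h3 | h3
  · exact h3
  · rw [h3] at h1
    simp at h1

end Slices

/-! ### Automatic regularity of a continuous unit field -/

section UnitField

/-- The cross product of the coefficient vectors of two covectors. -/
def covecCross (a b : Fin 3 → ℝ) : E3 :=
  !₂[a 1 * b 2 - a 2 * b 1, a 2 * b 0 - a 0 * b 2, a 0 * b 1 - a 1 * b 0]

/-- A vector annihilated by a and b is parallel to a × b; the coefficient is that of the orthogonal
projection onto w. The identities `c0`, `c1`, `c2` say x × w = 0. -/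
theorem eq_smul_covecCross {a b : Fin 3 → ℝ} {x : E3}
    (ha : a 0 * x 0 + a 1 * x 1 + a 2 * x 2 = 0) (hb : b 0 * x 0 + b 1 * x 1 + b 2 * x 2 = 0)
    {w : E3} (hw : w = covecCross a b) (hw0 : w ≠ 0) :
    x = ((x 0 * w 0 + x 1 * w 1 + x 2 * w 2) / (w 0 ^ 2 + w 1 ^ 2 + w 2 ^ 2)) • w := by
  have h0 : w 0 = a 1 * b 2 - a 2 * b 1 := by rw [hw]; rfl
  have h1 : w 1 = a 2 * b 0 - a 0 * b 2 := by rw [hw]; rfl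
  have h2 : w 2 = a 0 * b 1 - a 1 * b 0 := by rw [hw]; rfl
  have hpos : w 0 ^ 2 + w 1 ^ 2 + w 2 ^ 2 ≠ 0 := by
    intro h
    apply hw0
    ext i
    fin_cases i <;> simp <;> nlinarith [sq_nonneg (w 0), sq_nonneg (w 1), sq_nonneg (w 2)]
  have c0 : x 1 * w 2 - x 2 * w 1 = 0 := by
    rw [h1, h2]; linear_combination a 0 * hb - b 0 * ha
  have c1 : x 2 * w 0 - x 0 * w 2 = 0 := by
    rw [h0, h2]; linear_combination a 1 * hb - b 1 * ha
  have c2 : x 0 * w 1 - x 1 * w 0 = 0 := by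
    rw [h0, h1]; linear_combination a 2 * hb - b 2 * ha
  ext i
  rw [PiLp.smul_apply, smul_eq_mul, div_mul_eq_mul_div, eq_div_iff hpos]
  fin_cases i
  · change x 0 * _ = _ * w 0
    linear_combination w 1 * c2 - w 2 * c1
  · change x 1 * _ = _ * w 1
    linear_combination w 2 * c0 - w 0 * c2
  · change x 2 * _ = _ * w 2
    linear_combination w 0 * c1 - w 1 * c0

/-- If a × b = 0, then (a·v) b = (b·v) a = 0, although a·v ≠ 0 and b ≠ 0. -/
theorem covecCross_ne_zero {a b : Fin 3 → ℝ} {v : E3} (hb : b ≠ 0)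
    (hbv : b 0 * v 0 + b 1 * v 1 + b 2 * v 2 = 0) (hav : a 0 * v 0 + a 1 * v 1 + a 2 * v 2 ≠ 0) :
    covecCross a b ≠ 0 := by
  intro h
  have h0 : a 1 * b 2 - a 2 * b 1 = 0 := congrArg (fun z : E3 => z 0) h
  have h1 : a 2 * b 0 - a 0 * b 2 = 0 := congrArg (fun z : E3 => z 1) h
  have h2 : a 0 * b 1 - a 1 * b 0 = 0 := congrArg (fun z : E3 => z 2) h
  apply hb
  funext i
  refine (mul_eq_zero.1 (?_ : (a 0 * v 0 + a 1 * v 1 + a 2 * v 2) * b i = 0)).resolve_left hav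
  fin_cases i
  · change _ * b 0 = 0
    linear_combination a 0 * hbv - v 1 * h2 + v 2 * h1
  · change _ * b 1 = 0
    linear_combination a 1 * hbv + v 0 * h2 - v 2 * h0
  · change _ * b 2 = 0
    linear_combination a 2 * hbv - v 0 * h1 + v 1 * h0

/-- A continuous field of unit vectors in the intersection of two transverse plane fields is as
smooth as the plane fields and the metric. -/
theorem contDiffOn_of_unit {m : WithTop ℕ∞} {D : Set E3} (hD : IsOpen D)
    {α : E3 → E3 [⋀^Fin 1]→L[ℝ] ℝ} {β : E3 → E3 →L[ℝ] ℝ} {Ω : E3 → E3 [⋀^Fin 2]→L[ℝ] ℝ}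
    {j : E3 → E3 →L[ℝ] E3} {X : E3 → E3} (hα : ContDiffOn ℝ m α D) (hβ : ContDiffOn ℝ m β D)
    (hΩ : ContDiffOn ℝ m Ω D) (hj : ContDiffOn ℝ m j D) (hX : ContinuousOn X D)
    (hαX : ∀ y ∈ D, α y ![X y] = 0) (hβX : ∀ y ∈ D, β y (X y) = 0)
    (hXX : ∀ y ∈ D, (1 / 2) * Ω y ![X y, j y (X y)] = 1)
    (htr : ∀ y ∈ D, ∃ v : E3, β y v = 0 ∧ α y ![v] ≠ 0) (hβ0 : ∀ y ∈ D, β y ≠ 0) :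
    ContDiffOn ℝ m X D := by
  set a : E3 → Fin 3 → ℝ := fun y i => α y ![stdVec i] with ha
  set b : E3 → Fin 3 → ℝ := fun y i => β y (stdVec i) with hb
  have hac : ∀ i, ContDiffOn ℝ m (fun y => a y i) D := fun i => contDiffOn_alt1_iff.1 hα _
  have hbc : ∀ i, ContDiffOn ℝ m (fun y => b y i) D := fun i => hβ.clm_apply contDiffOn_const
  have haa : ∀ y (v : E3), α y ![v] = a y 0 * v 0 + a y 1 * v 1 + a y 2 * v 2 := fun y v => by
    rw [alt1_eq]; simp only [ha]; ring
  have hbb : ∀ y (v : E3), β y v = b y 0 * v 0 + b y 1 * v 1 + b y 2 * v 2 := fun y v => by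
    conv_lhs => rw [eq_sum_stdVec v]
    simp only [map_add, map_smul, smul_eq_mul, hb]; ring
  -- w spans the intersection of the two plane fields and is as regular as they are. Only the factor
  -- l in X = l w remains to be controlled.
  set w : E3 → E3 := fun y => covecCross (a y) (b y) with hw
  have hwc : ContDiffOn ℝ m w D := by
    rw [contDiffOn_euclidean]
    intro i
    fin_cases i
    · exact ((hac 1).mul (hbc 2)).sub ((hac 2).mul (hbc 1))
    · exact ((hac 2).mul (hbc 0)).sub ((hac 0).mul (hbc 2))
    · exact ((hac 0).mul (hbc 1)).sub ((hac 1).mul (hbc 0))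
  have hw0 : ∀ y ∈ D, w y ≠ 0 := by
    intro y hy
    obtain ⟨v, hv, hv'⟩ := htr y hy
    refine covecCross_ne_zero (v := v) ?_ (by rw [← hbb]; exact hv) (by rw [← haa]; exact hv')
    intro h
    apply hβ0 y hy
    ext z
    rw [hbb, h]
    simp
  set l : E3 → ℝ := fun y => (X y 0 * w y 0 + X y 1 * w y 1 + X y 2 * w y 2) /
    (w y 0 ^ 2 + w y 1 ^ 2 + w y 2 ^ 2) with hl
  have hXl : ∀ y ∈ D, X y = l y • w y := fun y hy =>
    eq_smul_covecCross (by rw [← haa]; exact hαX y hy) (by rw [← hbb]; exact hβX y hy) rfl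
      (hw0 y hy)
  have hlc : ContinuousOn l D := by
    have hXi : ∀ i, ContinuousOn (fun y => X y i) D := fun i =>
      (EuclideanSpace.proj i : E3 →L[ℝ] ℝ).continuous.comp_continuousOn hX
    have hwi : ∀ i, ContinuousOn (fun y => w y i) D := fun i =>
      (EuclideanSpace.proj i : E3 →L[ℝ] ℝ).continuous.comp_continuousOn hwc.continuousOn
    refine ContinuousOn.div (((hXi 0).mul (hwi 0)).add ((hXi 1).mul (hwi 1)) |>.add
      ((hXi 2).mul (hwi 2))) ((((hwi 0).pow 2).add ((hwi 1).pow 2)).add ((hwi 2).pow 2)) ?_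
    intro y hy h
    apply hw0 y hy
    ext i
    fin_cases i <;> simp <;>
      nlinarith [sq_nonneg (w y 0), sq_nonneg (w y 1), sq_nonneg (w y 2)]
  set Q : E3 → ℝ := fun y => (1 / 2) * Ω y ![w y, j y (w y)] with hQ
  have hQc : ContDiffOn ℝ m Q D :=
    contDiffOn_const.mul (contDiffOn_alt2_apply hΩ hwc (hj.clm_apply hwc))
  have hlQ : ∀ y ∈ D, l y ^ 2 * Q y = 1 := by
    intro y hy
    have h := hXX y hy
    rw [hXl y hy, map_smul, alt2_smul_left, alt2_smul_right] at h
    rw [← h, hQ]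
    ring
  have hQpos : ∀ y ∈ D, 0 < Q y := fun y hy =>
    pos_of_mul_pos_right (by rw [hlQ y hy]; exact one_pos) (sq_nonneg (l y))
  have hl0 : ∀ y ∈ D, l y ≠ 0 := fun y hy h => by simpa [h] using hlQ y hy
  have hlabs : ∀ y ∈ D, |l y| = (Real.sqrt (Q y))⁻¹ := by
    intro y hy
    have h1 : (|l y| * Real.sqrt (Q y)) ^ 2 = 1 := by
      rw [mul_pow, sq_abs, Real.sq_sqrt (hQpos y hy).le, hlQ y hy]
    have h2 : |l y| * Real.sqrt (Q y) = 1 :=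
      (pow_eq_one_iff_of_nonneg (by positivity) two_ne_zero).1 h1
    exact eq_inv_of_mul_eq_one_left h2
  intro x hx
  have hsm : ContDiffAt ℝ m (fun y => (Real.sqrt (Q y))⁻¹ • w y) x := by
    have hQx : ContDiffAt ℝ m Q x := hQc.contDiffAt (hD.mem_nhds hx)
    exact ((hQx.sqrt (hQpos x hx).ne').inv (Real.sqrt_pos.2 (hQpos x hx)).ne').smul
      (hwc.contDiffAt (hD.mem_nhds hx))
  have hlx : ContinuousAt l x := hlc.continuousAt (hD.mem_nhds hx)
  -- The unit condition gives |l| = Q^(-1/2). The continuous function l has no zeros, so its sign is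
  -- constant near x.
  rcases (hl0 x hx).lt_or_gt with hneg | hpos
  · refine (hsm.neg.congr_of_eventuallyEq ?_).contDiffWithinAt
    filter_upwards [hlx.eventually_lt_const hneg, hD.mem_nhds hx] with y hy hyD
    rw [← hlabs y hyD, abs_of_neg hy, neg_smul, neg_neg, hXl y hyD]
  · refine (hsm.congr_of_eventuallyEq ?_).contDiffWithinAt
    filter_upwards [hlx.eventually_const_lt hpos, hD.mem_nhds hx] with y hy hyD
    rw [← hlabs y hyD, abs_of_pos hy, hXl y hyD]

end UnitField

/-! ### Regularity of the characteristic field of the foliation -/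

section FoliationField

variable {M : Type*} [TopologicalSpace M] [ChartedSpace E3 M] [IsManifold (𝓡 3) ∞ M]
  (P : PseudohermitianStructure M) {X : VField M}

theorem fderiv_transition_dChart {k : WithTop ℕ∞} (hk : 1 ≤ k) {e f : OpenPartialHomeomorph M E3}
    (he : e ∈ IsManifold.maximalAtlas (𝓡 3) k M) (hf : f ∈ IsManifold.maximalAtlas (𝓡 3) k M)
    {y : E3} (hy : y ∈ overlap e f) (v : E3) :
    fderiv ℝ (transition e f) y (dChart e (e.symm y) v) = dChart f (e.symm y) v := by
  rw [dChart_eq_fderiv_transition hk he hf (e.map_target hy.1) hy.2, e.right_inv hy.1]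

/-- The field `X` is tangent to the slices of the chart `f`, which have no singular points. -/
def IsTangentToSlices (X : VField M) (f : OpenPartialHomeomorph M E3) : Prop :=
  ∀ q ∈ f.source, P.IsUnitLegendrian q (X q) ∧ dChart f q (X.vec q) 2 = 0 ∧
    ∃ v : E3, dChart f q v 2 = 0 ∧ P.theta q ![v] ≠ 0

/-- A continuous characteristic field of a foliation is as smooth as the tangent planes of the
foliation. -/
theorem contDiffOn_inChart_of_isTangentToSlices {m : WithTop ℕ∞}
    (hm : m + 1 ≤ (∞ : WithTop ℕ∞)) {U : Set M} (hX : X.IsClassOn 0 U)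
    (hfol : ∀ p ∈ U, ∃ f ∈ IsManifold.maximalAtlas (𝓡 3) (m + 1) M,
      p ∈ f.source ∧ f.source ⊆ U ∧ IsTangentToSlices P X f)
    {e : OpenPartialHomeomorph M E3} (he : e ∈ IsManifold.maximalAtlas (𝓡 3) ∞ M) :
    ContDiffOn ℝ m (X.inChart e) (e.target ∩ e.symm ⁻¹' U) := by
  rintro x ⟨hx, hxU⟩
  obtain ⟨f, hf, hpf, hfU, hft⟩ := hfol _ hxU
  have hm' : m ≤ (∞ : WithTop ℕ∞) := le_self_add.trans hm
  have h1m : (1 : WithTop ℕ∞) ≤ m + 1 := le_add_self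
  have he1 : e ∈ IsManifold.maximalAtlas (𝓡 3) 1 M :=
    IsManifold.maximalAtlas_subset_of_le one_le_infty he
  have hem : e ∈ IsManifold.maximalAtlas (𝓡 3) (m + 1) M :=
    IsManifold.maximalAtlas_subset_of_le hm he
  have h01 : (0 : WithTop ℕ∞) + 1 ≤ (∞ : WithTop ℕ∞) := by rw [zero_add]; exact one_le_infty
  have hD := isOpen_overlap e f
  have hsub : overlap e f ⊆ e.target ∩ e.symm ⁻¹' U := fun y hy => ⟨hy.1, hfU hy.2⟩
  have hτ : ContDiffOn ℝ (m + 1) (transition e f) (overlap e f) := contDiffOn_transition hem hf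
  have hβ : ∀ y ∈ overlap e f, ∀ v : E3, ((EuclideanSpace.proj 2 : E3 →L[ℝ] ℝ).comp
      (fderiv ℝ (transition e f) y)) (dChart e (e.symm y) v) = dChart f (e.symm y) v 2 := by
    intro y hy v
    rw [ContinuousLinearMap.comp_apply, fderiv_transition_dChart h1m hem hf hy]
    rfl
  have hα : ∀ y ∈ overlap e f, ∀ v : E3, P.Θ.inChart e y ![dChart e (e.symm y) v] =
      P.theta (e.symm y) ![v] := by
    intro y hy v
    rw [theta_inChart, dChartSymm_dChart' he1 le_rfl hy.1]
  refine ContDiffAt.contDiffWithinAt (ContDiffOn.contDiffAt ?_ (hD.mem_nhds ⟨hx, hpf⟩))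
  -- The two plane fields are the contact planes and the tangent planes of the slices. The latter
  -- are the kernels of the differential of the third foliated coordinate, of class C^m as f is of
  -- class C^(m+1).
  refine contDiffOn_of_unit hD (α := P.Θ.inChart e)
    (β := fun y => (EuclideanSpace.proj 2 : E3 →L[ℝ] ℝ).comp (fderiv ℝ (transition e f) y))
    (Ω := P.Θ.d.inChart e) (j := P.jChart e) ?_ ?_ ?_ ?_ ?_ ?_ ?_ ?_ ?_ ?_
  · exact ((P.Θ_smooth e he).of_le hm').mono fun y hy => ⟨hy.1, mem_univ _⟩
  · exact contDiffOn_const.clm_comp (hτ.fderiv_of_isOpen hD le_rfl)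
  · exact ((dtheta_isClassOn P e he).of_le hm').mono fun y hy => ⟨hy.1, mem_univ _⟩
  · exact ((contDiffOn_jChart P he).of_le hm').mono fun y hy => hy.1
  · exact ((hX.contDiffOn_inChart h01 (by rwa [zero_add])).continuousOn).mono hsub
  · exact fun y hy => (hα y hy _).trans (hft _ hy.2).1.1
  · exact fun y hy => (hβ y hy _).trans (hft _ hy.2).2.1
  · intro y hy
    rw [dtheta_inChart, dChartSymm_jChart P he1 hy.1, X.dChartSymm_inChart_vec he1 hy.1]
    exact (hft _ hy.2).1.2
  · intro y hy
    obtain ⟨v, hv, hv'⟩ := (hft _ hy.2).2.2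
    exact ⟨dChart e (e.symm y) v, (hβ y hy v).trans hv, by rwa [hα y hy]⟩
  · intro y hy h0
    have h := hβ y hy (dChartSymm f (f (e.symm y)) (stdVec 2))
    have h1 := dChart_dChartSymm hf h1m (f.map_source hy.2) (stdVec 2)
    rw [f.left_inv hy.2] at h1
    rw [h0, h1] at h
    simp at h

end FoliationField

/-! ### The Leibniz rule for a wedge product of 1-forms -/

section WedgeDerivative

theorem extDeriv_two_apply {g : E3 → E3 [⋀^Fin 2]→L[ℝ] ℝ} {x : E3} (hg : DifferentiableAt ℝ g x)
    (u v w : E3) : extDeriv g x ![u, v, w] = fderiv ℝ (fun y => g y ![v, w]) x u -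
      fderiv ℝ (fun y => g y ![u, w]) x v + fderiv ℝ (fun y => g y ![u, v]) x w := by
  rw [extDeriv_apply hg, Fin.sum_univ_three]
  have h0 : (0 : Fin 3).removeNth ![u, v, w] = ![v, w] := by funext i; fin_cases i <;> rfl
  have h1 : (1 : Fin 3).removeNth ![u, v, w] = ![u, w] := by funext i; fin_cases i <;> rfl
  have h2 : (2 : Fin 3).removeNth ![u, v, w] = ![u, v] := by funext i; fin_cases i <;> rfl
  rw [h0, h1, h2]
  simp
  ring

theorem extDeriv_wedge11 {a b : E3 → E3 [⋀^Fin 1]→L[ℝ] ℝ} {D : Set E3} (hD : IsOpen D)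
    (ha : ContDiffOn ℝ 1 a D) (hb : ContDiffOn ℝ 1 b D) {x : E3} (hx : x ∈ D) (u v w : E3) :
    extDeriv (fun y => wedge11 (a y) (b y)) x ![u, v, w] =
      (extDeriv a x ![u, v] * b x ![w] - extDeriv a x ![u, w] * b x ![v] +
        extDeriv a x ![v, w] * b x ![u]) -
      (a x ![u] * extDeriv b x ![v, w] - a x ![v] * extDeriv b x ![u, w] +
        a x ![w] * extDeriv b x ![u, v]) := by
  have hda : ∀ u : E3, DifferentiableAt ℝ (fun y => a y ![u]) x := fun u =>
    ((contDiffOn_alt1_iff.1 ha u).contDiffAt (hD.mem_nhds hx)).differentiableAt one_ne_zero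
  have hdb : ∀ u : E3, DifferentiableAt ℝ (fun y => b y ![u]) x := fun u =>
    ((contDiffOn_alt1_iff.1 hb u).contDiffAt (hD.mem_nhds hx)).differentiableAt one_ne_zero
  have hat := (ha.contDiffAt (hD.mem_nhds hx)).differentiableAt one_ne_zero
  have hbt := (hb.contDiffAt (hD.mem_nhds hx)).differentiableAt one_ne_zero
  have hwt := ((contDiffOn_wedge11 ha hb).contDiffAt (hD.mem_nhds hx)).differentiableAt one_ne_zero
  have hf : ∀ v w z : E3, fderiv ℝ (fun y => wedge11 (a y) (b y) ![v, w]) x z =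
      (a x ![v] * fderiv ℝ (fun y => b y ![w]) x z + b x ![w] * fderiv ℝ (fun y => a y ![v]) x z) -
      (a x ![w] * fderiv ℝ (fun y => b y ![v]) x z +
        b x ![v] * fderiv ℝ (fun y => a y ![w]) x z) := by
    intro v w z
    simp only [wedge11_apply]
    rw [fderiv_fun_sub ((hda v).fun_mul (hdb w)) ((hda w).fun_mul (hdb v)), fderiv_fun_mul (hda v) (hdb w),
      fderiv_fun_mul (hda w) (hdb v)]
    rfl
  rw [extDeriv_two_apply hwt, hf, hf, hf, extDeriv_one_apply hat, extDeriv_one_apply hat,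
    extDeriv_one_apply hat, extDeriv_one_apply hbt, extDeriv_one_apply hbt, extDeriv_one_apply hbt]
  ring

/-- A 2-form in terms of a frame `T, x, y` with dual coframe `θ, α, β`. -/
theorem alt2_frame (A : E3 [⋀^Fin 2]→L[ℝ] ℝ) {θ α β : E3 → ℝ} {T x y : E3}
    (h : ∀ v : E3, v = θ v • T + α v • x + β v • y) (u v : E3) :
    A ![u, v] = (θ u * α v - θ v * α u) * A ![T, x] + (θ u * β v - θ v * β u) * A ![T, y] +
      (α u * β v - α v * β u) * A ![x, y] := by
  conv_lhs => rw [h u, h v]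
  simp only [alt2_add_left, alt2_add_right, alt2_smul_left, alt2_smul_right, alt2_self,
    alt2_swap A x T, alt2_swap A y T, alt2_swap A y x]
  ring

end WedgeDerivative

/-! ### The pseudohermitian connection and closedness of Θ ∧ e¹ -/

section StructureEquations

variable {M : Type*} [TopologicalSpace M] [ChartedSpace E3 M] [IsManifold (𝓡 3) ∞ M]
  (P : PseudohermitianStructure M) {X : VField M} {V : Set M} {p : M}

/-- The form `e²` at a point, as a form on `ℝ³`. -/
def eTwo (X : VField M) (p : M) : E3 [⋀^Fin 1]→L[ℝ] ℝ := P.coframe₂ X p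

/-- The form `de¹` at a point, as a form on `ℝ³`. -/
def dOne (X : VField M) (p : M) : E3 [⋀^Fin 2]→L[ℝ] ℝ := (P.coframe₁ X).d p

/-- The form `de²` at a point, as a form on `ℝ³`. -/
def dTwo (X : VField M) (p : M) : E3 [⋀^Fin 2]→L[ℝ] ℝ := (P.coframe₂ X).d p

theorem eTwo_apply (X : VField M) (p : M) (w : E3) :
    eTwo P X p ![w] = (1 / 2) * P.dtheta p ![X.vec p, w] := rfl

theorem eTwo_inChart {e : OpenPartialHomeomorph M E3} (X : VField M) (x : E3) (u : E3) :
    (P.coframe₂ X).inChart e x ![u] = eTwo P X (e.symm x) ![dChartSymm e x u] :=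
  congrArg (eTwo P X (e.symm x)) (comp_vec1 (dChartSymm e x) u)

/-- A unitary frame `T, e₁, e₂` at a point. -/
theorem exists_frame_at (hX : P.IsUnitLegendrian p (X p)) :
    ∃ T : E3, P.theta p ![T] = 1 ∧ (∀ w : E3, P.dtheta p ![T, w] = 0) ∧
      ∀ v : E3, v = P.theta p ![v] • T + eOne P X p ![v] • X.vec p +
        eTwo P X p ![v] • P.jmap p (X.vec p) := by
  obtain ⟨T, h1, h2, h3⟩ := exists_unitary_frame P (x := X.vec p) hX
  refine ⟨T, h1, h2, fun v => ?_⟩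
  rw [eOne_apply, eTwo_apply]
  exact h3 v

/-- In the frame T, e₁, e₂ the terms with T vanish because T is in the kernel of dΘ, and dΘ(e₁, e₂)
= 2 because e₁ has Levi length one. -/
theorem dtheta_eq (hX : P.IsUnitLegendrian p (X p)) (u v : E3) : P.dtheta p ![u, v] =
    2 * (eOne P X p ![u] * eTwo P X p ![v] - eOne P X p ![v] * eTwo P X p ![u]) := by
  obtain ⟨T, h1, h2, h3⟩ := exists_frame_at P hX
  have h4 : P.dtheta p ![X.vec p, P.jmap p (X.vec p)] = 2 := by
    have : (1 / 2) * P.dtheta p ![X.vec p, P.jmap p (X.vec p)] = 1 := hX.2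
    linarith
  rw [alt2_frame (P.dtheta p) (θ := fun v => P.theta p ![v]) (α := fun v => eOne P X p ![v])
    (β := fun v => eTwo P X p ![v]) h3, h2, h2, h4]
  ring

variable (hV : IsOpen V) (hX : ∀ e ∈ IsManifold.maximalAtlas (𝓡 3) ∞ M,
  ContDiffOn ℝ 1 (X.inChart e) (e.target ∩ e.symm ⁻¹' V))
  (hXu : ∀ q ∈ V, P.IsUnitLegendrian q (X q)) (hp : p ∈ V)

theorem dChartSymm_chartAt (p : M) (u : E3) :
    dChartSymm (chartAt E3 p) (chartAt E3 p p) (dChart (chartAt E3 p) p u) = u :=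
  dChartSymm_dChart (chartAt_mem p one_le_infty) le_rfl (mem_chart_source _ _) u

theorem chartAt_symm_apply (p : M) : (chartAt E3 p).symm (chartAt E3 p p) = p :=
  (chartAt E3 p).left_inv (mem_chart_source _ _)

theorem dOne_apply (X : VField M) (p : M) (u v : E3) : dOne P X p ![u, v] =
    extDeriv ((P.coframe₁ X).inChart (chartAt E3 p)) (chartAt E3 p p)
      ![dChart (chartAt E3 p) p u, dChart (chartAt E3 p) p v] :=
  congrArg (extDeriv ((P.coframe₁ X).inChart (chartAt E3 p)) (chartAt E3 p p))
    (comp_vec2 (dChart (chartAt E3 p) p) u v)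

theorem dTwo_apply (X : VField M) (p : M) (u v : E3) : dTwo P X p ![u, v] =
    extDeriv ((P.coframe₂ X).inChart (chartAt E3 p)) (chartAt E3 p p)
      ![dChart (chartAt E3 p) p u, dChart (chartAt E3 p) p v] :=
  congrArg (extDeriv ((P.coframe₂ X).inChart (chartAt E3 p)) (chartAt E3 p p))
    (comp_vec2 (dChart (chartAt E3 p) p) u v)

theorem dtheta_apply (p : M) (u v : E3) : P.dtheta p ![u, v] =
    extDeriv (P.Θ.inChart (chartAt E3 p)) (chartAt E3 p p)
      ![dChart (chartAt E3 p) p u, dChart (chartAt E3 p) p v] :=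
  congrArg (extDeriv (P.Θ.inChart (chartAt E3 p)) (chartAt E3 p p))
    (comp_vec2 (dChart (chartAt E3 p) p) u v)

theorem eOne_chartAt (X : VField M) (p : M) (u : E3) :
    (P.coframe₁ X).inChart (chartAt E3 p) (chartAt E3 p p) ![dChart (chartAt E3 p) p u] =
      eOne P X p ![u] := by
  rw [eOne_inChart, dChartSymm_chartAt, chartAt_symm_apply]

theorem eTwo_chartAt (X : VField M) (p : M) (u : E3) :
    (P.coframe₂ X).inChart (chartAt E3 p) (chartAt E3 p p) ![dChart (chartAt E3 p) p u] =
      eTwo P X p ![u] := by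
  rw [eTwo_inChart, dChartSymm_chartAt, chartAt_symm_apply]

theorem theta_chartAt (p : M) (u : E3) :
    P.Θ.inChart (chartAt E3 p) (chartAt E3 p p) ![dChart (chartAt E3 p) p u] =
      P.theta p ![u] := by
  rw [theta_inChart, dChartSymm_chartAt, chartAt_symm_apply]

theorem chartAt_mem_inter (hp : p ∈ V) :
    chartAt E3 p p ∈ (chartAt E3 p).target ∩ (chartAt E3 p).symm ⁻¹' V :=
  ⟨mem_chart_target _ _, by rw [mem_preimage, chartAt_symm_apply]; exact hp⟩

include hV hX hXu hp in
/-- The equation `d(e¹ ∧ e²) = 0`. -/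
theorem d_coframe_wedge (u v w : E3) :
    (dOne P X p ![u, v] * eTwo P X p ![w] - dOne P X p ![u, w] * eTwo P X p ![v] +
        dOne P X p ![v, w] * eTwo P X p ![u]) -
      (eOne P X p ![u] * dTwo P X p ![v, w] - eOne P X p ![v] * dTwo P X p ![u, w] +
        eOne P X p ![w] * dTwo P X p ![u, v]) = 0 := by
  set c := chartAt E3 p with hc
  have hcm : c ∈ IsManifold.maximalAtlas (𝓡 3) ∞ M := chartAt_mem p le_rfl
  have hD := isOpen_target_inter c hV
  have hx : c p ∈ c.target ∩ c.symm ⁻¹' V := chartAt_mem_inter hp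
  have h := extDeriv_wedge11 hD (contDiffOn_coframe₁ P one_le_infty hcm (hX c hcm))
    (contDiffOn_coframe₂ P one_le_infty hcm (hX c hcm)) hx (dChart c p u) (dChart c p v)
    (dChart c p w)
  simp only [← dOne_apply, ← dTwo_apply, eOne_chartAt, eTwo_chartAt, hc] at h
  rw [← h]
  -- Near p the form 2 e¹ ∧ e² is dΘ, so its exterior derivative vanishes even though e¹ and e² are
  -- only of class C¹.
  have heq : extDeriv (P.Θ.inChart c) =ᶠ[𝓝 (c p)]
      (2 : ℝ) • fun y => wedge11 ((P.coframe₁ X).inChart c y) ((P.coframe₂ X).inChart c y) := by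
    filter_upwards [hD.mem_nhds hx] with y hy
    rw [← P.Θ_smooth.d_inChart (by exact one_le_infty) isOpen_univ
      (IsManifold.maximalAtlas_subset_of_le two_le_infty hcm) hy.1 (mem_univ _)]
    refine alt2_ext fun u v => ?_
    rw [dtheta_inChart, dtheta_eq P (hXu _ hy.2)]
    change _ = 2 * wedge11 _ _ ![u, v]
    rw [wedge11_apply, eOne_inChart, eOne_inChart, eTwo_inChart, eTwo_inChart]
  have h0 : extDeriv (extDeriv (P.Θ.inChart c)) (c p) = 0 := by
    have hcd : ContDiffAt ℝ ∞ (P.Θ.inChart c) (c p) :=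
      (P.Θ_smooth c hcm).contDiffAt ((isOpen_target_inter c isOpen_univ).mem_nhds
        ⟨hx.1, mem_univ _⟩)
    exact extDeriv_extDeriv_apply hcd (by simpa using two_le_infty)
  rw [heq.extDeriv_eq, extDeriv_smul] at h0
  have h1 := (smul_eq_zero.1 h0).resolve_left two_ne_zero
  exact congrArg (fun A : E3 [⋀^Fin 3]→L[ℝ] ℝ =>
    A ![dChart c p u, dChart c p v, dChart c p w]) h1

/-- The pointwise solution of the structure equation of the pseudohermitian connection. -/
theorem exists_structure_equation {θ α β : E3 [⋀^Fin 1]→L[ℝ] ℝ} {A B : E3 [⋀^Fin 2]→L[ℝ] ℝ}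
    {T x y : E3} (hxθ : θ ![x] = 0) (hxα : α ![x] = 1) (hxβ : β ![x] = 0) (h : ∀ v : E3, v = θ ![v] • T + α ![v] • x + β ![v] • y)
    (hAB : A ![T, x] + B ![T, y] = 0) :
    ∃ (η : E3 [⋀^Fin 1]→L[ℝ] ℝ) (a : ℂ), η ![x] = A ![x, y] ∧ ∀ u v : E3,
      (A ![u, v] : ℂ) + Complex.I * (B ![u, v] : ℂ) =
        (((α ![u] : ℂ) + Complex.I * (β ![u] : ℂ)) * (Complex.I * (η ![v] : ℂ)) -
          ((α ![v] : ℂ) + Complex.I * (β ![v] : ℂ)) * (Complex.I * (η ![u] : ℂ))) +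
        a * ((θ ![u] : ℂ) * (starRingEnd ℂ) ((α ![v] : ℂ) + Complex.I * (β ![v] : ℂ)) -
          (θ ![v] : ℂ) * (starRingEnd ℂ) ((α ![u] : ℂ) + Complex.I * (β ![u] : ℂ))) := by
  -- Obtained by comparing the coefficients of θ∧α, θ∧β and α∧β in the complex equation. The system
  -- is solvable exactly because of the trace condition `hAB`.
  refine ⟨((A ![T, y] - B ![T, x]) / 2) • θ + (A ![x, y]) • α + (B ![x, y]) • β,
    ⟨A ![T, x], (A ![T, y] + B ![T, x]) / 2⟩, ?_, fun u v => ?_⟩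
  · simp only [ContinuousAlternatingMap.add_apply, ContinuousAlternatingMap.smul_apply, hxθ, hxα,
      hxβ, smul_eq_mul]
    ring
  · have hA := alt2_frame A (θ := fun v => θ ![v]) (α := fun v => α ![v])
      (β := fun v => β ![v]) h u v
    have hB := alt2_frame B (θ := fun v => θ ![v]) (α := fun v => α ![v])
      (β := fun v => β ![v]) h u v
    have hB' : B ![T, y] = -A ![T, x] := by linarith
    rw [hA, hB, hB']
    simp only [ContinuousAlternatingMap.add_apply, ContinuousAlternatingMap.smul_apply,
      smul_eq_mul]
    apply Complex.ext <;> simp <;> ring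

include hV hX hXu in
/-- A unit Legendrian field of class `C¹` has a connection form, with `η(e₁) = de¹(e₁, e₂)`. -/
theorem exists_isConnectionForm : ∃ η : DForm 1 M, IsConnectionForm P V X η ∧
    ∀ p ∈ V, η p ![X p] = dOne P X p ![X.vec p, P.jmap p (X.vec p)] := by
  have key : ∀ p : M, ∃ (η : E3 [⋀^Fin 1]→L[ℝ] ℝ) (a : ℂ), p ∈ V →
      (η ![X.vec p] = dOne P X p ![X.vec p, P.jmap p (X.vec p)] ∧ ∀ u v : E3,
      (dOne P X p ![u, v] : ℂ) + Complex.I * (dTwo P X p ![u, v] : ℂ) =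
        (((eOne P X p ![u] : ℂ) + Complex.I * (eTwo P X p ![u] : ℂ)) *
            (Complex.I * (η ![v] : ℂ)) -
          ((eOne P X p ![v] : ℂ) + Complex.I * (eTwo P X p ![v] : ℂ)) *
            (Complex.I * (η ![u] : ℂ))) +
        a * ((P.theta p ![u] : ℂ) *
            (starRingEnd ℂ) ((eOne P X p ![v] : ℂ) + Complex.I * (eTwo P X p ![v] : ℂ)) -
          (P.theta p ![v] : ℂ) *
            (starRingEnd ℂ) ((eOne P X p ![u] : ℂ) + Complex.I * (eTwo P X p ![u] : ℂ)))) := by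
    intro p
    by_cases hp : p ∈ V
    · obtain ⟨T, h1, h2, h3⟩ := exists_frame_at P (hXu p hp)
      have hTα : eOne P X p ![T] = 0 := by rw [eOne_apply, h2, mul_zero]
      have hTβ : eTwo P X p ![T] = 0 := by rw [eTwo_apply, alt2_swap, h2]; simp
      have hxθ : P.theta p ![X.vec p] = 0 := (hXu p hp).1
      have hxα : eOne P X p ![X.vec p] = 1 := eOne_self P X (hXu p hp)
      have hxβ : eTwo P X p ![X.vec p] = 0 := by rw [eTwo_apply, alt2_self, mul_zero]
      have hyα : eOne P X p ![P.jmap p (X.vec p)] = 0 := by rw [eOne_apply, alt2_self, mul_zero]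
      have hyβ : eTwo P X p ![P.jmap p (X.vec p)] = 1 := (hXu p hp).2
      -- Evaluated on (T, e₁, e₂), the equation d(e¹ ∧ e²) = 0 becomes de¹(T, e₁) + de²(T, e₂) = 0,
      -- the solvability condition.
      have hd := d_coframe_wedge P hV hX hXu hp T (X.vec p) (P.jmap p (X.vec p))
      rw [hTα, hTβ, hxα, hxβ, hyα, hyβ] at hd
      obtain ⟨η, a, h4, h5⟩ := exists_structure_equation hxθ hxα hxβ h3
        (A := dOne P X p) (B := dTwo P X p) (by linarith)
      exact ⟨η, a, fun _ => ⟨h4, h5⟩⟩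
    · exact ⟨0, 0, fun h => absurd h hp⟩
  choose η a h using key
  exact ⟨η, ⟨a, fun p hp u v => (h p hp).2 u v⟩, fun p hp => (h p hp).1⟩

include hV hX hXu hp in
/-- If `de¹(e₁, e₂) = 0`, then the form `Θ ∧ e¹` is closed. -/
theorem d_areaForm_eq_zero (h : dOne P X p ![X.vec p, P.jmap p (X.vec p)] = 0) :
    (areaForm P X).d p = 0 := by
  set c := chartAt E3 p with hc
  have hcm : c ∈ IsManifold.maximalAtlas (𝓡 3) ∞ M := chartAt_mem p le_rfl
  have hD := isOpen_target_inter c hV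
  have hx : c p ∈ c.target ∩ c.symm ⁻¹' V := chartAt_mem_inter hp
  have hθ : ContDiffOn ℝ 1 (P.Θ.inChart c) (c.target ∩ c.symm ⁻¹' V) :=
    ((P.Θ_smooth c hcm).of_le one_le_infty).mono fun y hy => ⟨hy.1, mem_univ _⟩
  obtain ⟨T, h1, h2, h3⟩ := exists_frame_at P (hXu p hp)
  have hform : (areaForm P X).inChart c =
      fun y => wedge11 (P.Θ.inChart c y) ((P.coframe₁ X).inChart c y) :=
    funext fun y => areaForm_inChart P X y
  have hzero : ∀ u v w : E3, extDeriv ((areaForm P X).inChart c) (c p)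
      ![dChart c p u, dChart c p v, dChart c p w] = 0 := by
    intro u v w
    rw [hform, extDeriv_wedge11 hD hθ (contDiffOn_coframe₁ P one_le_infty hcm (hX c hcm)) hx]
    simp only [hc, ← dOne_apply, ← dtheta_apply, eOne_chartAt, theta_chartAt]
    have hA := alt2_frame (dOne P X p) (θ := fun v => P.theta p ![v])
      (α := fun v => eOne P X p ![v]) (β := fun v => eTwo P X p ![v]) h3
    -- dΘ ∧ e¹ = 2 e¹ ∧ e² ∧ e¹ = 0, and in Θ ∧ de¹ only the e¹ ∧ e² component of de¹ could survive,
    -- which is zero by `h`.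
    rw [hA u v, hA u w, hA v w, h, dtheta_eq P (hXu p hp), dtheta_eq P (hXu p hp),
      dtheta_eq P (hXu p hp)]
    ring
  have : ∀ z : Fin 3 → E3, ((areaForm P X).d p : E3 [⋀^Fin 3]→L[ℝ] ℝ) z = 0 := by
    intro z
    refine Eq.trans ?_ (hzero (z 0) (z 1) (z 2))
    refine congrArg (extDeriv ((areaForm P X).inChart c) (c p)) ?_
    funext i
    fin_cases i <;> rfl
  exact ContinuousAlternatingMap.ext this

end StructureEquations

/-! ### The calibration -/

section Calibration

variable {M : Type*} [TopologicalSpace M] [ChartedSpace E3 M] [IsManifold (𝓡 3) ∞ M]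
  (P : PseudohermitianStructure M) {X X' : VField M} {S S' U : Set M}

theorem VField.IsClassOn.mono {m : WithTop ℕ∞} (hX : X.IsClassOn m U) (h : S ⊆ U) :
    X.IsClassOn m S := ContMDiffOn.mono hX h

theorem isContinuousAlong_areaForm (hX : X.IsClassOn 0 U) (hSU : S ⊆ U) :
    IsContinuousAlong S (areaForm P X) := fun _ he =>
  continuousOn_areaForm P (hX.mono hSU) he.1

theorem isAreaForm_of_isCharacteristicField (hS : IsNonsingular P S)
    (hX : IsCharacteristicField P S X) : IsAreaForm S (areaForm P X) where
  cont := isContinuousAlong_areaForm P hX.1 subset_rfl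
  ne_zero _ he _ hx hx' := areaForm_density_ne_zero P he hS hX hx hx'

/-- The p-area form is an area form on each surface contained in a leaf. -/
theorem isAreaForm_of_subset_leaf {L : Set M} (hX : X.IsClassOn 0 U) (hSU : S ⊆ U) (hSL : S ⊆ L)
    (hfol : ∀ p ∈ U, ∃ f ∈ IsManifold.maximalAtlas (𝓡 3) 2 M, p ∈ f.source ∧
      IsTangentToSlices P X f ∧ ∃ C : Set ℝ, C.Countable ∧ ∀ q ∈ f.source, q ∈ L → f q 2 ∈ C) :
    IsAreaForm S (areaForm P X) where
  cont := isContinuousAlong_areaForm P hX hSU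
  ne_zero := by
    intro e he x hx hx'
    have hxS := he.symm_mem hx hx'
    obtain ⟨f, hf, hpf, hft, C, hC, hLC⟩ := hfol _ (hSU hxS)
    obtain ⟨h1, h2, v, hv, hv'⟩ := hft _ hpf
    have hiff := he.dChart_two_eq_zero_iff hf hC (fun q hq hqf => hLC q hqf (hSL hq))
      (e.map_target hx) hpf hxS
    exact areaForm_density_ne_zero_of_tangent P he.1 hx h1 ((hiff _).2 h2) ((hiff v).2 hv) hv'

theorem isTangentToSlices_of_isCharacteristicField {f : OpenPartialHomeomorph M E3}
    (hf : f ∈ IsManifold.maximalAtlas (𝓡 3) 2 M) (hns : ∀ c, IsNonsingular P (slice f c))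
    (hX : ∀ c, IsCharacteristicField P (slice f c) X) : IsTangentToSlices P X f := by
  intro q hq
  have h := (hX (f q 2)).2 q ⟨hq, rfl⟩
  exact ⟨h.1, (isTangent_slice_iff hf hq (X.vec q)).1 h.2,
    exists_dChart_eq_zero_theta_ne_zero P hf hq (hns _)⟩

/-- The form `Θ ∧ e¹` of a foliation by p-minimal surfaces is closed. -/
theorem d_areaForm_eq_zero_of_isPMinimal {f : OpenPartialHomeomorph M E3}
    (hns : ∀ c, IsNonsingular P (slice f c)) (hmin : ∀ c, IsPMinimal P (slice f c))
    (hX : ∀ c, IsCharacteristicField P (slice f c) X)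
    (hXc : ∀ e ∈ IsManifold.maximalAtlas (𝓡 3) ∞ M,
      ContDiffOn ℝ 1 (X.inChart e) (e.target ∩ e.symm ⁻¹' f.source))
    {p : M} (hp : p ∈ f.source) : (areaForm P X).d p = 0 := by
  have hXu : ∀ q ∈ f.source, P.IsUnitLegendrian q (X q) := fun q hq =>
    ((hX (f q 2)).2 q ⟨hq, rfl⟩).1
  refine d_areaForm_eq_zero P f.open_source hXc hXu hp ?_
  obtain ⟨η, hη, hη'⟩ := exists_isConnectionForm P f.open_source hXc hXu
  rw [← hη' p hp]
  -- The foliation field is itself a C¹ unit Legendrian extension of the characteristic field of the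
  -- slice, so η(e₁) is a p-mean curvature of the slice.
  refine hmin (f p 2) p ⟨hp, rfl⟩ (hns _ p ⟨hp, rfl⟩) _
    ⟨f.source, X, η, f.open_source, hp, ?_, hXu, fun q hq => ((hX _).2 q hq.2).2, hη, rfl⟩
  exact VField.isClassOn_of_inChart one_le_infty fun q hq =>
    hXc _ (chartAt_mem q le_rfl) _ (chartAt_mem_inter hq)

variable [MeasurableSpace M]

theorem pArea_eq_surfMeasure (S : Set M) (X : VField M) :
    pArea P S X = surfMeasure (areaForm P X) S S := by
  have h : ∀ e : OpenPartialHomeomorph M E3, chartPArea P X e = chartMeasure (areaForm P X) e := by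
    intro e
    unfold chartPArea chartMeasure
    congr 2
    funext y
    rw [DForm.density, areaForm_inChart_apply, areaAlt_apply]
    rfl
  unfold pArea pAreaMeasure surfMeasure
  simp only [h]

/-- The p-area form of a characteristic field of a surface calibrates the surface. -/
theorem formRatio_areaForm_le (hS' : IsSurface S') (hns : IsNonsingular P S')
    (hX' : IsCharacteristicField P S' X') {p : M} (hp : p ∈ S')
    (hX : P.IsUnitLegendrian p (X p)) :
    formRatio S' (areaForm P X) (areaForm P X') p ≤ 1 := by
  obtain ⟨e, he, hpe⟩ := hS' p hp
  have hx := e.map_source hpe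
  have hx' := he.apply_mem hpe hp
  rw [formRatio_eq (isAreaForm_of_isCharacteristicField P hns hX') he hpe hp,
    areaForm_density_eq P he hX' hx hx',
    mul_div_cancel_right₀ _ (areaForm_density_ne_zero P he hns hX' hx hx'), e.left_inv hpe]
  exact (le_abs_self _).trans (abs_eOne_le P X X' hX (hX'.2 p hp).1)

end Calibration

end PseudohermitianSurface

end

/-! ### The main theorem -/

open PseudohermitianSurface
theorem proposition6p2
    {M : Type*} [TopologicalSpace M] [T2Space M] [ParacompactSpace M]
    [ChartedSpace E3 M] [IsManifold (𝓡 3) ∞ M] [MeasurableSpace M] [BorelSpace M]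
    (P : PseudohermitianStructure M)
    (n : ℕ∞) (hn : 1 ≤ n)
    -- a foliation of the open set `U` by nonsingular p-minimal surfaces,
    -- with a characteristic field `e₁` along its leaves
    (U : Set M) (hU : IsOpen U)
    {ι : Type*} (F : ι → Set M) (hF : IsFoliation ((n + 1 : ℕ∞) : WithTop ℕ∞) U F)
    (hF_nonsing : ∀ e, IsFoliatedChart ((n + 1 : ℕ∞) : WithTop ℕ∞) U F e →
      ∀ c, IsNonsingular P (slice e c))
    (hF_min : ∀ e, IsFoliatedChart ((n + 1 : ℕ∞) : WithTop ℕ∞) U F e →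
      ∀ c, IsPMinimal P (slice e c))
    (e₁ : VField M) (he₁_cont : e₁.IsClassOn 0 U)
    (he₁ : ∀ e, IsFoliatedChart ((n + 1 : ℕ∞) : WithTop ℕ∞) U F e →
      ∀ c, IsCharacteristicField P (slice e c) e₁)
    -- every closed 2-form on `U` is exact
    (hPoincare : ∀ η : DForm 2 M, η.IsClassOn n U → (∀ p ∈ U, η.d p = 0) →
      ∃ Ψ : DForm 1 M, Ψ.IsClassOn n U ∧ ∀ p ∈ U, Ψ.d p = η p)
    -- the surface `S`, a compact piece of a leaf
    (S : Set M) (hS : IsSurface S) (hS_compact : IsCompact S) (i : ι) (hSF : S ⊆ F i)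
    -- the competing surface `S'`, with characteristic field `e₁'`
    (S' : Set M) (hS' : IsSurface S') (hS'_compact : IsCompact S') (hS'U : S' ⊆ U)
    (hS'_nonsing : IsNonsingular P S')
    (e₁' : VField M) (he₁' : IsCharacteristicField P S' e₁')
    (hbdry : SameOrientedBoundary P S e₁ S' e₁') :
    pArea P S e₁ ≤ pArea P S' e₁' := by
  have hk : ((n + 1 : ℕ∞) : WithTop ℕ∞) = (n : WithTop ℕ∞) + 1 := rfl
  have hn1 : (1 : WithTop ℕ∞) ≤ (n : WithTop ℕ∞) := by exact_mod_cast hn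
  have hk_le : (n : WithTop ℕ∞) + 1 ≤ (∞ : WithTop ℕ∞) := by
    rw [← hk]; exact WithTop.coe_le_coe.2 le_top
  have hn_le : (n : WithTop ℕ∞) ≤ (∞ : WithTop ℕ∞) := le_self_add.trans hk_le
  have h2k : (2 : WithTop ℕ∞) ≤ ((n + 1 : ℕ∞) : WithTop ℕ∞) := by
    rw [hk, ← one_add_one_eq_two]
    gcongr
  have hSU : S ⊆ U := hSF.trans (hF.iUnion_eq ▸ subset_iUnion F i)
  have hchart2 : ∀ {f}, IsFoliatedChart ((n + 1 : ℕ∞) : WithTop ℕ∞) U F f →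
      f ∈ IsManifold.maximalAtlas (𝓡 3) 2 M := fun hf =>
    IsManifold.maximalAtlas_subset_of_le h2k hf.1
  have htan : ∀ {f}, IsFoliatedChart ((n + 1 : ℕ∞) : WithTop ℕ∞) U F f →
      IsTangentToSlices P e₁ f := fun hf =>
    isTangentToSlices_of_isCharacteristicField P (hchart2 hf) (hF_nonsing _ hf) (he₁ _ hf)
  have hXc : ∀ e ∈ IsManifold.maximalAtlas (𝓡 3) ∞ M,
      ContDiffOn ℝ n (e₁.inChart e) (e.target ∩ e.symm ⁻¹' U) := fun e he =>
    contDiffOn_inChart_of_isTangentToSlices P hk_le he₁_cont (fun p hp => by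
      obtain ⟨f, hf, hpf⟩ := hF.exists_chart p hp
      exact ⟨f, hf.1, hpf, hf.2.1, htan hf⟩) he
  have hclass : (areaForm P e₁).IsClassOn n U := fun e he =>
    contDiffOn_areaForm P hn_le he (hXc e he)
  have hclosed : ∀ p ∈ U, (areaForm P e₁).d p = 0 := fun p hp => by
    obtain ⟨f, hf, hpf⟩ := hF.exists_chart p hp
    exact d_areaForm_eq_zero_of_isPMinimal P (hF_nonsing f hf) (hF_min f hf) (he₁ f hf)
      (fun e he => ((hXc e he).of_le hn1).mono
        (inter_subset_inter_right _ (preimage_mono hf.2.1))) hpf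
  have hunit : ∀ p ∈ U, P.IsUnitLegendrian p (e₁ p) := fun p hp => by
    obtain ⟨f, hf, hpf⟩ := hF.exists_chart p hp
    exact (htan hf p hpf).1
  -- Nonsingularity of S and tangency of e₁ to S are not assumed; both are inherited from the leaf
  -- through the foliated charts.
  have hσ : IsAreaForm S (areaForm P e₁) :=
    isAreaForm_of_subset_leaf P he₁_cont hSU hSF fun p hp => by
      obtain ⟨f, hf, hpf⟩ := hF.exists_chart p hp
      obtain ⟨C, hC, hiff⟩ := hf.2.2 i
      exact ⟨f, hchart2 hf, hpf, htan hf, C, hC, fun q hq hqF => (hiff q hq).1 hqF⟩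
  have hσ' := isAreaForm_of_isCharacteristicField P hS'_nonsing he₁'
  have hor : SameBoundaryOrientation S S' (areaForm P e₁) (areaForm P e₁') := by
    intro p hp w ν ν' h1 h2 h3 h4
    have h := hbdry.2 p hp w ν ν' h1 h2 h3 h4
    rw [← areaAlt_apply, ← areaAlt_apply] at h
    exact h
  obtain ⟨Ψ, hΨ, hΨd⟩ := hPoincare _ hclass hclosed
  have hΨ1 : Ψ.IsClassOn 1 U := fun e he => (hΨ e he).of_le hn1
  -- The calibration chain: area of S = ∫_S σ = ∫_S dΨ = ∫_S' dΨ = ∫_S' σ ≤ area of S'.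
  have key : (surfMeasure (areaForm P e₁) S S).toReal ≤
      (surfMeasure (areaForm P e₁') S' S').toReal := by
    rw [← surfIntegral_self hS hS_compact hσ,
      surfIntegral_congr hS hS_compact hσ fun p hp => (hΨd p (hSU hp)).symm,
      surfIntegral_d_eq_surfIntegral_d hS hS_compact hσ hS' hS'_compact hσ' hU hSU hS'U hbdry.1
        hor hΨ1,
      surfIntegral_congr hS' hS'_compact hσ' fun p hp => hΨd p (hS'U hp)]
    exact surfIntegral_le hS' hS'_compact hσ' (isContinuousAlong_areaForm P he₁_cont hS'U)
      fun p hp => formRatio_areaForm_le P hS' hS'_nonsing he₁' hp (hunit p (hS'U hp))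
  rw [pArea_eq_surfMeasure, pArea_eq_surfMeasure]
  exact (ENNReal.toReal_le_toReal (surfMeasure_lt_top hS hS_compact hσ).ne
    (surfMeasure_lt_top hS' hS'_compact hσ').ne).1 key
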